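/- Let $0<q<1$ and $[N]=(q^{-N}-q^{N})/(q^{-1}-q)$. Let $\mathcal A=\mathcal A(SU_q(2))$ be the $*$-algebra generated by $a,b$ with relations $ba=qab$, $b^*a=qab^*$, $bb^*=b^*b$, $a^*a+q^2b^*b=1$, $aa^*+bb^*=1$. *The spectral triple.* $\mathcal H$ is the Hilbert space with orthonormal basis $|j\mu n\uparrow\rangle$ ($j=0,\frac12,1,\dots$; $\mu=-j,\dots,j$; $n=-j-\frac12,\dots,j+\frac12$) and $|j\mu n\downarrow\rangle$ ($j=\frac12,1,\dots$; $\mu=-j,\dots,j$; $n=-j+\frac12,\dots,j-\frac12$). Write $j^\pm=j\pm\frac12$, $\mu^+=\mu+\frac12$, $n^\pm=n\pm\frac12$. The spinor representation is $\pi(a)=a_++a_-$, $\pi(b)=b_++b_-$, where $a_\pm|j\mu ns\rangle=\sum_{s'}(A_\pm)_{s's}|j^\pm\mu^+n^+s'\rangle$ and $b_\pm|j\mu ns\rangle=\sum_{s'}(B_\pm)_{s's}|j^\pm\mu^+n^-s'\rangle$ ($s,s'\in\{\uparrow,\downarrow\}$ in this order) with $$A_+=q^{(\mu+n-\frac12)/2}[j+\mu+1]^{\frac12}\begin{pmatrix}q^{-j-\frac12}\frac{[j+n+\frac32]^{1/2}}{[2j+2]}&0\\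 q^{\frac12}\frac{[j-n+\frac12]^{1/2}}{[2j+1][2j+2]}&q^{-j}\frac{[j+n+\frac12]^{1/2}}{[2j+1]}\end{pmatrix},$$ $$A_-=q^{(\mu+n-\frac12)/2}[j-\mu]^{\frac12}\begin{pmatrix}q^{j+1}\frac{[j-n+\frac12]^{1/2}}{[2j+1]}&-q^{\frac12}\frac{[j+n+\frac12]^{1/2}}{[2j][2j+1]}\\0&q^{j+\frac12}\frac{[j-n-\frac12]^{1/2}}{[2j]}\end{pmatrix},$$ $$B_+=q^{(\mu+n-\frac12)/2}[j+\mu+1]^{\frac12}\begin{pmatrix}\frac{[j-n+\frac32]^{1/2}}{[2j+2]}&0\\-q^{-j-1}\frac{[j+n+\frac12]^{1/2}}{[2j+1][2j+2]}&q^{-\frac12}\frac{[j-n+\frac12]^{1/2}}{[2j+1]}\end{pmatrix},$$ $$B_-=q^{(\mu+n-\frac12)/2}[j-\mu]^{\frac12}\begin{pmatrix}-q^{-\frac12}\frac{[j+n+\frac12]^{1/2}}{[2j+1]}&-q^{j}\frac{[j-n+\frac12]^{1/2}}{[2j][2j+1]}\\0&-\frac{[j+n-\frac12]^{1/2}}{[2j]}\end{pmatrix}.$$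 $D$ is the selfadjoint operator with $D|j\mu n\uparrow\rangle=(2j+\frac32)|j\mu n\uparrow\rangle$ and $D|j\mu n\downarrow\rangle=-(2j+\frac12)|j\mu n\downarrow\rangle$. $P^\uparrow,P^\downarrow$ are the projections onto the closed spans of the up and the down kets. Identify $x\in\mathcal A$ with $\pi(x)$ and put $\delta(T)=|D|T-T|D|$. Let $\mathcal B$ be the algebra generated by all $\delta^k(\mathcal A)$, and $\Psi^0(\mathcal A)$ the algebra generated by all $\delta^k(\mathcal A)$ and $\delta^k([D,\mathcal A])$, $k\ge0$. *Zeta functions.* For $T\in\Psi^0(\mathcal A)$ let $\zeta_T$ be the meromorphic continuation to $\mathbb C$ of $z\mapsto\operatorname{Tr}(T|D|^{-z})$, $\operatorname{Re}z>3$. The dimension spectrum is the set of all poles of all $\zeta_T$, $T\in\Psi^0(\mathcal A)$; it is simple if all these poles are simple. Put $⨍T|D|^{-k}=\operatorname{Res}_{z=0}\operatorname{Tr}(T|D|^{-k}|D|^{-z})$. *Symbols.* On $\ell^2(\mathbb N)$ with basis $(\varepsilon_x)_{x\ge0}$ let $\pi_\pm(a)\varepsilon_x=\sqrt{1-q^{2x+2}}\,\varepsilon_{x+1}$,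 $\pi_\pm(b)\varepsilon_x=\pm q^x\varepsilon_x$; let $\mathcal A(D^2_{q\pm})=\mathcal A/\ker\pi_\pm\cong\pi_\pm(\mathcal A)$ with quotient map $r_\pm$, and let $\mathcal A(S^1)$ be the Laurent polynomials in a unitary $u$. Let $\sigma:\mathcal A(D^2_{q\pm})\to\mathcal A(S^1)$ be the $*$-homomorphism with $\sigma(r_\pm(a))=u$, $\sigma(r_\pm(b))=0$, and on $\mathcal A(D^2_{q\pm})$ define $$\tau_1(x)=\frac1{2\pi}\int_{S^1}\sigma(x),\qquad \tau_0^\uparrow(x)=\lim_{N\to\infty}\big(\operatorname{Tr}_Nx-(N+\tfrac32)\tau_1(x)\big),\qquad \tau_0^\downarrow(x)=\lim_{N\to\infty}\big(\operatorname{Tr}_Nx-(N+\tfrac12)\tau_1(x)\big),$$ where $\operatorname{Tr}_N(x)=\sum_{k=0}^N\langle\varepsilon_k,x\varepsilon_k\rangle$. Let $\mathcal S=\mathcal A(D^2_{q+})\otimes\mathcal A(D^2_{q-})\otimes\mathcal A(S^1)$. For $s\in\mathcal S$, let $rs^0\in\mathcal A(D^2_{q+})\otimes\mathcal A(D^2_{q-})$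 be the coefficient of $u^0$. **Theorem.** 1. Every $\zeta_T$, $T\in\Psi^0(\mathcal A)$, exists ($T|D|^{-z}$ is of trace class for $\operatorname{Re}z>3$, and the trace continues meromorphically to $\mathbb C$), and the dimension spectrum of $(\mathcal A,\mathcal H,D)$ is simple and equal to $\{1,2,3\}$. 2. Let $\tilde a_\pm=P^\uparrow a_\pm P^\uparrow+P^\downarrow a_\pm P^\downarrow$ and $\tilde b_\pm=P^\uparrow b_\pm P^\uparrow+P^\downarrow b_\pm P^\downarrow$. These operators, $P^\downarrow a_+P^\uparrow+P^\uparrow a_-P^\downarrow$ and $P^\downarrow b_+P^\uparrow+P^\uparrow b_-P^\downarrow$ lie in $\mathcal B$, and there is a unique $*$-homomorphism $\rho:\mathcal B\to\mathcal S$, preserving units, which kills the last two and satisfies $$\rho(\tilde a_+)=r_+(a)\otimes r_-(a)\otimes u,\quad \rho(\tilde a_-)=-q\,r_+(b)\otimes r_-(b^*)\otimes u^*,\quad \rho(\tilde b_+)=-r_+(a)\otimes r_-(b)\otimes u,\quad \rho(\tilde b_-)=-r_+(b)\otimes r_-(a^*)\otimes u^*.$$ For all $T\in\mathcal B$, $$⨍T|D|^{-3}=2(\tau_1\otimes\tau_1)(r\rho(T)^0),$$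 $$⨍T|D|^{-2}=\big(\tau_1\otimes(\tau_0^\uparrow+\tau_0^\downarrow)+(\tau_0^\uparrow+\tau_0^\downarrow)\otimes\tau_1\big)(r\rho(T)^0),$$ $$⨍T|D|^{-1}=(\tau_0^\uparrow\otimes\tau_0^\downarrow+\tau_0^\downarrow\otimes\tau_0^\uparrow)(r\rho(T)^0).$$ 3. There is a unique unital homomorphism $(\rho^\uparrow,\rho^\downarrow):\Psi^0(\mathcal A)\to\mathcal S\times\mathcal S$ which is $(\rho(T),\rho(T))$ at each $T\in\mathcal B$; is $(\rho(T),0)$ at $P^\uparrow TP^\uparrow$ and $(0,\rho(T))$ at $P^\downarrow TP^\downarrow$ whenever $T\in\mathcal B$ and the corner lies in $\Psi^0(\mathcal A)$; and vanishes at each $T\in\Psi^0(\mathcal A)$ with $P^\uparrow TP^\uparrow+P^\downarrow TP^\downarrow=0$. For all $T\in\Psi^0(\mathcal A)$, $$⨍T|D|^{-3}=(\tau_1\otimes\tau_1)(r\rho^\uparrow(T)^0)+(\tau_1\otimes\tau_1)(r\rho^\downarrow(T)^0),$$ $$⨍T|D|^{-2}=(\tau_1\otimes\tau_0^\downarrow+\tau_0^\uparrow\otimes\tau_1)(r\rho^\uparrow(T)^0)+(\tau_1\otimes\tau_0^\uparrow+\tau_0^\downarrow\otimes\tau_1)(r\rho^\downarrow(T)^0),$$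 $$⨍T|D|^{-1}=(\tau_0^\uparrow\otimes\tau_0^\downarrow)(r\rho^\uparrow(T)^0)+(\tau_0^\downarrow\otimes\tau_0^\uparrow)(r\rho^\downarrow(T)^0).$$ -/

import Mathlib

open scoped lp TensorProduct LaurentPolynomial InnerProductSpace
open Filter Topology

noncomputable section
namespace SUq2

section Operators
variable {ι : Type*}

open Classical in
/-- The standard orthonormal basis of `ℓ²`. -/
def ket (i : ι) : ℓ²(ι, ℂ) := lp.single 2 i 1

/-- The bounded operator `T` has the matrix `M` in the standard basis: `⟨k, T l⟩ = M k l`. -/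
def HasMatrix (T : ℓ²(ι, ℂ) →L[ℂ] ℓ²(ι, ℂ)) (M : ι → ι → ℂ) : Prop :=
  ∀ k l, T (ket l) k = M k l

open Classical in
/-- The bounded operator with matrix `M` (the value is `0` if no bounded operator has that matrix;
this value does not occur for the operators used below, see the lemmas `hasMatrix_...`). -/
def ofMatrix (M : ι → ι → ℂ) : ℓ²(ι, ℂ) →L[ℂ] ℓ²(ι, ℂ) :=
  if h : ∃ T, HasMatrix T M then h.choose else 0

theorem ket_apply_self (i : ι) : ket i i = 1 := by
  classical
  simp [ket]

theorem ket_apply_ne {i j : ι} (h : j ≠ i) : ket i j = 0 := by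
  classical
  simp [ket, h]

theorem norm_ket (i : ι) : ‖ket i‖ = 1 := by
  classical
  simp [ket, lp.norm_single]

theorem HasMatrix.add {T S : ℓ²(ι, ℂ) →L[ℂ] ℓ²(ι, ℂ)} {M N : ι → ι → ℂ}
    (hT : HasMatrix T M) (hS : HasMatrix S N) : HasMatrix (T + S) (fun k l => M k l + N k l) := by
  intro k l
  simp [hT k l, hS k l]

theorem hasMatrix_ofMatrix {M : ι → ι → ℂ} (h : ∃ T, HasMatrix T M) : HasMatrix (ofMatrix M) M := by
  unfold ofMatrix
  rw [dif_pos h]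
  exact h.choose_spec

theorem exists_hasMatrix (M : ι → ι → ℂ) (C : ℝ) (hC : ∀ k l, ‖M k l‖ ≤ C)
    (hrow : ∀ k l l', M k l ≠ 0 → M k l' ≠ 0 → l = l')
    (hcol : ∀ k k' l, M k l ≠ 0 → M k' l ≠ 0 → k = k') : ∃ T, HasMatrix T M := by
  classical
  by_cases hι : IsEmpty ι
  · exact ⟨0, fun k => (hι.false k).elim⟩
  have hι' : Nonempty ι := not_isEmpty_iff.mp hι
  have hC0 : 0 ≤ C := (norm_nonneg _).trans (hC hι'.some hι'.some)
  choose r hr using fun k : ι => show ∃ r, ∀ l, M k l ≠ 0 → l = r by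
    by_cases h : ∃ l, M k l ≠ 0
    · exact ⟨h.choose, fun l hl => hrow k _ _ hl h.choose_spec⟩
    · exact ⟨k, fun l hl => (h ⟨l, hl⟩).elim⟩
  have key : ∀ (ψ : ℓ²(ι, ℂ)) (s : Finset ι),
      ∑ k ∈ s, ‖M k (r k) * ψ (r k)‖ ^ (2 : ENNReal).toReal ≤ (C * ‖ψ‖) ^ (2 : ENNReal).toReal := by
    intro ψ s
    have h2 : (2 : ENNReal).toReal = 2 := by simp
    have hinj : Set.InjOn r (s.filter fun k => M k (r k) ≠ 0 : Finset ι) := by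
      intro k hk k' hk' e
      simp only [Finset.coe_filter, Set.mem_ofPred_eq] at hk hk'
      refine hcol k k' (r k) hk.2 ?_
      rw [e]; exact hk'.2
    calc ∑ k ∈ s, ‖M k (r k) * ψ (r k)‖ ^ (2 : ENNReal).toReal
        = ∑ k ∈ s.filter (fun k => M k (r k) ≠ 0),
            ‖M k (r k) * ψ (r k)‖ ^ (2 : ENNReal).toReal := by
          symm
          apply Finset.sum_filter_of_ne
          intro k _ hk h0
          apply hk
          simp [h0]
      _ ≤ ∑ k ∈ s.filter (fun k => M k (r k) ≠ 0),
            C ^ (2 : ENNReal).toReal * ‖ψ (r k)‖ ^ (2 : ENNReal).toReal := by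
          apply Finset.sum_le_sum
          intro k _
          rw [norm_mul, Real.mul_rpow (norm_nonneg _) (norm_nonneg _)]
          gcongr
          exact hC _ _
      _ = C ^ (2 : ENNReal).toReal * ∑ k ∈ (s.filter fun k => M k (r k) ≠ 0).image r,
            ‖ψ k‖ ^ (2 : ENNReal).toReal := by
          rw [← Finset.mul_sum, Finset.sum_image hinj]
      _ ≤ C ^ (2 : ENNReal).toReal * ‖ψ‖ ^ (2 : ENNReal).toReal := by
          gcongr
          exact lp.sum_rpow_le_norm_rpow (by simp) ψ _
      _ = _ := (Real.mul_rpow hC0 (norm_nonneg _)).symm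
  let L : ℓ²(ι, ℂ) →ₗ[ℂ] ℓ²(ι, ℂ) :=
    { toFun := fun ψ => ⟨fun k => M k (r k) * ψ (r k), memℓp_gen' (key ψ)⟩
      map_add' := fun ψ φ => by
        apply lp.ext; funext k
        exact mul_add _ _ _
      map_smul' := fun c ψ => by
        apply lp.ext; funext k
        simp [mul_left_comm] }
  refine ⟨L.mkContinuous C fun ψ => ?_, ?_⟩
  · exact lp.norm_le_of_forall_sum_le (by simp) (by positivity) (key ψ)
  · intro k l
    change M k (r k) * ket l (r k) = M k l
    by_cases h : r k = l
    · rw [h, ket_apply_self, mul_one]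
    · rw [ket_apply_ne h, mul_zero]
      by_contra h0
      exact h (hr k l (Ne.symm h0)).symm

/-- The selfadjoint operator of multiplication by a real sequence, on its maximal domain. For
`lam` replaced by `|lam|` it is the absolute value of the operator for `lam`. -/
def diagOp (lam : ι → ℝ) : ℓ²(ι, ℂ) →ₗ.[ℂ] ℓ²(ι, ℂ) where
  domain :=
    { carrier := {ψ | Memℓp (fun i => (lam i : ℂ) * ψ i) 2}
      add_mem' := fun {ψ φ} hψ hφ => by
        have := Memℓp.add hψ hφ
        refine (congrArg (fun f : ι → ℂ => Memℓp f 2) ?_).mp this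
        funext i; simp [mul_add]
      zero_mem' := by
        refine (congrArg (fun f : ι → ℂ => Memℓp f 2) ?_).mp (zero_memℓp (E := fun _ : ι => ℂ))
        funext i; simp
      smul_mem' := fun c ψ hψ => by
        have := Memℓp.const_smul hψ c
        refine (congrArg (fun f : ι → ℂ => Memℓp f 2) ?_).mp this
        funext i; simp [mul_left_comm] }
  toFun :=
    { toFun := fun ψ => ⟨fun i => (lam i : ℂ) * ψ.1 i, ψ.2⟩
      map_add' := fun ψ φ => by
        apply lp.ext; funext i
        exact mul_add _ _ _
      map_smul' := fun c ψ => by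
        apply lp.ext; funext i
        simp [mul_left_comm] }

end Operators

section Disk

variable (q : Set.Ioo (0 : ℝ) 1) (ε : ℤˣ)

theorem HasMatrix.adjoint {ι : Type*} {T : ℓ²(ι, ℂ) →L[ℂ] ℓ²(ι, ℂ)} {M : ι → ι → ℂ}
    (hT : HasMatrix T M) : HasMatrix (star T) (fun k l => star (M l k)) := by
  classical
  have inner_ket : ∀ (k : ι) (ψ : ℓ²(ι, ℂ)), ⟪ket k, ψ⟫_ℂ = ψ k := by
    intro k ψ
    simp [ket, lp.inner_single_left]
  intro k l
  rw [← inner_ket, ContinuousLinearMap.star_eq_adjoint, ContinuousLinearMap.adjoint_inner_right,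
    ← inner_conj_symm, inner_ket, hT]
  rfl

/-- `π_±(a) ε_x = √(1 - q^(2x+2)) ε_{x+1}`. -/
def diskA : ℓ²(ℕ, ℂ) →L[ℂ] ℓ²(ℕ, ℂ) :=
  ofMatrix fun y x => if y = x + 1 then (√(1 - (q : ℝ) ^ (2 * x + 2)) : ℂ) else 0

/-- `π_±(b) ε_x = ± q^x ε_x`, with `ε` the sign `±1`. -/
def diskB : ℓ²(ℕ, ℂ) →L[ℂ] ℓ²(ℕ, ℂ) :=
  ofMatrix fun y x => if y = x then (ε : ℂ) * ((q : ℝ) : ℂ) ^ x else 0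

theorem hasMatrix_diskA : HasMatrix (diskA q)
    (fun y x => if y = x + 1 then ((√(1 - (q : ℝ) ^ (2 * x + 2)) : ℝ) : ℂ) else 0) := by
  have h0 := q.2.1
  have h1 := q.2.2
  refine hasMatrix_ofMatrix (exists_hasMatrix _ 1 ?_ ?_ ?_)
  · intro k l
    split_ifs
    · rw [Complex.norm_real, Real.norm_of_nonneg (Real.sqrt_nonneg _)]
      apply Real.sqrt_le_one.mpr
      have : 0 ≤ (q : ℝ) ^ (2 * l + 2) := by positivity
      linarith
    · simp
  · intro k l l' h h'
    simp only [ne_eq, ite_eq_right_iff, not_forall] at h h'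
    obtain ⟨h, -⟩ := h
    obtain ⟨h', -⟩ := h'
    omega
  · intro k k' l h h'
    simp only [ne_eq, ite_eq_right_iff, not_forall] at h h'
    obtain ⟨h, -⟩ := h
    obtain ⟨h', -⟩ := h'
    omega

theorem norm_sign_mul (x : ℕ) : ‖(ε : ℂ) * ((q : ℝ) : ℂ) ^ x‖ = (q : ℝ) ^ x := by
  have h0 := q.2.1
  rw [norm_mul, norm_pow, Complex.norm_real, Real.norm_of_nonneg h0.le]
  rcases Int.units_eq_one_or ε with rfl | rfl <;> simp

theorem hasMatrix_diskB : HasMatrix (diskB q ε)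
    (fun y x => if y = x then (ε : ℂ) * ((q : ℝ) : ℂ) ^ x else 0) := by
  have h0 := q.2.1
  have h1 := q.2.2
  refine hasMatrix_ofMatrix (exists_hasMatrix _ 1 ?_ ?_ ?_)
  · intro k l
    split_ifs
    · rw [norm_sign_mul]
      exact pow_le_one₀ h0.le h1.le
    · simp
  · intro k l l' h h'
    simp only [ne_eq, ite_eq_right_iff, not_forall] at h h'
    obtain ⟨h, -⟩ := h
    obtain ⟨h', -⟩ := h'
    omega
  · intro k k' l h h'
    simp only [ne_eq, ite_eq_right_iff, not_forall] at h h'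
    obtain ⟨h, -⟩ := h
    obtain ⟨h', -⟩ := h'
    omega

/-- `ε_n` for `n ≥ 0`, zero otherwise. -/
def intKet (n : ℤ) : ℓ²(ℕ, ℂ) := if 0 ≤ n then ket n.toNat else 0

/-- `Σ_k p_k ε_{n+k}`. -/
def laurentKet (p : ℂ[T;T⁻¹]) (n : ℤ) : ℓ²(ℕ, ℂ) :=
  Finsupp.linearCombination ℂ (fun k => intKet (n + k)) p.coeff

/-- `T ε_n = Σ_k p_k ε_{n+k}` up to an error `O(q^n)`: the symbol of `T` is `p`. -/
def IsAsymptotic (T : ℓ²(ℕ, ℂ) →L[ℂ] ℓ²(ℕ, ℂ)) (p : ℂ[T;T⁻¹]) : Prop :=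
  ∃ C : ℝ, 0 ≤ C ∧ ∀ n : ℤ, ‖T (intKet n) - laurentKet p n‖ ≤ C * (q : ℝ) ^ n

theorem laurentKet_add (p p' : ℂ[T;T⁻¹]) (n : ℤ) :
    laurentKet (p + p') n = laurentKet p n + laurentKet p' n := by
  simp [laurentKet]

theorem laurentKet_C_mul_T (c : ℂ) (k n : ℤ) :
    laurentKet (LaurentPolynomial.C c * LaurentPolynomial.T k) n = c • intKet (n + k) := by
  rw [← LaurentPolynomial.single_eq_C_mul_T]
  simp [laurentKet, -LaurentPolynomial.single_eq_C_mul_T]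

theorem laurentKet_mul (p p' : ℂ[T;T⁻¹]) (n : ℤ) :
    laurentKet (p * p') n =
      Finsupp.linearCombination ℂ (fun k => laurentKet p (n + k)) p'.coeff := by
  induction p' using LaurentPolynomial.induction_on' with
  | add f g hf hg => rw [mul_add, laurentKet_add, hf, hg]; simp
  | C_mul_T m c =>
    have : Finsupp.linearCombination ℂ (fun k => laurentKet p (n + k))
        (LaurentPolynomial.C c * LaurentPolynomial.T m : ℂ[T;T⁻¹]).coeff
        = c • laurentKet p (n + m) := by
      rw [← LaurentPolynomial.single_eq_C_mul_T]
      simp [-LaurentPolynomial.single_eq_C_mul_T]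
    rw [this]
    clear this
    induction p using LaurentPolynomial.induction_on' with
    | add f g hf hg => rw [add_mul, laurentKet_add, hf, hg, laurentKet_add, smul_add]
    | C_mul_T m' c' =>
      have : (LaurentPolynomial.C c' * LaurentPolynomial.T m' *
          (LaurentPolynomial.C c * LaurentPolynomial.T m) : ℂ[T;T⁻¹]) =
          LaurentPolynomial.C (c * c') * LaurentPolynomial.T (m + m') := by
        rw [map_mul, LaurentPolynomial.T_add]; ring
      rw [this, laurentKet_C_mul_T, laurentKet_C_mul_T, smul_smul, add_assoc]

theorem laurentKet_apply (p : ℂ[T;T⁻¹]) {n k : ℤ} (h : 0 ≤ n + k) :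
    laurentKet p n (n + k).toNat = p.coeff k := by
  induction p using LaurentPolynomial.induction_on' with
  | add f g hf hg => rw [laurentKet_add]; simp [hf, hg]
  | C_mul_T m c =>
    rw [laurentKet_C_mul_T, ← LaurentPolynomial.single_eq_C_mul_T]
    by_cases hm : m = k
    · subst hm
      simp [intKet, h, ket_apply_self, -LaurentPolynomial.single_eq_C_mul_T]
    · simp only [intKet]
      split_ifs with h'
      · have : (n + k).toNat ≠ (n + m).toNat := by omega
        simp [ket_apply_ne this, hm, -LaurentPolynomial.single_eq_C_mul_T]
      · simp [hm, -LaurentPolynomial.single_eq_C_mul_T]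

variable {q}

theorem IsAsymptotic.algebraMap (c : ℂ) :
    IsAsymptotic q (algebraMap ℂ _ c) (LaurentPolynomial.C c) := by
  refine ⟨0, le_rfl, fun n => ?_⟩
  have := laurentKet_C_mul_T c 0 n
  rw [LaurentPolynomial.T_zero, mul_one] at this
  simp [this, Algebra.algebraMap_eq_smul_one]

theorem IsAsymptotic.add {S T : ℓ²(ℕ, ℂ) →L[ℂ] ℓ²(ℕ, ℂ)} {p p' : ℂ[T;T⁻¹]}
    (hS : IsAsymptotic q S p) (hT : IsAsymptotic q T p') : IsAsymptotic q (S + T) (p + p') := by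
  obtain ⟨C, hC, h⟩ := hS
  obtain ⟨C', hC', h'⟩ := hT
  refine ⟨C + C', by positivity, fun n => ?_⟩
  have : (S + T) (intKet n) - laurentKet (p + p') n =
      (S (intKet n) - laurentKet p n) + (T (intKet n) - laurentKet p' n) := by
    rw [laurentKet_add, add_apply]; abel
  rw [this, add_mul]
  exact (norm_add_le _ _).trans (add_le_add (h n) (h' n))

theorem IsAsymptotic.mul {S T : ℓ²(ℕ, ℂ) →L[ℂ] ℓ²(ℕ, ℂ)} {p p' : ℂ[T;T⁻¹]}
    (hS : IsAsymptotic q S p) (hT : IsAsymptotic q T p') : IsAsymptotic q (S * T) (p * p') := by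
  obtain ⟨C, hC, h⟩ := hS
  obtain ⟨C', hC', h'⟩ := hT
  have hq : (0 : ℝ) < q := q.2.1
  refine ⟨‖S‖ * C' + ∑ k ∈ p'.coeff.support, ‖p'.coeff k‖ * (C * (q : ℝ) ^ k), by positivity,
    fun n => ?_⟩
  have : (S * T) (intKet n) - laurentKet (p * p') n =
      S (T (intKet n) - laurentKet p' n) +
        ∑ k ∈ p'.coeff.support, p'.coeff k • (S (intKet (n + k)) - laurentKet p (n + k)) := by
    rw [laurentKet_mul]
    simp only [laurentKet, Finsupp.linearCombination_apply, Finsupp.sum, map_sub, map_sum,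
      map_smul, smul_sub, Finset.sum_sub_distrib, mul_apply_eq_comp]
    abel
  rw [this, add_mul]
  refine (norm_add_le _ _).trans (add_le_add ?_ ?_)
  · refine (S.le_opNorm _).trans ?_
    rw [mul_assoc]
    exact mul_le_mul_of_nonneg_left (h' n) (norm_nonneg _)
  · rw [Finset.sum_mul]
    refine (norm_sum_le _ _).trans (Finset.sum_le_sum fun k _ => ?_)
    rw [norm_smul, mul_assoc]
    refine mul_le_mul_of_nonneg_left ?_ (norm_nonneg _)
    refine (h (n + k)).trans (le_of_eq ?_)
    rw [zpow_add₀ hq.ne']; ring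

theorem IsAsymptotic.coeff_bound {T : ℓ²(ℕ, ℂ) →L[ℂ] ℓ²(ℕ, ℂ)} {p : ℂ[T;T⁻¹]}
    (hT : IsAsymptotic q T p) (k : ℤ) : ∃ C : ℝ, 0 ≤ C ∧ ∀ n : ℤ, 0 ≤ n + k →
      ‖T (intKet n) (n + k).toNat - p.coeff k‖ ≤ C * (q : ℝ) ^ n := by
  obtain ⟨C, hC, h⟩ := hT
  refine ⟨C, hC, fun n hn => ?_⟩
  rw [← laurentKet_apply p hn]
  exact (lp.norm_apply_le_norm (by simp) (T (intKet n) - laurentKet p n) _).trans (h n)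

theorem IsAsymptotic.unique {T : ℓ²(ℕ, ℂ) →L[ℂ] ℓ²(ℕ, ℂ)} {p p' : ℂ[T;T⁻¹]}
    (h : IsAsymptotic q T p) (h' : IsAsymptotic q T p') : p = p' := by
  apply LaurentPolynomial.ext
  intro k
  have key : ∀ {p : ℂ[T;T⁻¹]}, IsAsymptotic q T p →
      Tendsto (fun n : ℕ => T (intKet n) (n + k).toNat) atTop (𝓝 (p.coeff k)) := by
    intro p h
    obtain ⟨C, hC, hb⟩ := h.coeff_bound k
    rw [tendsto_iff_norm_sub_tendsto_zero]
    have h0 : Tendsto (fun n : ℕ => C * (q : ℝ) ^ n) atTop (𝓝 0) := by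
      simpa using (tendsto_pow_atTop_nhds_zero_of_lt_one q.2.1.le q.2.2).const_mul C
    refine squeeze_zero' (Eventually.of_forall fun n => norm_nonneg _) ?_ h0
    filter_upwards [eventually_ge_atTop k.natAbs] with n hn
    have := hb n (by omega)
    simpa using this
  exact tendsto_nhds_unique (key h) (key h')

theorem intKet_natCast (n : ℕ) : intKet n = ket n := by simp [intKet]

theorem intKet_neg {n : ℤ} (h : n < 0) : intKet n = 0 := by simp [intKet, not_le.mpr h]

theorem apply_ket_eq {T : ℓ²(ℕ, ℂ) →L[ℂ] ℓ²(ℕ, ℂ)} {M : ℕ → ℕ → ℂ} (hT : HasMatrix T M)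
    (n m : ℕ) (c : ℂ) (h : ∀ k, M k n = if k = m then c else 0) : T (ket n) = c • ket m := by
  apply lp.ext
  funext k
  rw [hT, h]
  split_ifs with hk
  · subst hk; simp [ket_apply_self]
  · simp [ket_apply_ne hk]

theorem abs_sqrt_sub_one {t : ℝ} (h0 : 0 ≤ t) (h1 : t ≤ 1) : |√(1 - t) - 1| ≤ t := by
  have hs : √(1 - t) ≤ 1 := Real.sqrt_le_one.mpr (by linarith)
  have hn := Real.sqrt_nonneg (1 - t)
  have hsq : √(1 - t) ^ 2 = 1 - t := Real.sq_sqrt (by linarith)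
  rw [abs_le]
  constructor <;> nlinarith

theorem isAsymptotic_of {T : ℓ²(ℕ, ℂ) →L[ℂ] ℓ²(ℕ, ℂ)} {p : ℂ[T;T⁻¹]} (C : ℝ) (hC : 0 ≤ C)
    (hpos : ∀ n : ℕ, ‖T (ket n) - laurentKet p n‖ ≤ C * (q : ℝ) ^ n)
    (hneg : ∀ n : ℤ, n < 0 → ‖laurentKet p n‖ ≤ C) : IsAsymptotic q T p := by
  refine ⟨C, hC, fun n => ?_⟩
  rcases lt_or_ge n 0 with h | h
  · rw [intKet_neg h, map_zero, zero_sub, norm_neg]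
    refine (hneg n h).trans ?_
    have : (1 : ℝ) ≤ (q : ℝ) ^ n := by
      obtain ⟨m, rfl⟩ : ∃ m : ℕ, n = -m := ⟨n.natAbs, by omega⟩
      rw [zpow_neg, zpow_natCast]
      exact (one_le_inv₀ (pow_pos q.2.1 _)).mpr (pow_le_one₀ q.2.1.le q.2.2.le)
    exact le_mul_of_one_le_right hC this
  · lift n to ℕ using h
    rw [intKet_natCast]
    simpa using hpos n

theorem norm_intKet_le (n : ℤ) : ‖intKet n‖ ≤ 1 := by
  unfold intKet
  split_ifs
  · rw [norm_ket]
  · simp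

theorem laurentKet_T (k n : ℤ) : laurentKet (LaurentPolynomial.T k) n = intKet (n + k) := by
  simpa using laurentKet_C_mul_T 1 k n

theorem isAsymptotic_diskA : IsAsymptotic q (diskA q) (LaurentPolynomial.T 1) := by
  have h0 := q.2.1
  have h1 := q.2.2
  refine isAsymptotic_of 1 zero_le_one (fun n => ?_) (fun n _ => ?_)
  · rw [apply_ket_eq (hasMatrix_diskA q) n (n + 1) _ (fun k => rfl), laurentKet_T,
      show ((n : ℤ) + 1) = ((n + 1 : ℕ) : ℤ) by push_cast; rfl, intKet_natCast]
    have : ∀ c : ℂ, c • ket (n + 1) - ket (n + 1) = (c - 1) • ket (n + 1) := by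
      intro c; rw [sub_smul, one_smul]
    rw [this, norm_smul, norm_ket, mul_one, one_mul, ← Complex.ofReal_one, ← Complex.ofReal_sub,
      Complex.norm_real, Real.norm_eq_abs]
    refine (abs_sqrt_sub_one (by positivity) (pow_le_one₀ h0.le h1.le)).trans ?_
    exact pow_le_pow_of_le_one h0.le h1.le (by omega)
  · rw [laurentKet_T]; exact norm_intKet_le _

theorem isAsymptotic_star_diskA :
    IsAsymptotic q (star (diskA q)) (LaurentPolynomial.T (-1)) := by
  have h0 := q.2.1
  have h1 := q.2.2
  refine isAsymptotic_of 1 zero_le_one (fun n => ?_) (fun n _ => ?_)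
  · rw [laurentKet_T]
    rcases n with _ | n
    · rw [apply_ket_eq (hasMatrix_diskA q).adjoint 0 0 0 (fun k => by simp), intKet_neg (by simp)]
      simp
    · rw [apply_ket_eq (hasMatrix_diskA q).adjoint (n + 1) n
        ((√(1 - (q : ℝ) ^ (2 * n + 2)) : ℝ) : ℂ) (fun k => ?_),
        show (((n + 1 : ℕ) : ℤ) + -1) = (n : ℤ) by push_cast; ring, intKet_natCast]
      · have : ∀ c : ℂ, c • ket n - ket n = (c - 1) • ket n := by
          intro c; rw [sub_smul, one_smul]
        rw [this, norm_smul, norm_ket, mul_one, one_mul, ← Complex.ofReal_one,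
          ← Complex.ofReal_sub, Complex.norm_real, Real.norm_eq_abs]
        refine (abs_sqrt_sub_one (by positivity) (pow_le_one₀ h0.le h1.le)).trans ?_
        exact pow_le_pow_of_le_one h0.le h1.le (by omega)
      · by_cases hk : k = n
        · subst hk; simp
        · have : ¬ (n + 1 = k + 1) := by omega
          rw [if_neg this, if_neg hk, star_zero]
  · rw [laurentKet_T]; exact norm_intKet_le _

theorem isAsymptotic_diskB : IsAsymptotic q (diskB q ε) 0 := by
  refine isAsymptotic_of 1 zero_le_one (fun n => ?_) (fun n _ => ?_)
  · rw [apply_ket_eq (hasMatrix_diskB q ε) n n ((ε : ℂ) * ((q : ℝ) : ℂ) ^ n) (fun k => by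
      by_cases hk : k = n <;> simp [hk])]
    simp only [laurentKet, AddMonoidAlgebra.coeff_zero, map_zero, sub_zero]
    rw [norm_smul, norm_ket, mul_one, one_mul, norm_sign_mul]
  · simp [laurentKet]

theorem isAsymptotic_star_diskB : IsAsymptotic q (star (diskB q ε)) 0 := by
  refine isAsymptotic_of 1 zero_le_one (fun n => ?_) (fun n _ => ?_)
  · rw [apply_ket_eq (hasMatrix_diskB q ε).adjoint n n (star ((ε : ℂ) * ((q : ℝ) : ℂ) ^ n))
      (fun k => by
        by_cases hk : k = n
        · simp [hk]
        · simp [hk, Ne.symm hk])]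
    simp only [laurentKet, AddMonoidAlgebra.coeff_zero, map_zero, sub_zero]
    rw [norm_smul, norm_ket, mul_one, one_mul, norm_star, norm_sign_mul]
  · simp [laurentKet]

variable (q)

/-- `𝒜(D²_{q±}) = 𝒜(SU_q(2)) / ker π_±`, realised as the image of `π_±`: the `*`-algebra generated by
`π_±(a)` and `π_±(b)`. -/
def disk : StarSubalgebra ℂ (ℓ²(ℕ, ℂ) →L[ℂ] ℓ²(ℕ, ℂ)) :=
  StarAlgebra.adjoin ℂ {diskA q, diskB q ε}

/-- `r_±(a)`. -/
def rA : disk q ε := ⟨diskA q, StarAlgebra.subset_adjoin ℂ _ (by simp)⟩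

/-- `r_±(b)`. -/
def rB : disk q ε := ⟨diskB q ε, StarAlgebra.subset_adjoin ℂ _ (by simp)⟩

variable {q ε}

theorem exists_isAsymptotic {T : ℓ²(ℕ, ℂ) →L[ℂ] ℓ²(ℕ, ℂ)} (hT : T ∈ disk q ε) :
    ∃ p, IsAsymptotic q T p := by
  have hT' : T ∈ Algebra.adjoin ℂ
      ({diskA q, diskB q ε} ∪ star {diskA q, diskB q ε} :
        Set (ℓ²(ℕ, ℂ) →L[ℂ] ℓ²(ℕ, ℂ))) := by
    rw [← StarAlgebra.adjoin_toSubalgebra]; exact hT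
  clear hT
  induction hT' using Algebra.adjoin_induction with
  | mem x hx =>
    simp only [Set.mem_union, Set.mem_insert_iff, Set.mem_singleton_iff, Set.mem_star] at hx
    rcases hx with (rfl | rfl) | (hx | hx)
    · exact ⟨_, isAsymptotic_diskA⟩
    · exact ⟨_, isAsymptotic_diskB ε⟩
    · rw [← star_star x, hx]; exact ⟨_, isAsymptotic_star_diskA⟩
    · rw [← star_star x, hx]; exact ⟨_, isAsymptotic_star_diskB ε⟩
  | algebraMap c => exact ⟨_, IsAsymptotic.algebraMap c⟩
  | add x y _ _ ihx ihy =>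
    obtain ⟨p, hp⟩ := ihx
    obtain ⟨p', hp'⟩ := ihy
    exact ⟨_, hp.add hp'⟩
  | mul x y _ _ ihx ihy =>
    obtain ⟨p, hp⟩ := ihx
    obtain ⟨p', hp'⟩ := ihy
    exact ⟨_, hp.mul hp'⟩

variable (q ε)

/-- The symbol map `σ : 𝒜(D²_{q±}) → 𝒜(S¹)`, with `𝒜(S¹)` the Laurent polynomials in the unitary
generator `u = T 1`; it is determined by `σ(r(a)) = u`, `σ(r(a)*) = u*`, `σ(r(b)) = σ(r(b)*) = 0`,
see the four lemmas below. -/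
def symbol : disk q ε →ₐ[ℂ] ℂ[T;T⁻¹] where
  toFun x := (exists_isAsymptotic x.2).choose
  map_one' := (exists_isAsymptotic (1 : disk q ε).2).choose_spec.unique (by
    simpa using IsAsymptotic.algebraMap (q := q) 1)
  map_mul' x y := (exists_isAsymptotic (x * y).2).choose_spec.unique
    ((exists_isAsymptotic x.2).choose_spec.mul (exists_isAsymptotic y.2).choose_spec)
  map_zero' := (exists_isAsymptotic (0 : disk q ε).2).choose_spec.unique (by
    simpa using IsAsymptotic.algebraMap (q := q) 0)
  map_add' x y := (exists_isAsymptotic (x + y).2).choose_spec.unique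
    ((exists_isAsymptotic x.2).choose_spec.add (exists_isAsymptotic y.2).choose_spec)
  commutes' c := (exists_isAsymptotic (algebraMap ℂ (disk q ε) c).2).choose_spec.unique
    (IsAsymptotic.algebraMap c)

variable {q ε}

theorem isAsymptotic_symbol (x : disk q ε) : IsAsymptotic q x (symbol q ε x) :=
  (exists_isAsymptotic x.2).choose_spec

theorem symbol_rA : symbol q ε (rA q ε) = LaurentPolynomial.T 1 :=
  (isAsymptotic_symbol _).unique isAsymptotic_diskA

theorem symbol_star_rA : symbol q ε (star (rA q ε)) = LaurentPolynomial.T (-1) :=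
  (isAsymptotic_symbol _).unique isAsymptotic_star_diskA

theorem symbol_rB : symbol q ε (rB q ε) = 0 :=
  (isAsymptotic_symbol _).unique (isAsymptotic_diskB ε)

theorem symbol_star_rB : symbol q ε (star (rB q ε)) = 0 :=
  (isAsymptotic_symbol _).unique (isAsymptotic_star_diskB ε)

variable (q ε)

/-- `τ₁(x) = (2π)⁻¹ ∫_{S¹} σ(x)`: the normalised integral of a Laurent polynomial over the circle is
its constant coefficient. -/
def tau1 : disk q ε →ₗ[ℂ] ℂ where
  toFun x := (symbol q ε x).coeff 0
  map_add' x y := by simp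
  map_smul' c x := by simp

variable {q ε} in
/-- `Tr_N`, the truncated trace over `ε_0, …, ε_N`. -/
def truncTrace (N : ℕ) (x : disk q ε) : ℂ :=
  ∑ k ∈ Finset.range (N + 1), ⟪ket k, (x : ℓ²(ℕ, ℂ) →L[ℂ] ℓ²(ℕ, ℂ)) (ket k)⟫_ℂ

theorem inner_ket {ι : Type*} (k : ι) (ψ : ℓ²(ι, ℂ)) : ⟪ket k, ψ⟫_ℂ = ψ k := by
  classical
  simp [ket, lp.inner_single_left]

variable {q ε} in
theorem exists_tendsto_truncTrace (c : ℂ) (x : disk q ε) :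
    ∃ l, Tendsto (fun N : ℕ => truncTrace N x - (N + c) * tau1 q ε x) atTop (𝓝 l) := by
  obtain ⟨C, hC, h⟩ := (isAsymptotic_symbol x).coeff_bound 0
  have hs : Summable fun k : ℕ =>
      ⟪ket k, (x : ℓ²(ℕ, ℂ) →L[ℂ] ℓ²(ℕ, ℂ)) (ket k)⟫_ℂ - tau1 q ε x := by
    refine Summable.of_norm_bounded
      ((summable_geometric_of_lt_one q.2.1.le q.2.2).mul_left C) fun k => ?_
    have := h k (by simp)
    rw [inner_ket]
    simpa [intKet_natCast, tau1] using this
  have ht := ((tendsto_add_atTop_iff_nat 1).mpr hs.hasSum.tendsto_sum_nat).sub_const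
    ((c - 1) * tau1 q ε x)
  refine ⟨_, ht.congr fun N => ?_⟩
  rw [Finset.sum_sub_distrib, truncTrace]
  simp
  ring

/-- `lim_N (Tr_N x - (N + c) τ₁(x))`; the limit exists, see `tendsto_tau0`. -/
def tau0 (c : ℂ) : disk q ε →ₗ[ℂ] ℂ where
  toFun x := limUnder atTop fun N : ℕ => truncTrace N x - (N + c) * tau1 q ε x
  map_add' x y := by
    obtain ⟨l, hl⟩ := exists_tendsto_truncTrace c x
    obtain ⟨m, hm⟩ := exists_tendsto_truncTrace c y
    rw [hl.limUnder_eq, hm.limUnder_eq]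
    refine Tendsto.limUnder_eq ((hl.add hm).congr fun N => ?_)
    simp only [truncTrace, map_add, AddMemClass.coe_add, add_apply, inner_add_right,
      Finset.sum_add_distrib]
    ring
  map_smul' a x := by
    obtain ⟨l, hl⟩ := exists_tendsto_truncTrace c x
    rw [hl.limUnder_eq]
    refine Tendsto.limUnder_eq ((hl.const_mul a).congr fun N => ?_)
    simp only [truncTrace, map_smul, smul_eq_mul, SetLike.val_smul,
      smul_apply, inner_smul_right, ← Finset.mul_sum]
    ring

theorem tendsto_tau0 (c : ℂ) (x : disk q ε) :
    Tendsto (fun N : ℕ => truncTrace N x - (N + c) * tau1 q ε x) atTop (𝓝 (tau0 q ε c x)) := by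
  obtain ⟨l, hl⟩ := exists_tendsto_truncTrace c x
  have : tau0 q ε c x = l := hl.limUnder_eq
  rwa [this]

end Disk

section Generic
variable {ι : Type*}

/-- Hilbert-Schmidt operators; the sum does not depend on the orthonormal basis. -/
def IsHilbertSchmidt (T : ℓ²(ι, ℂ) →L[ℂ] ℓ²(ι, ℂ)) : Prop :=
  Summable fun i => ‖T (ket i)‖ ^ 2

/-- Trace class operators are the products of two Hilbert-Schmidt operators. -/
def IsTraceClass (T : ℓ²(ι, ℂ) →L[ℂ] ℓ²(ι, ℂ)) : Prop :=
  ∃ R S : ℓ²(ι, ℂ) →L[ℂ] ℓ²(ι, ℂ), IsHilbertSchmidt R ∧ IsHilbertSchmidt S ∧ T = R * S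

/-- The trace of a trace class operator. -/
def trace (T : ℓ²(ι, ℂ) →L[ℂ] ℓ²(ι, ℂ)) : ℂ := ∑' i, ⟪ket i, T (ket i)⟫_ℂ

/-- `T` preserves the domain of `D` and `[D, T] = D T - T D` extends to the bounded operator `S`. -/
def IsCommutator (D : ℓ²(ι, ℂ) →ₗ.[ℂ] ℓ²(ι, ℂ)) (T S : ℓ²(ι, ℂ) →L[ℂ] ℓ²(ι, ℂ)) : Prop :=
  ∀ ψ : D.domain, ∃ h : T ψ ∈ D.domain, D ⟨T ψ, h⟩ - T (D ψ) = S ψ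

/-- The operators `δⁿ(T)`, `T ∈ G`, `n ≥ 0`, where `δ(T) = |D| T - T |D|` and `D` is multiplication
by `lam`. -/
inductive DeltaOrbit (lam : ι → ℝ) (G : Set (ℓ²(ι, ℂ) →L[ℂ] ℓ²(ι, ℂ))) :
    (ℓ²(ι, ℂ) →L[ℂ] ℓ²(ι, ℂ)) → Prop
  | base {T} : T ∈ G → DeltaOrbit lam G T
  | step {T S} : DeltaOrbit lam G T → IsCommutator (diagOp fun i => |lam i|) T S →
      DeltaOrbit lam G S

/-- The algebra generated by all `δⁿ(A)`. -/
def deltaAlgebra (lam : ι → ℝ) (A : Set (ℓ²(ι, ℂ) →L[ℂ] ℓ²(ι, ℂ))) :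
    Subalgebra ℂ (ℓ²(ι, ℂ) →L[ℂ] ℓ²(ι, ℂ)) :=
  Algebra.adjoin ℂ {T | DeltaOrbit lam A T}

/-- The algebra `Ψ⁰(A)` generated by all `δⁿ(A)` and `δⁿ([D, A])`. -/
def psiZero (lam : ι → ℝ) (A : Set (ℓ²(ι, ℂ) →L[ℂ] ℓ²(ι, ℂ))) :
    Subalgebra ℂ (ℓ²(ι, ℂ) →L[ℂ] ℓ²(ι, ℂ)) :=
  Algebra.adjoin ℂ {T | DeltaOrbit lam (A ∪ {S | ∃ T ∈ A, IsCommutator (diagOp lam) T S}) T}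

open Classical in
/-- The complex power `|D|^w` (bounded in all cases used below). -/
def absPow (lam : ι → ℝ) (w : ℂ) : ℓ²(ι, ℂ) →L[ℂ] ℓ²(ι, ℂ) :=
  ofMatrix fun k l => if k = l then ((|lam l| : ℝ) : ℂ) ^ w else 0

open Classical in
theorem hasMatrix_absPow {lam : ι → ℝ} (hlam : ∀ i, 1 ≤ |lam i|) {w : ℂ} (hw : w.re ≤ 0) :
    HasMatrix (absPow lam w) fun k l => if k = l then ((|lam l| : ℝ) : ℂ) ^ w else 0 := by
  refine hasMatrix_ofMatrix (exists_hasMatrix _ 1 ?_ ?_ ?_)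
  · intro k l
    split_ifs
    · rw [Complex.norm_cpow_eq_rpow_re_of_pos (zero_lt_one.trans_le (hlam l))]
      exact Real.rpow_le_one_of_one_le_of_nonpos (hlam l) hw
    · simp
  · intro k l l' h h'
    simp only [ne_eq, ite_eq_right_iff, not_forall] at h h'
    exact h.1.symm.trans h'.1
  · intro k k' l h h'
    simp only [ne_eq, ite_eq_right_iff, not_forall] at h h'
    exact h.1.trans h'.1.symm

/-- `f` is a meromorphic function on `ℂ` which continues `z ↦ Tr(T |D|^{-z})`, an operator that is
of trace class for `Re z > p`. -/
structure IsZetaContinuation (p : ℝ) (lam : ι → ℝ) (T : ℓ²(ι, ℂ) →L[ℂ] ℓ²(ι, ℂ)) (f : ℂ → ℂ) :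
    Prop where
  meromorphic : MeromorphicOn f Set.univ
  eq_trace : ∀ z : ℂ, p < z.re →
    IsTraceClass (T * absPow lam (-z)) ∧ f z = trace (T * absPow lam (-z))

/-- The set of poles of the continued zeta functions of the elements of `Ψ⁰(A)`. -/
def dimensionSpectrum (p : ℝ) (lam : ι → ℝ) (A : Set (ℓ²(ι, ℂ) →L[ℂ] ℓ²(ι, ℂ))) : Set ℂ :=
  {s | ∃ T ∈ psiZero lam A, ∃ f, IsZetaContinuation p lam T f ∧ meromorphicOrderAt f s < 0}

/-- All zeta functions of elements of `Ψ⁰(A)` continue meromorphically to `ℂ`, the set of their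
poles is `S`, and all these poles are simple. -/
structure HasSimpleDimensionSpectrum (p : ℝ) (lam : ι → ℝ)
    (A : Set (ℓ²(ι, ℂ) →L[ℂ] ℓ²(ι, ℂ))) (S : Set ℂ) : Prop where
  exists_continuation : ∀ T ∈ psiZero lam A, ∃ f, IsZetaContinuation p lam T f
  eq_spectrum : dimensionSpectrum p lam A = S
  simple : ∀ T ∈ psiZero lam A, ∀ f, IsZetaContinuation p lam T f →
    ∀ s : ℂ, ((-1 : ℤ) : WithTop ℤ) ≤ meromorphicOrderAt f s

/-- The noncommutative integral `⨍ T = Res_{z=0} Tr(T |D|^{-z})` exists and is `v`: the continued zeta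
function has at most a simple pole at `0`, with residue `v`. -/
def HasNCInt (p : ℝ) (lam : ι → ℝ) (T : ℓ²(ι, ℂ) →L[ℂ] ℓ²(ι, ℂ)) (v : ℂ) : Prop :=
  ∃ f, IsZetaContinuation p lam T f ∧ Tendsto (fun z => z * f z) (𝓝[≠] 0) (𝓝 v)

end Generic

section Spin

/-- The labels of the orthonormal basis `v^j_{xys}`, `s = 0` for up, `s = 1` for down. With `2j`, `x`, `y`
as parameters, `v^j_{xy↑} = |j, x - j, y - j - 1/2, ↑⟩` for `0 ≤ x ≤ 2j`, `0 ≤ y ≤ 2j + 1` and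
`v^j_{xy↓} = |j, x - j, y - j + 1/2, ↓⟩` for `0 ≤ x ≤ 2j`, `0 ≤ y ≤ 2j - 1`. -/
structure SpinIndex where
  twoJ : ℕ
  x : ℕ
  y : ℕ
  s : Fin 2
  hx : x ≤ twoJ
  hy : y < if s = 0 then twoJ + 2 else twoJ

namespace SpinIndex

def j (k : SpinIndex) : ℝ := k.twoJ / 2

def mu (k : SpinIndex) : ℝ := k.x - k.j

def n (k : SpinIndex) : ℝ := if k.s = 0 then k.y - k.j - 1 / 2 else k.y - k.j + 1 / 2

end SpinIndex

/-- Eigenvalues of the Dirac operator: `2j + 3/2` on up kets, `-2j - 1/2` on down kets. -/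
def diracEigenvalue (k : SpinIndex) : ℝ := if k.s = 0 then 2 * k.j + 3 / 2 else -(2 * k.j + 1 / 2)

/-- Bounded operators on the Hilbert space `H` of spinors. -/
abbrev SpinOp : Type := ℓ²(SpinIndex, ℂ) →L[ℂ] ℓ²(SpinIndex, ℂ)

/-- The `q`-integer `[N]`. -/
def qInt (q N : ℝ) : ℝ := (q ^ (-N) - q ^ N) / (q⁻¹ - q)

/-- The matrix of the operator that sends `|j μ n s⟩` to
`Σ_{s'} F(j, μ, n)_{s' s} |j + dj, μ + 1/2, n + dn, s'⟩`. -/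
def spinMatrix (dj dn : ℝ) (F : ℝ → ℝ → ℝ → Matrix (Fin 2) (Fin 2) ℝ) (k l : SpinIndex) : ℂ :=
  open Classical in
  if k.j = l.j + dj ∧ k.mu = l.mu + 1 / 2 ∧ k.n = l.n + dn then
    ((F l.j l.mu l.n k.s l.s : ℝ) : ℂ) else 0

def aPlusBlock (q j μ n : ℝ) : Matrix (Fin 2) (Fin 2) ℝ :=
  (q ^ ((μ + n - 1 / 2) / 2) * √(qInt q (j + μ + 1))) •
    !![q ^ (-j - 1 / 2) * (√(qInt q (j + n + 3 / 2)) / qInt q (2 * j + 2)), 0;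
      q ^ (1 / 2 : ℝ) * (√(qInt q (j - n + 1 / 2)) / (qInt q (2 * j + 1) * qInt q (2 * j + 2))),
      q ^ (-j) * (√(qInt q (j + n + 1 / 2)) / qInt q (2 * j + 1))]

def aMinusBlock (q j μ n : ℝ) : Matrix (Fin 2) (Fin 2) ℝ :=
  (q ^ ((μ + n - 1 / 2) / 2) * √(qInt q (j - μ))) •
    !![q ^ (j + 1) * (√(qInt q (j - n + 1 / 2)) / qInt q (2 * j + 1)),
      -(q ^ (1 / 2 : ℝ) * (√(qInt q (j + n + 1 / 2)) / (qInt q (2 * j) * qInt q (2 * j + 1))));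
      0, q ^ (j + 1 / 2) * (√(qInt q (j - n - 1 / 2)) / qInt q (2 * j))]

def bPlusBlock (q j μ n : ℝ) : Matrix (Fin 2) (Fin 2) ℝ :=
  (q ^ ((μ + n - 1 / 2) / 2) * √(qInt q (j + μ + 1))) •
    !![√(qInt q (j - n + 3 / 2)) / qInt q (2 * j + 2), 0;
      -(q ^ (-j - 1) * (√(qInt q (j + n + 1 / 2)) / (qInt q (2 * j + 1) * qInt q (2 * j + 2)))),
      q ^ (-1 / 2 : ℝ) * (√(qInt q (j - n + 1 / 2)) / qInt q (2 * j + 1))]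

def bMinusBlock (q j μ n : ℝ) : Matrix (Fin 2) (Fin 2) ℝ :=
  (q ^ ((μ + n - 1 / 2) / 2) * √(qInt q (j - μ))) •
    !![-(q ^ (-1 / 2 : ℝ) * (√(qInt q (j + n + 1 / 2)) / qInt q (2 * j + 1))),
      -(q ^ j * (√(qInt q (j - n + 1 / 2)) / (qInt q (2 * j) * qInt q (2 * j + 1))));
      0, -(√(qInt q (j + n - 1 / 2)) / qInt q (2 * j))]

theorem SpinIndex.eq_of_labels {k l : SpinIndex} (hs : k.s = l.s) (hj : k.j = l.j)
    (hmu : k.mu = l.mu) (hn : k.n = l.n) : k = l := by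
  have h1 : k.twoJ = l.twoJ := by
    have : (k.twoJ : ℝ) = l.twoJ := by simp only [j] at hj; linarith
    exact_mod_cast this
  have h2 : k.x = l.x := by
    have : (k.x : ℝ) = l.x := by simp only [mu] at hmu; linarith
    exact_mod_cast this
  have h3 : k.y = l.y := by
    have : (k.y : ℝ) = l.y := by
      simp only [n, hs] at hn
      split_ifs at hn <;> linarith
    exact_mod_cast this
  cases k; cases l; simp_all

theorem exists_spinMatrix (dj dn : ℝ) (F : ℝ → ℝ → ℝ → Matrix (Fin 2) (Fin 2) ℝ) (C : ℝ)
    (hC : ∀ (l : SpinIndex) (s : Fin 2), |F l.j l.mu l.n s l.s| ≤ C) :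
    ∃ T, HasMatrix T (spinMatrix dj dn F) := by
  classical
  have piece : ∀ s t : Fin 2, ∃ T, HasMatrix T (fun k l : SpinIndex =>
      if k.s = s ∧ l.s = t then spinMatrix dj dn F k l else 0) := by
    intro s t
    have hC0 : 0 ≤ C := (abs_nonneg _).trans (hC ⟨0, 0, 0, 0, le_rfl, by simp⟩ 0)
    refine exists_hasMatrix _ C ?_ ?_ ?_
    · intro k l
      simp only [spinMatrix]
      split_ifs
      · rw [Complex.norm_real]; exact hC l _
      all_goals simpa using hC0
    · intro k l l' h h'
      simp only [spinMatrix, ne_eq, ite_eq_right_iff, not_forall] at h h'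
      obtain ⟨h1, h2, -⟩ := h
      obtain ⟨h1', h2', -⟩ := h'
      exact SpinIndex.eq_of_labels (h1.2.trans h1'.2.symm) (by linarith) (by linarith)
        (by linarith)
    · intro k k' l h h'
      simp only [spinMatrix, ne_eq, ite_eq_right_iff, not_forall] at h h'
      obtain ⟨h1, h2, -⟩ := h
      obtain ⟨h1', h2', -⟩ := h'
      exact SpinIndex.eq_of_labels (h1.1.trans h1'.1.symm) (by linarith) (by linarith)
        (by linarith)
  choose P hP using piece
  refine ⟨P 0 0 + P 0 1 + P 1 0 + P 1 1, fun k l => ?_⟩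
  rw [(((hP 0 0).add (hP 0 1)).add (hP 1 0)).add (hP 1 1) k l]
  have hk : k.s = 0 ∨ k.s = 1 := by omega
  have hl : l.s = 0 ∨ l.s = 1 := by omega
  rcases hk with hk | hk <;> rcases hl with hl | hl <;> simp [hk, hl]

theorem sqrt_qInt_le {q : ℝ} (h0 : 0 < q) (h1 : q < 1) (N : ℝ) :
    √(qInt q N) ≤ √((q⁻¹ - q)⁻¹) * q ^ (-N / 2) := by
  have hd : 0 < q⁻¹ - q := by
    have := (one_lt_inv₀ h0).mpr h1
    linarith
  have : q ^ (-N / 2) = √(q ^ (-N)) := by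
    rw [Real.sqrt_eq_rpow, ← Real.rpow_mul h0.le]; ring_nf
  rw [this, ← Real.sqrt_mul (inv_nonneg.mpr hd.le)]
  apply Real.sqrt_le_sqrt
  rw [qInt, div_eq_inv_mul]
  have := Real.rpow_pos_of_pos h0 N
  gcongr
  linarith

theorem inv_qInt_le {q : ℝ} (h0 : 0 < q) (h1 : q < 1) {N : ℝ} (hN : 1 ≤ N) :
    0 < qInt q N ∧ (qInt q N)⁻¹ ≤ q ^ (N - 1) := by
  have hd : 0 < q⁻¹ - q := by
    have := (one_lt_inv₀ h0).mpr h1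
    linarith
  have key : q ^ (1 - N) ≤ qInt q N := by
    rw [qInt, le_div_iff₀ hd, Real.rpow_sub h0, Real.rpow_neg h0.le, Real.rpow_one]
    have hp := Real.rpow_pos_of_pos h0 N
    have h2 : q ^ N ≤ q := by
      simpa using Real.rpow_le_rpow_of_exponent_ge h0 h1.le hN
    have : q / q ^ N * (q⁻¹ - q) = (q ^ N)⁻¹ - q ^ 2 / q ^ N := by
      field_simp
    rw [this]
    have : q ^ N ≤ q ^ 2 / q ^ N := by
      rw [le_div_iff₀ hp]; nlinarith
    linarith
  have hp := Real.rpow_pos_of_pos h0 (1 - N)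
  refine ⟨hp.trans_le key, ?_⟩
  rw [show N - 1 = -(1 - N) by ring, Real.rpow_neg h0.le]
  exact inv_anti₀ hp key

theorem entry_bound {q : ℝ} (h0 : 0 < q) (h1 : q < 1) {e e' A B M : ℝ} (hM : 1 ≤ M)
    (h : -4 ≤ e + e' - A / 2 - B / 2 + (M - 1)) :
    |q ^ e * √(qInt q A) * (q ^ e' * (√(qInt q B) / qInt q M))| ≤
      (q⁻¹ - q)⁻¹ * q ^ (-4 : ℝ) := by
  have hd : 0 < q⁻¹ - q := by
    have := (one_lt_inv₀ h0).mpr h1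
    linarith
  obtain ⟨hpos, hinv⟩ := inv_qInt_le h0 h1 hM
  have hA := sqrt_qInt_le h0 h1 A
  have hB := sqrt_qInt_le h0 h1 B
  rw [abs_of_nonneg (by positivity), div_eq_mul_inv]
  calc q ^ e * √(qInt q A) * (q ^ e' * (√(qInt q B) * (qInt q M)⁻¹))
      ≤ q ^ e * (√((q⁻¹ - q)⁻¹) * q ^ (-A / 2)) *
          (q ^ e' * ((√((q⁻¹ - q)⁻¹) * q ^ (-B / 2)) * q ^ (M - 1))) := by
        gcongr
    _ = (√((q⁻¹ - q)⁻¹) * √((q⁻¹ - q)⁻¹)) *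
          (q ^ e * q ^ e' * q ^ (-A / 2) * q ^ (-B / 2) * q ^ (M - 1)) := by ring
    _ = (q⁻¹ - q)⁻¹ * q ^ (e + e' + (-A / 2) + (-B / 2) + (M - 1)) := by
        rw [Real.mul_self_sqrt (inv_nonneg.mpr hd.le), ← Real.rpow_add h0, ← Real.rpow_add h0,
          ← Real.rpow_add h0, ← Real.rpow_add h0]
    _ ≤ _ := by
        refine mul_le_mul_of_nonneg_left ?_ (inv_nonneg.mpr hd.le)
        exact Real.rpow_le_rpow_of_exponent_ge h0 h1.le (by linarith)

theorem entry_bound' {q : ℝ} (h0 : 0 < q) (h1 : q < 1) {e e' A B M M' : ℝ} (hM : 1 ≤ M)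
    (hM' : 1 ≤ M') (h : -4 ≤ e + e' - A / 2 - B / 2 + (M - 1) + (M' - 1)) :
    |q ^ e * √(qInt q A) * (q ^ e' * (√(qInt q B) / (qInt q M * qInt q M')))| ≤
      (q⁻¹ - q)⁻¹ * q ^ (-4 : ℝ) := by
  obtain ⟨hpos, hinv⟩ := inv_qInt_le h0 h1 hM'
  obtain ⟨hpos2, -⟩ := inv_qInt_le h0 h1 hM
  refine le_trans ?_ (entry_bound h0 h1 (e := e) (e' := e' + (M' - 1)) (A := A) (B := B) hM
    (by linarith))
  rw [abs_of_nonneg (by positivity), abs_of_nonneg (by positivity), Real.rpow_add h0]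
  calc q ^ e * √(qInt q A) * (q ^ e' * (√(qInt q B) / (qInt q M * qInt q M')))
      = q ^ e * √(qInt q A) * (q ^ e' * (qInt q M')⁻¹ * (√(qInt q B) / qInt q M)) := by
        field_simp
    _ ≤ _ := by gcongr

theorem SpinIndex.label_bounds (l : SpinIndex) :
    0 ≤ l.j ∧ 0 ≤ l.j + l.mu ∧ 0 ≤ l.j - l.mu ∧
      (l.s = 0 → 0 ≤ l.j + l.n + 1 / 2 ∧ 0 ≤ l.j - l.n + 1 / 2) ∧
      (l.s = 1 → 1 ≤ 2 * l.j ∧ 0 ≤ l.j + l.n - 1 / 2 ∧ 0 ≤ l.j - l.n - 1 / 2) := by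
  have hx : (l.x : ℝ) ≤ l.twoJ := by exact_mod_cast l.hx
  have hx0 : (0 : ℝ) ≤ l.x := by positivity
  have hy0 : (0 : ℝ) ≤ l.y := by positivity
  have hy := l.hy
  refine ⟨by simp only [j]; positivity, by simp only [j, mu]; linarith,
    by simp only [j, mu]; linarith, fun hs => ?_, fun hs => ?_⟩
  · rw [if_pos hs] at hy
    have hy' : (l.y : ℝ) + 1 ≤ l.twoJ + 2 := by exact_mod_cast hy
    simp only [n, j, if_pos hs]
    constructor <;> linarith
  · have hs' : l.s ≠ 0 := by simp [hs]
    rw [if_neg hs'] at hy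
    have hy' : (l.y : ℝ) + 1 ≤ l.twoJ := by exact_mod_cast hy
    simp only [n, j, if_neg hs']
    refine ⟨?_, ?_, ?_⟩ <;> linarith

theorem one_le_abs_diracEigenvalue (k : SpinIndex) : 1 ≤ |diracEigenvalue k| := by
  obtain ⟨hj, -, -, -, h4⟩ := k.label_bounds
  have hk : k.s = 0 ∨ k.s = 1 := by omega
  rcases hk with hk | hk
  · rw [diracEigenvalue, if_pos hk, abs_of_nonneg (by linarith)]
    linarith
  · have := (h4 hk).1
    rw [diracEigenvalue, if_neg (by simp [hk]), abs_neg, abs_of_nonneg (by linarith)]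
    linarith

variable (q : Set.Ioo (0 : ℝ) 1)

/-- The operator `a_+` on spinors. -/
def aPlus : SpinOp := ofMatrix (spinMatrix (1 / 2) (1 / 2) (aPlusBlock q))
/-- The operator `a_-` on spinors. -/
def aMinus : SpinOp := ofMatrix (spinMatrix (-1 / 2) (1 / 2) (aMinusBlock q))
/-- The operator `b_+` on spinors. -/
def bPlus : SpinOp := ofMatrix (spinMatrix (1 / 2) (-1 / 2) (bPlusBlock q))
/-- The operator `b_-` on spinors. -/
def bMinus : SpinOp := ofMatrix (spinMatrix (-1 / 2) (-1 / 2) (bMinusBlock q))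

theorem const_nonneg : 0 ≤ ((q : ℝ)⁻¹ - q)⁻¹ * (q : ℝ) ^ (-4 : ℝ) := by
  have h0 := q.2.1
  have h1 := q.2.2
  have := (one_lt_inv₀ h0).mpr h1
  have hd : 0 ≤ (q : ℝ)⁻¹ - q := by linarith
  positivity

theorem hasMatrix_aPlus : HasMatrix (aPlus q) (spinMatrix (1 / 2) (1 / 2) (aPlusBlock q)) := by
  refine hasMatrix_ofMatrix (exists_spinMatrix _ _ _ (((q : ℝ)⁻¹ - q)⁻¹ * (q : ℝ) ^ (-4 : ℝ)) ?_)
  intro l s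
  obtain ⟨hj, h1, h2, h3, h4⟩ := l.label_bounds
  have hl : l.s = 0 ∨ l.s = 1 := by omega
  have hs : s = 0 ∨ s = 1 := by omega
  rcases hl with hl | hl <;> rcases hs with rfl | rfl <;>
    simp only [aPlusBlock, hl, Matrix.smul_apply, smul_eq_mul, Matrix.of_apply, Matrix.cons_val',
      Matrix.cons_val_zero, Matrix.cons_val_one, Matrix.cons_val_fin_one, mul_zero, abs_zero]
  · obtain ⟨h5, h6⟩ := h3 hl
    exact entry_bound q.2.1 q.2.2 (by linarith) (by linarith)
  · obtain ⟨h5, h6⟩ := h3 hl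
    exact entry_bound' q.2.1 q.2.2 (by linarith) (by linarith) (by linarith)
  · exact const_nonneg q
  · obtain ⟨h5, h6, h7⟩ := h4 hl
    exact entry_bound q.2.1 q.2.2 (by linarith) (by linarith)

theorem hasMatrix_aMinus : HasMatrix (aMinus q) (spinMatrix (-1 / 2) (1 / 2) (aMinusBlock q)) := by
  refine hasMatrix_ofMatrix (exists_spinMatrix _ _ _ (((q : ℝ)⁻¹ - q)⁻¹ * (q : ℝ) ^ (-4 : ℝ)) ?_)
  intro l s
  obtain ⟨hj, h1, h2, h3, h4⟩ := l.label_bounds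
  have hl : l.s = 0 ∨ l.s = 1 := by omega
  have hs : s = 0 ∨ s = 1 := by omega
  rcases hl with hl | hl <;> rcases hs with rfl | rfl <;>
    simp only [aMinusBlock, hl, Matrix.smul_apply, smul_eq_mul, Matrix.of_apply, Matrix.cons_val',
      Matrix.cons_val_zero, Matrix.cons_val_one, Matrix.cons_val_fin_one, mul_zero, abs_zero,
      mul_neg, abs_neg]
  · obtain ⟨h5, h6⟩ := h3 hl
    exact entry_bound q.2.1 q.2.2 (by linarith) (by linarith)
  · exact const_nonneg q
  · obtain ⟨h5, h6, h7⟩ := h4 hl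
    exact entry_bound' q.2.1 q.2.2 (by linarith) (by linarith) (by linarith)
  · obtain ⟨h5, h6, h7⟩ := h4 hl
    exact entry_bound q.2.1 q.2.2 (by linarith) (by linarith)

theorem hasMatrix_bPlus : HasMatrix (bPlus q) (spinMatrix (1 / 2) (-1 / 2) (bPlusBlock q)) := by
  refine hasMatrix_ofMatrix (exists_spinMatrix _ _ _ (((q : ℝ)⁻¹ - q)⁻¹ * (q : ℝ) ^ (-4 : ℝ)) ?_)
  intro l s
  obtain ⟨hj, h1, h2, h3, h4⟩ := l.label_bounds
  have hl : l.s = 0 ∨ l.s = 1 := by omega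
  have hs : s = 0 ∨ s = 1 := by omega
  rcases hl with hl | hl <;> rcases hs with rfl | rfl <;>
    simp only [bPlusBlock, hl, Matrix.smul_apply, smul_eq_mul, Matrix.of_apply, Matrix.cons_val',
      Matrix.cons_val_zero, Matrix.cons_val_one, Matrix.cons_val_fin_one, mul_zero, abs_zero,
      mul_neg, abs_neg]
  · obtain ⟨h5, h6⟩ := h3 hl
    have := entry_bound q.2.1 q.2.2 (e := (l.mu + l.n - 1 / 2) / 2) (e' := 0) (A := l.j + l.mu + 1)
      (B := l.j - l.n + 3 / 2) (M := 2 * l.j + 2) (by linarith) (by linarith)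
    simpa using this
  · obtain ⟨h5, h6⟩ := h3 hl
    exact entry_bound' q.2.1 q.2.2 (by linarith) (by linarith) (by linarith)
  · exact const_nonneg q
  · obtain ⟨h5, h6, h7⟩ := h4 hl
    exact entry_bound q.2.1 q.2.2 (by linarith) (by linarith)

theorem hasMatrix_bMinus :
    HasMatrix (bMinus q) (spinMatrix (-1 / 2) (-1 / 2) (bMinusBlock q)) := by
  refine hasMatrix_ofMatrix (exists_spinMatrix _ _ _ (((q : ℝ)⁻¹ - q)⁻¹ * (q : ℝ) ^ (-4 : ℝ)) ?_)
  intro l s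
  obtain ⟨hj, h1, h2, h3, h4⟩ := l.label_bounds
  have hl : l.s = 0 ∨ l.s = 1 := by omega
  have hs : s = 0 ∨ s = 1 := by omega
  rcases hl with hl | hl <;> rcases hs with rfl | rfl <;>
    simp only [bMinusBlock, hl, Matrix.smul_apply, smul_eq_mul, Matrix.of_apply, Matrix.cons_val',
      Matrix.cons_val_zero, Matrix.cons_val_one, Matrix.cons_val_fin_one, mul_zero, abs_zero,
      mul_neg, abs_neg]
  · obtain ⟨h5, h6⟩ := h3 hl
    exact entry_bound q.2.1 q.2.2 (by linarith) (by linarith)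
  · exact const_nonneg q
  · obtain ⟨h5, h6, h7⟩ := h4 hl
    exact entry_bound' q.2.1 q.2.2 (by linarith) (by linarith) (by linarith)
  · obtain ⟨h5, h6, h7⟩ := h4 hl
    have := entry_bound q.2.1 q.2.2 (e := (l.mu + l.n - 1 / 2) / 2) (e' := 0) (A := l.j - l.mu)
      (B := l.j + l.n - 1 / 2) (M := 2 * l.j) (by linarith) (by linarith)
    simpa using this

/-- Orthogonal projection onto the closed span of the up (`s = 0`) or down (`s = 1`) kets. -/
def spinProj (s : Fin 2) : SpinOp :=
  open Classical in ofMatrix fun k l => if k = l ∧ l.s = s then 1 else 0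

theorem hasMatrix_spinProj (s : Fin 2) : HasMatrix (spinProj s)
    (open Classical in fun k l => if k = l ∧ l.s = s then 1 else 0) := by
  classical
  refine hasMatrix_ofMatrix (exists_hasMatrix _ 1 ?_ ?_ ?_)
  · intro k l
    split_ifs <;> simp
  · intro k l l' h h'
    simp only [ne_eq, ite_eq_right_iff, not_forall] at h h'
    exact h.1.1.symm.trans h'.1.1
  · intro k k' l h h'
    simp only [ne_eq, ite_eq_right_iff, not_forall] at h h'
    exact h.1.1.trans h'.1.1.symm

/-- `π(a) = a_+ + a_-`. -/
def spinA := aPlus q + aMinus q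

/-- `π(b) = b_+ + b_-`. -/
def spinB := bPlus q + bMinus q

/-- The image `π(𝒜)` of `𝒜 = 𝒜(SU_q(2))` in the spinor representation: the `*`-algebra generated
by `π(a)` and `π(b)`. -/
def spinAlgebra : StarSubalgebra ℂ SpinOp :=
  StarAlgebra.adjoin ℂ {spinA q, spinB q}

/-- `ℬ`, the algebra generated by all `δⁿ(𝒜)`. -/
abbrev algB : Subalgebra ℂ SpinOp :=
  deltaAlgebra diracEigenvalue (spinAlgebra q)

/-- `Ψ⁰(𝒜)`, the algebra generated by all `δⁿ(𝒜)` and `δⁿ([D, 𝒜])`. -/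
abbrev algPsi : Subalgebra ℂ SpinOp :=
  psiZero diracEigenvalue (spinAlgebra q)

/-- `T ↦ P↑ T P↑ + P↓ T P↓`. -/
def diagPart (T : SpinOp) : SpinOp :=
  spinProj 0 * T * spinProj 0 + spinProj 1 * T * spinProj 1

/-- `P↓ R P↑ + P↑ S P↓`. -/
def offDiag (R S : SpinOp) : SpinOp :=
  spinProj 1 * R * spinProj 0 + spinProj 0 * S * spinProj 1

end Spin

section Symbol

variable (q : Set.Ioo (0 : ℝ) 1)

/-- `𝒜(D²_{q+}) ⊗ 𝒜(D²_{q-}) ⊗ 𝒜(S¹)`. -/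
abbrev SymbolAlgebra : Type := (disk q 1 ⊗[ℂ] disk q (-1)) ⊗[ℂ] ℂ[T;T⁻¹]

variable {q} in
/-- `x ⊗ y ⊗ u^m`. -/
def symb (x : disk q 1) (y : disk q (-1)) (m : ℤ) : SymbolAlgebra q :=
  (x ⊗ₜ[ℂ] y) ⊗ₜ[ℂ] (LaurentPolynomial.T m : ℂ[T;T⁻¹])

/-- The symbol map `ρ` on `ℬ`: the unital algebra homomorphism with the prescribed values on the
generators of `ℬ` and on their adjoints, that is, the `*`-homomorphism with the prescribed values
on the `*`-generators (these lie in `ℬ`, which is part of the assertion). -/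
structure IsSymbolMap (ρ : algB q →ₐ[ℂ] SymbolAlgebra q) : Prop where
  map_aPlus : ∃ h, ρ ⟨diagPart (aPlus q), h⟩ =
    symb (rA q 1) (rA q (-1)) 1
  map_aPlus_star : ∃ h, ρ ⟨star (diagPart (aPlus q)), h⟩ =
    symb (star (rA q 1)) (star (rA q (-1))) (-1)
  map_aMinus : ∃ h, ρ ⟨diagPart (aMinus q), h⟩ =
    -((q : ℝ) : ℂ) • symb (rB q 1) (star (rB q (-1))) (-1)
  map_aMinus_star : ∃ h, ρ ⟨star (diagPart (aMinus q)), h⟩ =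
    -((q : ℝ) : ℂ) • symb (star (rB q 1)) (rB q (-1)) 1
  map_bPlus : ∃ h, ρ ⟨diagPart (bPlus q), h⟩ =
    -symb (rA q 1) (rB q (-1)) 1
  map_bPlus_star : ∃ h, ρ ⟨star (diagPart (bPlus q)), h⟩ =
    -symb (star (rA q 1)) (star (rB q (-1))) (-1)
  map_bMinus : ∃ h, ρ ⟨diagPart (bMinus q), h⟩ =
    -symb (rB q 1) (star (rA q (-1))) (-1)
  map_bMinus_star : ∃ h, ρ ⟨star (diagPart (bMinus q)), h⟩ =
    -symb (star (rB q 1)) (rA q (-1)) 1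
  map_offDiag_a : ∃ h, ρ ⟨offDiag (aPlus q) (aMinus q), h⟩ =
    0
  map_offDiag_a_star : ∃ h, ρ ⟨star (offDiag (aPlus q) (aMinus q)), h⟩ =
    0
  map_offDiag_b : ∃ h, ρ ⟨offDiag (bPlus q) (bMinus q), h⟩ =
    0
  map_offDiag_b_star : ∃ h, ρ ⟨star (offDiag (bPlus q) (bMinus q)), h⟩ =
    0

variable {q} in
/-- The extension of `ρ` from `ℬ` to the algebra `Ψ⁰(𝒜)`, which contains the corners of the elements
of `ℬ` separately. The two components of `ρ'` are the symbols on `H↑` and on `H↓`. -/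
structure IsExtendedSymbolMap (ρ : algB q →ₐ[ℂ] SymbolAlgebra q)
    (ρ' : algPsi q →ₐ[ℂ] SymbolAlgebra q × SymbolAlgebra q) : Prop where
  extends_symbol : ∀ (S : algPsi q) (T : algB q), (S : SpinOp) = (T : SpinOp) → ρ' S = (ρ T, ρ T)
  map_cornerUp : ∀ (S : algPsi q) (T : algB q),
    (S : SpinOp) = spinProj 0 * T * spinProj 0 → ρ' S = (ρ T, 0)
  map_cornerDn : ∀ (S : algPsi q) (T : algB q),
    (S : SpinOp) = spinProj 1 * T * spinProj 1 → ρ' S = (0, ρ T)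
  map_offDiag : ∀ S : algPsi q, diagPart (S : SpinOp) = 0 → ρ' S = 0

section Restrict

variable {A : Type*} [Ring A] [Algebra ℂ A]

/-- The projection of `A ⊗ 𝒜(S¹)` onto its degree-zero part for the `ℤ`-grading by powers of `u`. -/
def degreeZero : A ⊗[ℂ] ℂ[T;T⁻¹] →ₗ[ℂ] A ⊗[ℂ] ℂ[T;T⁻¹] :=
  TensorProduct.map LinearMap.id
    { toFun := fun p => LaurentPolynomial.C (p.coeff 0)
      map_add' := fun p p' => by simp
      map_smul' := fun c p => by
        rw [AddMonoidAlgebra.coeff_smul, Finsupp.smul_apply, smul_eq_mul, map_mul,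
          LaurentPolynomial.smul_eq_C_mul, RingHom.id_apply] }

/-- Evaluation of Laurent polynomials at `u = 1`. -/
def evalOne : ℂ[T;T⁻¹] →ₐ[ℂ] ℂ := AddMonoidAlgebra.lift ℂ ℂ ℤ 1

theorem evalOne_T (m : ℤ) : evalOne (LaurentPolynomial.T m : ℂ[T;T⁻¹]) = 1 := by
  simp [evalOne, LaurentPolynomial.T, AddMonoidAlgebra.lift_single,
    -LaurentPolynomial.single_eq_C_mul_T]

/-- The restriction homomorphism `r : A ⊗ 𝒜(S¹) → A` (evaluation at `u = 1`); it is used for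
`A = 𝒜(D²_{q+}) ⊗ 𝒜(D²_{q-})`, where it is the restriction to the first two legs. -/
def restrict : A ⊗[ℂ] ℂ[T;T⁻¹] →ₐ[ℂ] A :=
  (Algebra.TensorProduct.rid ℂ ℂ A).toAlgHom.comp
    (Algebra.TensorProduct.map (AlgHom.id ℂ A) evalOne)

theorem restrict_tmul (x : A) (p : ℂ[T;T⁻¹]) : restrict (x ⊗ₜ[ℂ] p) = evalOne p • x := by
  simp [restrict]

/-- `r(s)⁰`, the restriction of the degree-zero part of the symbol `s`. -/
def restrictZero (s : A ⊗[ℂ] ℂ[T;T⁻¹]) : A := restrict (degreeZero s)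

theorem restrictZero_tmul_T (x : A) (m : ℤ) :
    restrictZero (x ⊗ₜ[ℂ] (LaurentPolynomial.T m : ℂ[T;T⁻¹])) = if m = 0 then x else 0 := by
  have h1 : degreeZero (x ⊗ₜ[ℂ] (LaurentPolynomial.T m : ℂ[T;T⁻¹])) =
      x ⊗ₜ[ℂ] (LaurentPolynomial.C (if m = 0 then 1 else 0) : ℂ[T;T⁻¹]) := by
    simp [degreeZero]
  rw [restrictZero, h1, restrict_tmul]
  by_cases h : m = 0
  · rw [if_pos h, if_pos h, map_one, map_one, one_smul]
  · rw [if_neg h, if_neg h, map_zero, map_zero, zero_smul]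

end Restrict

variable {q} in
/-- `f ⊗ g` for linear functionals on the two disks. -/
def tensorFunctional (f : disk q 1 →ₗ[ℂ] ℂ) (g : disk q (-1) →ₗ[ℂ] ℂ) :
    disk q 1 ⊗[ℂ] disk q (-1) →ₗ[ℂ] ℂ :=
  LinearMap.mul' ℂ ℂ ∘ₗ TensorProduct.map f g

/-- `τ₀↑(x) = lim (Tr_N x - (N + 3/2) τ₁(x))`. -/
abbrev tauUp (ε : ℤˣ) : disk q ε →ₗ[ℂ] ℂ := tau0 q ε (3 / 2)

/-- `τ₀↓(x) = lim (Tr_N x - (N + 1/2) τ₁(x))`. -/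
abbrev tauDn (ε : ℤˣ) : disk q ε →ₗ[ℂ] ℂ := tau0 q ε (1 / 2)

end Symbol

end SUq2
end

/-!
A spinor ket `|j μ n s⟩` is labelled by its spin `s`, by `N = 2j`, by `x = j + μ` and by a natural
number `y` in place of `n`. In these labels `π(a)` and `π(b)` are sums of weighted shifts, and `|D|` is
`N + 3/2` on up kets and `N + 1/2` on down kets.

*Generators.* The diagonal parts of `a_±` and `b_±` are eigenvectors of `δ` of weight `±1`, the
off-diagonal parts have weight `0`, and each part is recovered from `X`, `δ X`, `δ² X`. Hence `ℬ` is
generated by these parts (`algB_eq`). Since `[D, X]` has the same parts with other signs, except that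
the off-diagonal part `o` becomes `[D, o]`, the algebra `Ψ⁰(𝒜)` is generated by the corners of the
diagonal parts together with all `o` and `[D, o]` (`algPsi_eq`).

*Symbols.* The algebra `𝒮` acts on an algebraic model space with basis `ε_x ⊗ ε_y ⊗ u^N`. An operator
`T` has the symbol `σ` on spin `s` if it acts on the kets of spin `s` as `σ` acts on the vectors with the
same labels, up to an error `O(q^(N/2))` (`HasSpinSymbol`). The set of pairs `(T, σ)` is closed under sums
and products, and `σ` is determined by `T`, because its matrix coefficients are limits as `N → ∞` of
matrix entries of `T`. Expanding the `q`-integers shows that the diagonal parts have the symbols of the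
theorem (`aPlus_symbol`, `aMinus_symbol`, `bPlus_symbol`, `bMinus_symbol`). The off-diagonal parts have
weights of order `q^N`, so they and their commutators with `D`, of order `N q^N`, have symbol `0`. So
every element of `ℬ` and of `Ψ⁰(𝒜)` has symbols, and uniqueness of symbols makes them homomorphisms
`rho` and `rhoExt`. These maps are determined by their values on the generators.

*Zeta functions.* The eigenspace of `|D|` for `λ = N + 3/2` is spanned by the up kets with `2j = N`, for
which `0 ≤ x ≤ N` and `0 ≤ y ≤ N + 1`, and by the down kets with `2j = N + 1`, for which
`0 ≤ x ≤ N + 1` and `0 ≤ y ≤ N`. The diagonal entries of `T` are, up to exponentially small errors, those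
of the degree-zero part of its symbol, so the trace of `T` over this eigenspace is given by
`Tr_N ⊗ Tr_{N+1}` of one symbol and `Tr_{N+1} ⊗ Tr_N` of the other. Now `Tr_N = λ τ₁ + τ₀↑` and
`Tr_{N+1} = λ τ₁ + τ₀↓` up to `O(q^N)`, so that trace is `A λ² + B λ + C` plus a rapidly decaying
sequence (`rapidDecay_levelTrace`). Therefore `Tr(T |D|^{-z})` is
`A Z(z - 2) + B Z(z - 1) + C Z(z)` plus an entire function, where `Z(z) = ∑ (N + 3/2)^{-z}` is a Hurwitz
zeta function without its first term. It has at most simple poles at `3`, `2`, `1`, with the residues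
`A`, `B`, `C`. The unit has poles at `3` and `1`, and `b̃₊* b̃₊` has a pole at `2`.
-/

noncomputable section
namespace SUq2

/-! ### Matrices and commutators with diagonal operators -/

section Matrices
variable {ι : Type*}

theorem hasSum_smul_ket (ψ : ℓ²(ι, ℂ)) : HasSum (fun i => ψ i • ket i) ψ := by
  classical
  have h := lp.hasSum_single (p := 2) (by simp) ψ
  refine h.congr_fun ?_
  intro i
  simp only [ket]
  rw [← lp.single_smul]; simp

theorem clm_ext_ket {T S : ℓ²(ι, ℂ) →L[ℂ] ℓ²(ι, ℂ)} (h : ∀ l, T (ket l) = S (ket l)) : T = S := by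
  ext1 ψ
  have h1 := (hasSum_smul_ket ψ).mapL T
  have h2 := (hasSum_smul_ket ψ).mapL S
  simp only [map_smul, h] at h1 h2
  exact h1.unique h2

theorem HasMatrix.unique {T S : ℓ²(ι, ℂ) →L[ℂ] ℓ²(ι, ℂ)} {M : ι → ι → ℂ} (hT : HasMatrix T M)
    (hS : HasMatrix S M) : T = S :=
  clm_ext_ket fun l => lp.ext (funext fun k => (hT k l).trans (hS k l).symm)

theorem HasMatrix.congr {T : ℓ²(ι, ℂ) →L[ℂ] ℓ²(ι, ℂ)} {M N : ι → ι → ℂ} (hT : HasMatrix T M)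
    (h : ∀ k l, M k l = N k l) : HasMatrix T N := fun k l => (hT k l).trans (h k l)

theorem HasMatrix.smul {T : ℓ²(ι, ℂ) →L[ℂ] ℓ²(ι, ℂ)} {M : ι → ι → ℂ} (hT : HasMatrix T M) (c : ℂ) :
    HasMatrix (c • T) fun k l => c * M k l := fun k l => by simp [hT k l]

theorem HasMatrix.hasSum {T : ℓ²(ι, ℂ) →L[ℂ] ℓ²(ι, ℂ)} {M : ι → ι → ℂ} (hT : HasMatrix T M)
    (ψ : ℓ²(ι, ℂ)) (k : ι) : HasSum (fun l => M k l * ψ l) (T ψ k) := by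
  have h := ((hasSum_smul_ket ψ).mapL T).mapL (innerSL ℂ (ket k))
  simp only [map_smul, innerSL_apply_apply, inner_ket, hT k, smul_eq_mul] at h
  exact h.congr_fun fun l => mul_comm _ _

theorem ket_mem_domain (lam : ι → ℝ) (l : ι) : ket l ∈ (diagOp lam).domain := by
  have h : Memℓp (⇑((lam l : ℂ) • ket l : ℓ²(ι, ℂ))) 2 := lp.memℓp _
  refine (congrArg (fun f : ι → ℂ => Memℓp f 2) ?_).mp h
  funext i
  rw [lp.coeFn_smul, Pi.smul_apply, smul_eq_mul]
  by_cases hi : i = l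
  · rw [hi]
  · simp [ket_apply_ne hi]

theorem diagOp_apply (lam : ι → ℝ) (ψ : (diagOp lam).domain) (k : ι) :
    diagOp lam ψ k = lam k * (ψ : ℓ²(ι, ℂ)) k := rfl

/-- The commutator with a diagonal operator multiplies each matrix entry by the difference of the
eigenvalues. If the result is bounded, then `T` preserves the domain, because the vector
`D (T ψ) = S ψ + T (D ψ)` is square summable. -/
theorem HasMatrix.isCommutator {lam : ι → ℝ} {T S : ℓ²(ι, ℂ) →L[ℂ] ℓ²(ι, ℂ)} {M : ι → ι → ℂ}
    (hT : HasMatrix T M) (hS : HasMatrix S fun k l => ((lam k : ℂ) - lam l) * M k l) :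
    IsCommutator (diagOp lam) T S := by
  intro ψ
  have key : ∀ k, (lam k : ℂ) * T ψ k = S ψ k + T (diagOp lam ψ) k := by
    intro k
    have h1 := (hT.hasSum ψ k).mul_left (lam k : ℂ)
    have h2 := (hS.hasSum ψ k).add (hT.hasSum (diagOp lam ψ) k)
    refine h1.unique (h2.congr_fun fun l => ?_)
    rw [diagOp_apply]; ring
  have hmem : T ψ ∈ (diagOp lam).domain := by
    have h : Memℓp (⇑(S ψ + T (diagOp lam ψ))) 2 := lp.memℓp _
    refine (congrArg (fun f : ι → ℂ => Memℓp f 2) ?_).mp h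
    funext k
    exact (key k).symm
  refine ⟨hmem, lp.ext (funext fun k => ?_)⟩
  have := key k
  rw [lp.coeFn_sub, Pi.sub_apply, diagOp_apply]
  simp only
  rw [this]; ring

theorem IsCommutator.hasMatrix {lam : ι → ℝ} {T S : ℓ²(ι, ℂ) →L[ℂ] ℓ²(ι, ℂ)} {M : ι → ι → ℂ}
    (h : IsCommutator (diagOp lam) T S) (hT : HasMatrix T M) :
    HasMatrix S fun k l => ((lam k : ℂ) - lam l) * M k l := by
  intro k l
  obtain ⟨hm, h⟩ := h ⟨ket l, ket_mem_domain lam l⟩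
  have hD : diagOp lam ⟨ket l, ket_mem_domain lam l⟩ = (lam l : ℂ) • ket l := by
    refine lp.ext (funext fun i => ?_)
    rw [diagOp_apply, lp.coeFn_smul, Pi.smul_apply, smul_eq_mul]
    by_cases hi : i = l
    · rw [hi]
    · simp [ket_apply_ne hi]
  have h2 := congrArg (fun f : ℓ²(ι, ℂ) => f k) h
  simp only [lp.coeFn_sub, Pi.sub_apply, diagOp_apply, hD, map_smul, lp.coeFn_smul, Pi.smul_apply,
    hT k l, smul_eq_mul] at h2
  rw [← h2]; ring

theorem hasMatrix_self (T : ℓ²(ι, ℂ) →L[ℂ] ℓ²(ι, ℂ)) : HasMatrix T fun k l => T (ket l) k :=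
  fun _ _ => rfl

theorem IsCommutator.unique {lam : ι → ℝ} {T S S' : ℓ²(ι, ℂ) →L[ℂ] ℓ²(ι, ℂ)}
    (h : IsCommutator (diagOp lam) T S) (h' : IsCommutator (diagOp lam) T S') : S = S' :=
  (h.hasMatrix (hasMatrix_self T)).unique (h'.hasMatrix (hasMatrix_self T))

theorem IsCommutator.add {lam : ι → ℝ} {T S T' S' : ℓ²(ι, ℂ) →L[ℂ] ℓ²(ι, ℂ)}
    (h : IsCommutator (diagOp lam) T S) (h' : IsCommutator (diagOp lam) T' S') :
    IsCommutator (diagOp lam) (T + T') (S + S') := by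
  refine ((hasMatrix_self T).add (hasMatrix_self T')).isCommutator ?_
  refine ((h.hasMatrix (hasMatrix_self T)).add (h'.hasMatrix (hasMatrix_self T'))).congr ?_
  intro k l; ring

theorem IsCommutator.smul {lam : ι → ℝ} {T S : ℓ²(ι, ℂ) →L[ℂ] ℓ²(ι, ℂ)}
    (h : IsCommutator (diagOp lam) T S) (c : ℂ) :
    IsCommutator (diagOp lam) (c • T) (c • S) := by
  refine ((hasMatrix_self T).smul c).isCommutator ?_
  refine ((h.hasMatrix (hasMatrix_self T)).smul c).congr ?_
  intro k l; ring

theorem IsCommutator.mul {lam : ι → ℝ} {T S T' S' : ℓ²(ι, ℂ) →L[ℂ] ℓ²(ι, ℂ)}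
    (h : IsCommutator (diagOp lam) T S) (h' : IsCommutator (diagOp lam) T' S') :
    IsCommutator (diagOp lam) (T * T') (S * T' + T * S') := by
  intro ψ
  obtain ⟨h1, e1⟩ := h' ψ
  obtain ⟨h2, e2⟩ := h ⟨T' ψ, h1⟩
  refine ⟨h2, ?_⟩
  rw [sub_eq_iff_eq_add] at e1 e2
  change (diagOp lam) ⟨T (T' ψ), h2⟩ - T (T' (diagOp lam ψ)) = S (T' ψ) + T (S' ψ)
  rw [e2, e1, map_add]; abel

theorem IsCommutator.star {lam : ι → ℝ} {T S : ℓ²(ι, ℂ) →L[ℂ] ℓ²(ι, ℂ)}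
    (h : IsCommutator (diagOp lam) T S) : IsCommutator (diagOp lam) (star T) (-star S) := by
  refine (hasMatrix_self T).adjoint.isCommutator ?_
  have := (h.hasMatrix (hasMatrix_self T)).adjoint.smul (-1)
  rw [neg_one_smul] at this
  refine this.congr fun k l => ?_
  simp
  ring

theorem isCommutator_algebraMap (lam : ι → ℝ) (c : ℂ) :
    IsCommutator (diagOp lam) (algebraMap ℂ (ℓ²(ι, ℂ) →L[ℂ] ℓ²(ι, ℂ)) c) 0 := by
  refine (hasMatrix_self _).isCommutator fun k l => ?_
  by_cases h : k = l
  · simp [h]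
  · simp [Algebra.algebraMap_eq_smul_one, ket_apply_ne h]

/-- A matrix concentrated on one difference `c` of the eigenvalues is an eigenvector of the
commutator. -/
theorem HasMatrix.isCommutator_smul {lam : ι → ℝ} {T : ℓ²(ι, ℂ) →L[ℂ] ℓ²(ι, ℂ)} {M : ι → ι → ℂ}
    (hT : HasMatrix T M) (c : ℝ) (h : ∀ k l, M k l ≠ 0 → lam k - lam l = c) :
    IsCommutator (diagOp lam) T ((c : ℂ) • T) := by
  refine hT.isCommutator ((hT.smul c).congr fun k l => ?_)
  by_cases h0 : M k l = 0
  · simp [h0]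
  · rw [← h k l h0]; push_cast; rfl

/-- An algebra is stable under a derivation as soon as its generators are sent into it. -/
theorem exists_isCommutator_of_mem_adjoin {lam : ι → ℝ} {G : Set (ℓ²(ι, ℂ) →L[ℂ] ℓ²(ι, ℂ))}
    {A : Subalgebra ℂ (ℓ²(ι, ℂ) →L[ℂ] ℓ²(ι, ℂ))} (hA : Algebra.adjoin ℂ G ≤ A)
    (hG : ∀ g ∈ G, ∃ S ∈ A, IsCommutator (diagOp lam) g S) {T : ℓ²(ι, ℂ) →L[ℂ] ℓ²(ι, ℂ)}
    (hT : T ∈ Algebra.adjoin ℂ G) : ∃ S ∈ A, IsCommutator (diagOp lam) T S := by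
  induction hT using Algebra.adjoin_induction with
  | mem x hx => exact hG x hx
  | algebraMap c => exact ⟨0, zero_mem _, isCommutator_algebraMap lam c⟩
  | add x y _ _ ihx ihy =>
    obtain ⟨S, hS, h⟩ := ihx
    obtain ⟨S', hS', h'⟩ := ihy
    exact ⟨_, add_mem hS hS', h.add h'⟩
  | mul x y hx hy ihx ihy =>
    obtain ⟨S, hS, h⟩ := ihx
    obtain ⟨S', hS', h'⟩ := ihy
    exact ⟨_, add_mem (mul_mem hS (hA hy)) (mul_mem (hA hx) hS'), h.mul h'⟩

/-- A subalgebra that contains `G` and is stable under `δ` contains all `δⁿ(G)`. -/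
theorem DeltaOrbit.mem_of_stable {lam : ι → ℝ} {G : Set (ℓ²(ι, ℂ) →L[ℂ] ℓ²(ι, ℂ))}
    {A : Subalgebra ℂ (ℓ²(ι, ℂ) →L[ℂ] ℓ²(ι, ℂ))} (hG : ∀ g ∈ G, g ∈ A)
    (hA : ∀ T ∈ A, ∃ S ∈ A, IsCommutator (diagOp fun i => |lam i|) T S)
    {T : ℓ²(ι, ℂ) →L[ℂ] ℓ²(ι, ℂ)} (hT : DeltaOrbit lam G T) : T ∈ A := by
  induction hT with
  | base h => exact hG _ h
  | step _ h ih =>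
    obtain ⟨S', hS', h'⟩ := hA _ ih
    rw [h.unique h']; exact hS'

theorem DeltaOrbit.mono {lam : ι → ℝ} {G G' : Set (ℓ²(ι, ℂ) →L[ℂ] ℓ²(ι, ℂ))} (h : G ⊆ G')
    {T : ℓ²(ι, ℂ) →L[ℂ] ℓ²(ι, ℂ)} (hT : DeltaOrbit lam G T) : DeltaOrbit lam G' T := by
  induction hT with
  | base hT => exact .base (h hT)
  | step _ hc ih => exact .step ih hc

end Matrices

/-! ### Corners and weighted shifts -/

section Shifts

/-- The corner `P_t T P_s` of an operator on spinors. -/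
abbrev corner (t : Fin 2) (T : SpinOp) (s : Fin 2) : SpinOp := spinProj t * T * spinProj s

theorem spinProj_ket (s : Fin 2) (l : SpinIndex) :
    spinProj s (ket l) = if l.s = s then ket l else 0 := by
  refine lp.ext (funext fun k => ?_)
  rw [hasMatrix_spinProj s k l]
  by_cases hk : k = l
  · subst hk
    by_cases hs : k.s = s <;> simp [hs, ket_apply_self]
  · by_cases hs : l.s = s <;> simp [hs, hk, ket_apply_ne hk]

theorem spinProj_apply (s : Fin 2) (ψ : ℓ²(SpinIndex, ℂ)) (k : SpinIndex) :
    spinProj s ψ k = if k.s = s then ψ k else 0 := by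
  classical
  have h := (hasMatrix_spinProj s).hasSum ψ k
  refine h.unique ((hasSum_ite_eq k (if k.s = s then ψ k else 0)).congr_fun fun l => ?_)
  by_cases hl : k = l
  · subst hl; simp
  · simp [hl, Ne.symm hl]

theorem spinProj_add : spinProj 0 + spinProj 1 = 1 := by
  refine clm_ext_ket fun l => ?_
  have hl : l.s = 0 ∨ l.s = 1 := by omega
  rcases hl with hl | hl <;> simp [spinProj_ket, hl]

theorem star_spinProj (s : Fin 2) : star (spinProj s) = spinProj s := by
  refine (hasMatrix_spinProj s).adjoint.unique ((hasMatrix_spinProj s).congr fun k l => ?_)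
  by_cases h : k = l
  · subst h; simp [apply_ite]
  · simp [h, Ne.symm h]

theorem star_corner (t s : Fin 2) (T : SpinOp) : star (corner t T s) = corner s (star T) t := by
  simp only [corner, star_mul, star_spinProj, mul_assoc]

theorem corner_decomp (T : SpinOp) :
    T = corner 0 T 0 + corner 1 T 1 + corner 1 T 0 + corner 0 T 1 := by
  calc T = (spinProj 0 + spinProj 1) * T * (spinProj 0 + spinProj 1) := by
        rw [spinProj_add, one_mul, mul_one]
    _ = _ := by simp only [corner]; noncomm_ring

theorem HasMatrix.corner {T : SpinOp} {M : SpinIndex → SpinIndex → ℂ} (hT : HasMatrix T M)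
    (t s : Fin 2) :
    HasMatrix (corner t T s) fun k l => if l.s = s ∧ k.s = t then M k l else 0 := by
  intro k l
  change spinProj t (T (spinProj s (ket l))) k = _
  rw [spinProj_apply, spinProj_ket]
  by_cases hl : l.s = s <;> by_cases hk : k.s = t <;> simp [hl, hk, hT k l]

/-- The matrix of the weighted shift that sends the ket labelled `(x, y, 2j, s)` to
`c x y 2j` times the ket labelled `(x + dx, y + dy, 2j + dN, t)` and kills the other spin. -/
def shiftMatrix (s t : Fin 2) (dx dy dN : ℤ) (c : ℤ → ℤ → ℤ → ℝ) (k l : SpinIndex) : ℂ :=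
  if l.s = s ∧ k.s = t ∧ (k.x : ℤ) = l.x + dx ∧ (k.y : ℤ) = l.y + dy ∧ (k.twoJ : ℤ) = l.twoJ + dN
  then ((c l.x l.y l.twoJ : ℝ) : ℂ) else 0

/-- The half-integer relating the label `y` to `n + j`. -/
def spinOffset (s : Fin 2) : ℝ := if s = 0 then 1 / 2 else -1 / 2

theorem SpinIndex.n_eq (l : SpinIndex) : l.n = l.y - l.twoJ / 2 - spinOffset l.s := by
  unfold SpinIndex.n spinOffset SpinIndex.j
  split_ifs <;> ring

/-- In the labels `(x, y, 2j)` a corner of an operator given by `2 × 2` blocks is a weighted shift. -/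
theorem HasMatrix.shift {T : SpinOp} {dj dn : ℝ} {F : ℝ → ℝ → ℝ → Matrix (Fin 2) (Fin 2) ℝ}
    (hT : HasMatrix T (spinMatrix dj dn F)) (s t : Fin 2) (dx dy dN : ℤ) (hN : (dN : ℝ) = 2 * dj)
    (hx : (dx : ℝ) = dj + 1 / 2) (hy : (dy : ℝ) = dn + dj + spinOffset t - spinOffset s) :
    HasMatrix (SUq2.corner t T s) (shiftMatrix s t dx dy dN fun x y N =>
      F (N / 2) (x - N / 2) (y - N / 2 - spinOffset s) t s) := by
  refine (hT.corner t s).congr fun k l => ?_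
  unfold shiftMatrix spinMatrix
  by_cases hl : l.s = s
  · by_cases hk : k.s = t
    · have e : (k.j = l.j + dj ∧ k.mu = l.mu + 1 / 2 ∧ k.n = l.n + dn) ↔
          ((k.x : ℤ) = l.x + dx ∧ (k.y : ℤ) = l.y + dy ∧ (k.twoJ : ℤ) = l.twoJ + dN) := by
        rw [SpinIndex.n_eq, SpinIndex.n_eq, hl, hk]
        unfold SpinIndex.mu SpinIndex.j
        constructor
        · rintro ⟨h1, h2, h3⟩
          refine ⟨?_, ?_, ?_⟩
          · have : (k.x : ℝ) = l.x + dx := by linarith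
            exact_mod_cast this
          · have : (k.y : ℝ) = l.y + dy := by linarith
            exact_mod_cast this
          · have : (k.twoJ : ℝ) = l.twoJ + dN := by linarith
            exact_mod_cast this
        · rintro ⟨h1, h2, h3⟩
          have h1' : (k.x : ℝ) = l.x + dx := by exact_mod_cast h1
          have h2' : (k.y : ℝ) = l.y + dy := by exact_mod_cast h2
          have h3' : (k.twoJ : ℝ) = l.twoJ + dN := by exact_mod_cast h3
          refine ⟨?_, ?_, ?_⟩ <;> linarith
      simp only [hl, hk, e, true_and, and_self, if_true]
      split_ifs
      · rw [SpinIndex.n_eq, hl]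
        simp [SpinIndex.mu, SpinIndex.j]
      · rfl
    · simp [hl, hk]
  · simp [hl]

theorem HasMatrix.star_shift {T : SpinOp} {s t : Fin 2} {dx dy dN : ℤ} {c : ℤ → ℤ → ℤ → ℝ}
    (hT : HasMatrix T (shiftMatrix s t dx dy dN c)) :
    HasMatrix (star T) (shiftMatrix t s (-dx) (-dy) (-dN) fun x y N =>
      c (x - dx) (y - dy) (N - dN)) := by
  refine hT.adjoint.congr fun k l => ?_
  unfold shiftMatrix
  rw [apply_ite star, star_zero]
  refine if_ctx_congr ?_ ?_ (fun _ => rfl)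
  · constructor
    · rintro ⟨h1, h2, h3, h4, h5⟩
      exact ⟨h2, h1, by omega, by omega, by omega⟩
    · rintro ⟨h1, h2, h3, h4, h5⟩
      exact ⟨h2, h1, by omega, by omega, by omega⟩
  · rintro ⟨h1, h2, h3, h4, h5⟩
    beta_reduce
    rw [show (l.x : ℤ) - dx = k.x by omega, show (l.y : ℤ) - dy = k.y by omega,
      show (l.twoJ : ℤ) - dN = k.twoJ by omega]
    simp

theorem SpinIndex.eq_of_params {k l : SpinIndex} (hs : k.s = l.s) (hN : k.twoJ = l.twoJ)
    (hx : k.x = l.x) (hy : k.y = l.y) : k = l := by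
  cases k; cases l; simp_all

theorem exists_hasMatrix_shift (s t : Fin 2) (dx dy dN : ℤ) (c : ℤ → ℤ → ℤ → ℝ) (C : ℝ)
    (hC : ∀ l : SpinIndex, l.s = s → |c l.x l.y l.twoJ| ≤ C) :
    ∃ T, HasMatrix T (shiftMatrix s t dx dy dN c) := by
  refine exists_hasMatrix _ (max C 0) ?_ ?_ ?_
  · intro k l
    unfold shiftMatrix
    split_ifs with h
    · rw [Complex.norm_real]; exact (hC l h.1).trans (le_max_left _ _)
    · simp
  · intro k l l' h h'
    simp only [shiftMatrix, ne_eq, ite_eq_right_iff, not_forall] at h h'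
    obtain ⟨⟨h1, h2, h3, h4, h5⟩, -⟩ := h
    obtain ⟨⟨h1', h2', h3', h4', h5'⟩, -⟩ := h'
    exact SpinIndex.eq_of_params (h1.trans h1'.symm) (by omega) (by omega) (by omega)
  · intro k k' l h h'
    simp only [shiftMatrix, ne_eq, ite_eq_right_iff, not_forall] at h h'
    obtain ⟨⟨h1, h2, h3, h4, h5⟩, -⟩ := h
    obtain ⟨⟨h1', h2', h3', h4', h5'⟩, -⟩ := h'
    exact SpinIndex.eq_of_params (h2.trans h2'.symm) (by omega) (by omega) (by omega)

theorem abs_diracEigenvalue (k : SpinIndex) :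
    |diracEigenvalue k| = k.twoJ + 1 + spinOffset k.s := by
  have h := one_le_abs_diracEigenvalue k
  unfold diracEigenvalue spinOffset SpinIndex.j at *
  split_ifs at * with hs
  · rw [abs_of_nonneg (by positivity)]; ring
  · rw [abs_neg, abs_of_nonneg (by positivity)]; ring

theorem HasMatrix.abs_commutator_shift {T : SpinOp} {s t : Fin 2} {dx dy dN : ℤ}
    {c : ℤ → ℤ → ℤ → ℝ} (hT : HasMatrix T (shiftMatrix s t dx dy dN c)) (e : ℝ)
    (he : e = dN + spinOffset t - spinOffset s) :
    IsCommutator (diagOp fun i => |diracEigenvalue i|) T ((e : ℂ) • T) := by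
  refine hT.isCommutator_smul e fun k l h => ?_
  simp only [shiftMatrix, ne_eq, ite_eq_right_iff, not_forall] at h
  obtain ⟨⟨h1, h2, h3, h4, h5⟩, -⟩ := h
  rw [abs_diracEigenvalue, abs_diracEigenvalue, h1, h2, he]
  have : (k.twoJ : ℝ) = l.twoJ + dN := by exact_mod_cast h5
  rw [this]; ring

theorem HasMatrix.commutator_shift {T : SpinOp} {s : Fin 2} {dx dy dN : ℤ}
    {c : ℤ → ℤ → ℤ → ℝ} (hT : HasMatrix T (shiftMatrix s s dx dy dN c)) (e : ℝ)
    (he : e = if s = 0 then (dN : ℝ) else -dN) :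
    IsCommutator (diagOp diracEigenvalue) T ((e : ℂ) • T) := by
  refine hT.isCommutator_smul e fun k l h => ?_
  simp only [shiftMatrix, ne_eq, ite_eq_right_iff, not_forall] at h
  obtain ⟨⟨h1, h2, h3, h4, h5⟩, -⟩ := h
  have : (k.twoJ : ℝ) = l.twoJ + dN := by exact_mod_cast h5
  simp only [diracEigenvalue, SpinIndex.j]
  rw [h1, h2, he]
  split_ifs <;> rw [this] <;> ring

end Shifts

/-! ### Decompositions into eigenvectors of `δ` -/

section Generators

variable {q : Set.Ioo (0 : ℝ) 1}

theorem DeltaOrbit.mem_deltaAlgebra {ι : Type*} {lam : ι → ℝ} {A : Set (ℓ²(ι, ℂ) →L[ℂ] ℓ²(ι, ℂ))}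
    {T : ℓ²(ι, ℂ) →L[ℂ] ℓ²(ι, ℂ)} (h : DeltaOrbit lam A T) : T ∈ deltaAlgebra lam A :=
  Algebra.subset_adjoin h

theorem DeltaOrbit.mem_psiZero {ι : Type*} {lam : ι → ℝ} {A : Set (ℓ²(ι, ℂ) →L[ℂ] ℓ²(ι, ℂ))}
    {T : ℓ²(ι, ℂ) →L[ℂ] ℓ²(ι, ℂ)}
    (h : DeltaOrbit lam (A ∪ {S | ∃ T ∈ A, IsCommutator (diagOp lam) T S}) T) :
    T ∈ psiZero lam A :=
  Algebra.subset_adjoin h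

/-- A decomposition of an operator `X` into eigenvectors of `δ`: `pu` and `pd`, of weight `1`, `mu` and
`md`, of weight `-1`, and `o`, of weight `0`. The operators `pu` and `mu` act within the up kets, `pd`
and `md` within the down kets, so that their commutators with `D` and with `|D|` agree up to sign;
`d` is the commutator `[D, o]`. -/
structure SpinSplit (X pu pd mu md o d : SpinOp) : Prop where
  sum : X = pu + pd + mu + md + o
  abs_pu : IsCommutator (diagOp fun i => |diracEigenvalue i|) pu pu
  abs_pd : IsCommutator (diagOp fun i => |diracEigenvalue i|) pd pd
  abs_mu : IsCommutator (diagOp fun i => |diracEigenvalue i|) mu (-mu)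
  abs_md : IsCommutator (diagOp fun i => |diracEigenvalue i|) md (-md)
  abs_o : IsCommutator (diagOp fun i => |diracEigenvalue i|) o 0
  abs_d : IsCommutator (diagOp fun i => |diracEigenvalue i|) d 0
  dir_pu : IsCommutator (diagOp diracEigenvalue) pu pu
  dir_pd : IsCommutator (diagOp diracEigenvalue) pd (-pd)
  dir_mu : IsCommutator (diagOp diracEigenvalue) mu (-mu)
  dir_md : IsCommutator (diagOp diracEigenvalue) md md
  dir_o : IsCommutator (diagOp diracEigenvalue) o d

namespace SpinSplit
variable {X pu pd mu md o d : SpinOp} (h : SpinSplit X pu pd mu md o d)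
include h

theorem star : SpinSplit (star X) (star mu) (star md) (star pu) (star pd) (star o) (-star d) where
  sum := by rw [h.sum]; simp only [star_add]; abel
  abs_pu := by simpa using h.abs_mu.star
  abs_pd := by simpa using h.abs_md.star
  abs_mu := h.abs_pu.star
  abs_md := h.abs_pd.star
  abs_o := by simpa using h.abs_o.star
  abs_d := by simpa using h.abs_d.star.smul (-1)
  dir_pu := by simpa using h.dir_mu.star
  dir_pd := h.dir_md.star
  dir_mu := h.dir_pu.star
  dir_md := by simpa using h.dir_pd.star
  dir_o := h.dir_o.star

theorem delta : IsCommutator (diagOp fun i => |diracEigenvalue i|) X (pu + pd - (mu + md)) := by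
  have := (((h.abs_pu.add h.abs_pd).add h.abs_mu).add h.abs_md).add h.abs_o
  rw [← h.sum] at this
  convert this using 1; abel

theorem delta_sq : IsCommutator (diagOp fun i => |diracEigenvalue i|) (pu + pd - (mu + md))
    (pu + pd + (mu + md)) := by
  have := (h.abs_pu.add h.abs_pd).add ((h.abs_mu.add h.abs_md).smul (-1))
  convert this using 1
  · simp only [neg_smul, one_smul]; abel
  · simp only [neg_smul, one_smul]; abel

theorem dirac : IsCommutator (diagOp diracEigenvalue) X (pu - pd - mu + md + d) := by
  have := (((h.dir_pu.add h.dir_pd).add h.dir_mu).add h.dir_md).add h.dir_o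
  rw [← h.sum] at this
  convert this using 1; abel

theorem delta_dirac : IsCommutator (diagOp fun i => |diracEigenvalue i|) (pu - pd - mu + md + d)
    (pu - pd + mu - md) := by
  have := (((h.abs_pu.add (h.abs_pd.smul (-1))).add (h.abs_mu.smul (-1))).add h.abs_md).add h.abs_d
  convert this using 1
  · simp only [neg_smul, one_smul]; abel
  · simp only [neg_smul, one_smul]; abel

theorem delta_sq_dirac : IsCommutator (diagOp fun i => |diracEigenvalue i|) (pu - pd + mu - md)
    (pu - pd - mu + md) := by
  have := ((h.abs_pu.add (h.abs_pd.smul (-1))).add h.abs_mu).add (h.abs_md.smul (-1))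
  convert this using 1
  · simp only [neg_smul, one_smul]; abel
  · simp only [neg_smul, one_smul]; abel

/-- The weight components of `X` are linear combinations of `X`, `δ X` and `δ² X`. -/
theorem mem_deltaAlgebra {A : Set SpinOp} (hX : X ∈ A) :
    pu + pd ∈ deltaAlgebra diracEigenvalue A ∧ mu + md ∈ deltaAlgebra diracEigenvalue A ∧
      o ∈ deltaAlgebra diracEigenvalue A := by
  have h0 : DeltaOrbit diracEigenvalue A X := .base hX
  have h1 := h0.step h.delta
  have h2 := h1.step h.delta_sq
  have m0 := h0.mem_deltaAlgebra
  have m1 := h1.mem_deltaAlgebra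
  have m2 := h2.mem_deltaAlgebra
  refine ⟨?_, ?_, ?_⟩
  · convert Subalgebra.smul_mem _ (add_mem m1 m2) (1 / 2 : ℂ) using 1
    module
  · convert Subalgebra.smul_mem _ (sub_mem m2 m1) (1 / 2 : ℂ) using 1
    module
  · convert sub_mem m0 m2 using 1
    rw [h.sum]; abel

/-- Spin and weight components of `X` are linear combinations of the `δᵏ X` and the `δᵏ [D, X]`: on
the components of weight `±1` the operator `[D, ·]` differs from `δ` by a sign that depends on the
spin. -/
theorem mem_psiZero {A : Set SpinOp} (hX : X ∈ A) :
    pu ∈ psiZero diracEigenvalue A ∧ pd ∈ psiZero diracEigenvalue A ∧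
    mu ∈ psiZero diracEigenvalue A ∧ md ∈ psiZero diracEigenvalue A ∧
    o ∈ psiZero diracEigenvalue A ∧ d ∈ psiZero diracEigenvalue A := by
  have hsub : deltaAlgebra diracEigenvalue A ≤ psiZero diracEigenvalue A :=
    Algebra.adjoin_mono fun T hT => DeltaOrbit.mono Set.subset_union_left hT
  obtain ⟨hp, hm, ho⟩ := h.mem_deltaAlgebra hX
  replace hp := hsub hp
  replace hm := hsub hm
  have h0 : DeltaOrbit diracEigenvalue
      (A ∪ {S | ∃ T ∈ A, IsCommutator (diagOp diracEigenvalue) T S}) (pu - pd - mu + md + d) :=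
    .base (Or.inr ⟨X, hX, h.dirac⟩)
  have h1 := h0.step h.delta_dirac
  have h2 := h1.step h.delta_sq_dirac
  have m0 := h0.mem_psiZero
  have m1 := h1.mem_psiZero
  have m2 := h2.mem_psiZero
  refine ⟨?_, ?_, ?_, ?_, hsub ho, ?_⟩
  · convert Subalgebra.smul_mem _ (add_mem (add_mem m1 m2) (add_mem hp hp)) (1 / 4 : ℂ) using 1
    module
  · convert Subalgebra.smul_mem _ (sub_mem (add_mem hp hp) (add_mem m1 m2)) (1 / 4 : ℂ) using 1
    module
  · convert Subalgebra.smul_mem _ (add_mem (sub_mem m1 m2) (add_mem hm hm)) (1 / 4 : ℂ) using 1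
    module
  · convert Subalgebra.smul_mem _ (sub_mem (add_mem hm hm) (sub_mem m1 m2)) (1 / 4 : ℂ) using 1
    module
  · convert sub_mem m0 m2 using 1
    abel

end SpinSplit
end Generators

/-! ### Functionals on tensor products -/

section TensorFunctionals

variable {A B : Type*} [AddCommGroup A] [Module ℂ A] [AddCommGroup B] [Module ℂ B]

/-- The functional `f ⊗ g` on a tensor product. -/
def tensorFun (f : A →ₗ[ℂ] ℂ) (g : B →ₗ[ℂ] ℂ) : A ⊗[ℂ] B →ₗ[ℂ] ℂ :=
  LinearMap.mul' ℂ ℂ ∘ₗ TensorProduct.map f g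

@[simp] theorem tensorFun_tmul (f : A →ₗ[ℂ] ℂ) (g : B →ₗ[ℂ] ℂ) (a : A) (b : B) :
    tensorFun f g (a ⊗ₜ b) = f a * g b := by
  simp [tensorFun]

/-- Point-separating families of functionals on `A` and on `B` yield a point-separating family on
`A ⊗ B`. -/
theorem eq_zero_of_tensorFun {I J : Type*} (f : I → A →ₗ[ℂ] ℂ) (g : J → B →ₗ[ℂ] ℂ)
    (hf : ∀ a, (∀ i, f i a = 0) → a = 0) (hg : ∀ b, (∀ j, g j b = 0) → b = 0) (w : A ⊗[ℂ] B)
    (h : ∀ i j, tensorFun (f i) (g j) w = 0) : w = 0 := by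
  classical
  let 𝒞 := Module.Basis.ofVectorSpace ℂ B
  let E := TensorProduct.equivFinsuppOfBasisRight (R := ℂ) (M := A) 𝒞
  let slice : I → A ⊗[ℂ] B →ₗ[ℂ] B := fun i =>
    (TensorProduct.lid ℂ B).toLinearMap ∘ₗ LinearMap.rTensor B (f i)
  have h1 : ∀ i, slice i w = 0 := by
    intro i
    refine hg _ fun j => ?_
    rw [← h i j]
    have : g j ∘ₗ slice i = tensorFun (f i) (g j) := by
      ext a b; simp [slice]
    rw [← this]; rfl
  have h2 : E w = 0 := by
    ext c
    refine hf _ fun i => ?_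
    have : ∀ w, f i (E w c) = 𝒞.repr (slice i w) c := by
      intro w
      induction w using TensorProduct.induction_on with
      | zero => simp
      | tmul a b =>
        simp only [E, TensorProduct.equivFinsuppOfBasisRight_apply_tmul_apply]
        simp [slice, mul_comm]
      | add x y hx hy => simp only [map_add, Finsupp.add_apply, hx, hy]
    rw [this, h1]; simp
  exact E.map_eq_zero_iff.mp h2

end TensorFunctionals

/-! ### The action of symbols on the model space -/

section SymbolAction

variable {q : Set.Ioo (0 : ℝ) 1} {ε : ℤˣ}

theorem disk_induction {P : disk q ε → Prop} (hA : P (rA q ε)) (hA' : P (star (rA q ε)))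
    (hB : P (rB q ε)) (hB' : P (star (rB q ε))) (hc : ∀ c : ℂ, P (algebraMap ℂ _ c))
    (hadd : ∀ x y, P x → P y → P (x + y)) (hmul : ∀ x y, P x → P y → P (x * y)) (x : disk q ε) :
    P x := by
  obtain ⟨x, hx⟩ := x
  have hx' : x ∈ Algebra.adjoin ℂ
      ({diskA q, diskB q ε} ∪ star {diskA q, diskB q ε} :
        Set (ℓ²(ℕ, ℂ) →L[ℂ] ℓ²(ℕ, ℂ))) := by
    rw [← StarAlgebra.adjoin_toSubalgebra]; exact hx
  suffices h : ∃ h : x ∈ disk q ε, P ⟨x, h⟩ from h.2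
  clear hx
  induction hx' using Algebra.adjoin_induction with
  | mem x hx =>
    simp only [Set.mem_union, Set.mem_insert_iff, Set.mem_singleton_iff, Set.mem_star] at hx
    rcases hx with (rfl | rfl) | (hx | hx)
    · exact ⟨_, hA⟩
    · exact ⟨_, hB⟩
    · obtain rfl : x = star (diskA q) := by rw [← hx, star_star]
      exact ⟨(star (rA q ε)).2, hA'⟩
    · obtain rfl : x = star (diskB q ε) := by rw [← hx, star_star]
      exact ⟨(star (rB q ε)).2, hB'⟩
  | algebraMap c => exact ⟨_, hc c⟩
  | add x y _ _ ihx ihy => exact ⟨_, hadd _ _ ihx.2 ihy.2⟩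
  | mul x y _ _ ihx ihy => exact ⟨_, hmul _ _ ihx.2 ihy.2⟩

/-- The defining action of the disk algebra on `ℓ²(ℕ)`, as linear maps. -/
def diskEnd : disk q ε →ₐ[ℂ] Module.End ℂ ℓ²(ℕ, ℂ) where
  toFun x := (x : ℓ²(ℕ, ℂ) →L[ℂ] ℓ²(ℕ, ℂ)).toLinearMap
  map_one' := rfl
  map_mul' _ _ := rfl
  map_zero' := rfl
  map_add' _ _ := rfl
  commutes' c := by ext1 ψ; simp [Algebra.algebraMap_eq_smul_one]

/-- The algebraic tensor product on which symbols act: two copies of `ℓ²(ℕ)` for the labels `x`, `y`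
and the Laurent polynomials for the label `2j`. -/
abbrev ModelSpace : Type := (ℓ²(ℕ, ℂ) ⊗[ℂ] ℓ²(ℕ, ℂ)) ⊗[ℂ] ℂ[T;T⁻¹]

/-- The action of the symbol algebra: the disk algebras act on their copy of `ℓ²(ℕ)` and `u` shifts
`2j`. -/
def symbolRep : SymbolAlgebra q →ₐ[ℂ] Module.End ℂ ModelSpace :=
  (Module.endTensorEndAlgHom (R := ℂ) (S := ℂ) (A := ℂ)).comp
    (Algebra.TensorProduct.map
      ((Module.endTensorEndAlgHom (R := ℂ) (S := ℂ) (A := ℂ)).comp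
        (Algebra.TensorProduct.map diskEnd diskEnd))
      (Algebra.lmul ℂ ℂ[T;T⁻¹]))

theorem symbolRep_tmul (a : disk q 1) (b : disk q (-1)) (p p' : ℂ[T;T⁻¹]) (f g : ℓ²(ℕ, ℂ)) :
    symbolRep ((a ⊗ₜ[ℂ] b) ⊗ₜ[ℂ] p) ((f ⊗ₜ[ℂ] g) ⊗ₜ[ℂ] p') =
      ((a : ℓ²(ℕ, ℂ) →L[ℂ] ℓ²(ℕ, ℂ)) f ⊗ₜ[ℂ] (b : ℓ²(ℕ, ℂ) →L[ℂ] ℓ²(ℕ, ℂ)) g) ⊗ₜ[ℂ] (p * p') :=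
  rfl

/-- The basis vector with labels `(x, y, 2j)`, zero if `x` or `y` is negative. -/
def modelKet (x y N : ℤ) : ModelSpace :=
  (intKet x ⊗ₜ[ℂ] intKet y) ⊗ₜ[ℂ] (LaurentPolynomial.T N : ℂ[T;T⁻¹])

/-- The coordinate functional of `ℓ²(ℕ)`. -/
def evalAt (x : ℕ) : ℓ²(ℕ, ℂ) →ₗ[ℂ] ℂ where
  toFun f := f x
  map_add' _ _ := rfl
  map_smul' _ _ := rfl

@[simp] theorem evalAt_apply (x : ℕ) (f : ℓ²(ℕ, ℂ)) : evalAt x f = f x := rfl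

/-- The coefficient functional of Laurent polynomials. -/
def coeffAt (m : ℤ) : ℂ[T;T⁻¹] →ₗ[ℂ] ℂ where
  toFun p := p.coeff m
  map_add' _ _ := by simp
  map_smul' _ _ := by simp

@[simp] theorem coeffAt_apply (m : ℤ) (p : ℂ[T;T⁻¹]) : coeffAt m p = p.coeff m := rfl

/-- The coordinate functional for the label `(x, y, 2j)`. -/
def coordAt (x y : ℕ) (N : ℤ) : ModelSpace →ₗ[ℂ] ℂ :=
  tensorFun (tensorFun (evalAt x) (evalAt y)) (coeffAt N)

open Classical in
/-- The basis vector of the spinor space with integer labels, zero if the labels are out of range. -/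
def spinKet (s : Fin 2) (x y N : ℤ) : ℓ²(SpinIndex, ℂ) :=
  if h : ∃ k : SpinIndex, k.s = s ∧ (k.x : ℤ) = x ∧ (k.y : ℤ) = y ∧ (k.twoJ : ℤ) = N then
    ket h.choose else 0

theorem spinKet_index (k : SpinIndex) : spinKet k.s k.x k.y k.twoJ = ket k := by
  have h : ∃ k' : SpinIndex, k'.s = k.s ∧ (k'.x : ℤ) = k.x ∧ (k'.y : ℤ) = k.y ∧
      (k'.twoJ : ℤ) = k.twoJ := ⟨k, rfl, rfl, rfl, rfl⟩
  rw [spinKet, dif_pos h]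
  obtain ⟨h1, h2, h3, h4⟩ := h.choose_spec
  rw [SpinIndex.eq_of_params h1 (by omega) (by omega) (by omega)]

theorem spinKet_of_not_exists {s : Fin 2} {x y N : ℤ}
    (h : ¬∃ k : SpinIndex, k.s = s ∧ (k.x : ℤ) = x ∧ (k.y : ℤ) = y ∧ (k.twoJ : ℤ) = N) :
    spinKet s x y N = 0 := by
  rw [spinKet, dif_neg h]

theorem spinKet_apply (s : Fin 2) (x y N : ℤ) (k : SpinIndex) : spinKet s x y N k =
    if k.s = s ∧ (k.x : ℤ) = x ∧ (k.y : ℤ) = y ∧ (k.twoJ : ℤ) = N then 1 else 0 := by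
  by_cases h : ∃ k : SpinIndex, k.s = s ∧ (k.x : ℤ) = x ∧ (k.y : ℤ) = y ∧ (k.twoJ : ℤ) = N
  · obtain ⟨l, rfl, rfl, rfl, rfl⟩ := h
    rw [spinKet_index]
    split_ifs with hk
    · obtain ⟨h1, h2, h3, h4⟩ := hk
      rw [SpinIndex.eq_of_params h1 (by omega) (by omega) (by omega), ket_apply_self]
    · refine ket_apply_ne fun e => hk ?_
      rw [e]; exact ⟨rfl, rfl, rfl, rfl⟩
  · rw [spinKet_of_not_exists h, if_neg fun hk => h ⟨k, hk⟩]
    rfl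

theorem norm_spinKet_le (s : Fin 2) (x y N : ℤ) : ‖spinKet s x y N‖ ≤ 1 := by
  by_cases h : ∃ k : SpinIndex, k.s = s ∧ (k.x : ℤ) = x ∧ (k.y : ℤ) = y ∧ (k.twoJ : ℤ) = N
  · obtain ⟨l, rfl, rfl, rfl, rfl⟩ := h
    rw [spinKet_index, norm_ket]
  · rw [spinKet_of_not_exists h, norm_zero]; exact zero_le_one

theorem exists_index_iff (s : Fin 2) (x y N : ℤ) :
    (∃ k : SpinIndex, k.s = s ∧ (k.x : ℤ) = x ∧ (k.y : ℤ) = y ∧ (k.twoJ : ℤ) = N) ↔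
      0 ≤ x ∧ x ≤ N ∧ 0 ≤ y ∧ y < if s = 0 then N + 2 else N := by
  constructor
  · rintro ⟨k, rfl, rfl, rfl, rfl⟩
    have h1 := k.hx
    have h2 := k.hy
    refine ⟨by omega, by omega, by omega, ?_⟩
    split_ifs at * <;> omega
  · rintro ⟨h1, h2, h3, h4⟩
    refine ⟨⟨N.toNat, x.toNat, y.toNat, s, by omega, ?_⟩, rfl, ?_, ?_, ?_⟩
    · split_ifs at * <;> omega
    all_goals simp only; omega

/-- The part of `modelToSpin` on the vectors with a given value `N` of `2j`. -/
def modelBlock (s : Fin 2) (N : ℤ) : ℓ²(ℕ, ℂ) ⊗[ℂ] ℓ²(ℕ, ℂ) →ₗ[ℂ] ℓ²(SpinIndex, ℂ) :=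
  ∑ x ∈ Finset.range (N.toNat + 1), ∑ y ∈ Finset.range (N.toNat + 2),
    (tensorFun (evalAt x) (evalAt y)).smulRight (spinKet s x y N)

/-- The map from the model space to spinors of spin `s` that matches the labels of the basis vectors
and annihilates those whose labels are out of range. -/
def modelToSpin (s : Fin 2) : ModelSpace →ₗ[ℂ] ℓ²(SpinIndex, ℂ) :=
  TensorProduct.lift (LinearMap.flip
    ((Finsupp.linearCombination ℂ (modelBlock s)) ∘ₗ
      (AddMonoidAlgebra.coeffLinearEquiv ℂ : ℂ[T;T⁻¹] ≃ₗ[ℂ] ℤ →₀ ℂ).toLinearMap))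

theorem modelBlock_tmul_apply (s : Fin 2) (N : ℤ) (f g : ℓ²(ℕ, ℂ)) (k : SpinIndex) :
    modelBlock s N (f ⊗ₜ g) k = if k.s = s ∧ (k.twoJ : ℤ) = N then f k.x * g k.y else 0 := by
  have h1 := k.hx
  have h2 : k.y < k.twoJ + 2 := by
    have := k.hy
    split_ifs at this <;> omega
  have e : modelBlock s N (f ⊗ₜ g) k = ∑ x ∈ Finset.range (N.toNat + 1),
      ∑ y ∈ Finset.range (N.toNat + 2), f x * g y * spinKet s x y N k := by
    rw [← inner_ket]
    simp [modelBlock, inner_ket]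
  rw [e]
  simp only [spinKet_apply]
  split_ifs with h
  · obtain ⟨rfl, rfl⟩ := h
    rw [Finset.sum_eq_single k.x, Finset.sum_eq_single k.y]
    · simp
    · intro y _ hy
      simp [Ne.symm hy]
    · intro h'; exact absurd (Finset.mem_range.mpr (by simpa using h2)) h'
    · intro x _ hx
      simp [Ne.symm hx]
    · intro h'; exact absurd (Finset.mem_range.mpr (by simp; omega)) h'
  · refine Finset.sum_eq_zero fun x _ => Finset.sum_eq_zero fun y _ => ?_
    rw [if_neg fun hk => h ⟨hk.1, hk.2.2.2⟩, mul_zero]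

theorem modelToSpin_apply (s : Fin 2) (w : ModelSpace) (k : SpinIndex) :
    modelToSpin s w k = if k.s = s then coordAt k.x k.y k.twoJ w else 0 := by
  induction w using TensorProduct.induction_on with
  | zero => simp
  | add w w' hw hw' =>
    rw [map_add, lp.coeFn_add, Pi.add_apply, hw, hw', map_add]
    split_ifs <;> simp
  | tmul w p =>
    induction w using TensorProduct.induction_on with
    | zero => simp
    | add w w' hw hw' =>
      rw [TensorProduct.add_tmul, map_add, lp.coeFn_add, Pi.add_apply, hw, hw', map_add]
      split_ifs <;> simp
    | tmul f g =>
      induction p using LaurentPolynomial.induction_on' with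
      | add p p' hp hp' =>
        rw [TensorProduct.tmul_add, map_add, lp.coeFn_add, Pi.add_apply, hp, hp', map_add]
        split_ifs <;> simp
      | C_mul_T N c =>
        have : modelToSpin s ((f ⊗ₜ g) ⊗ₜ (LaurentPolynomial.C c * LaurentPolynomial.T N)) =
            c • modelBlock s N (f ⊗ₜ g) := by
          rw [← LaurentPolynomial.single_eq_C_mul_T]
          simp [modelToSpin, -LaurentPolynomial.single_eq_C_mul_T]
        rw [this, lp.coeFn_smul, Pi.smul_apply, modelBlock_tmul_apply, smul_eq_mul, coordAt,
          tensorFun_tmul, tensorFun_tmul, coeffAt_apply, ← LaurentPolynomial.single_eq_C_mul_T]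
        by_cases hs : k.s = s
        · by_cases hN : (k.twoJ : ℤ) = N
          · simp [hs, hN, -LaurentPolynomial.single_eq_C_mul_T, mul_comm]
          · simp [hs, hN, -LaurentPolynomial.single_eq_C_mul_T]
        · simp [hs]

theorem intKet_apply (n : ℤ) (m : ℕ) : intKet n m = if (m : ℤ) = n then 1 else 0 := by
  unfold intKet
  split_ifs with h1 h2 h2
  · rw [show n.toNat = m by omega, ket_apply_self]
  · exact ket_apply_ne (by omega)
  · omega
  · rfl

theorem coeff_T (m N : ℤ) : (LaurentPolynomial.T N : ℂ[T;T⁻¹]).coeff m = if m = N then 1 else 0 := by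
  by_cases h : m = N
  · simp [h]
  · simpa [h] using Ne.symm h

theorem modelToSpin_modelKet (s : Fin 2) (x y N : ℤ) :
    modelToSpin s (modelKet x y N) = spinKet s x y N := by
  refine lp.ext (funext fun k => ?_)
  rw [modelToSpin_apply, spinKet_apply, modelKet, coordAt, tensorFun_tmul, tensorFun_tmul,
    evalAt_apply, evalAt_apply, coeffAt_apply, intKet_apply, intKet_apply, coeff_T]
  by_cases h1 : k.s = s <;> by_cases h2 : (k.x : ℤ) = x <;> by_cases h3 : (k.y : ℤ) = y <;>
    by_cases h4 : (k.twoJ : ℤ) = N <;> simp [h1, h2, h3, h4]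

end SymbolAction

/-! ### The generators of the disk algebras -/

section Alpha
variable (q : Set.Ioo (0 : ℝ) 1)

/-- The weight `√(1 - q^(2x+2))` of the shift `π_±(a)`, for all integers `x`; it vanishes at `x = -1`. -/
def alpha (x : ℤ) : ℝ := √(1 - (q : ℝ) ^ (2 * x + 2))

theorem alpha_neg_one : alpha q (-1) = 0 := by simp [alpha]

theorem alpha_nonneg (x : ℤ) : 0 ≤ alpha q x := Real.sqrt_nonneg _

theorem alpha_le_one (x : ℤ) : alpha q x ≤ 1 := by
  apply Real.sqrt_le_one.mpr
  have : 0 < (q : ℝ) ^ (2 * x + 2) := zpow_pos q.2.1 _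
  linarith

theorem diskA_intKet (x : ℤ) : diskA q (intKet x) = (alpha q x : ℂ) • intKet (x + 1) := by
  rcases lt_or_ge x 0 with h | h
  · rw [intKet_neg h, map_zero]
    rcases (show x = -1 ∨ x + 1 < 0 by omega) with rfl | h'
    · simp [alpha_neg_one]
    · rw [intKet_neg h', smul_zero]
  · lift x to ℕ using h
    rw [intKet_natCast, show ((x : ℤ) + 1) = ((x + 1 : ℕ) : ℤ) by push_cast; rfl, intKet_natCast]
    refine apply_ket_eq (hasMatrix_diskA q) x (x + 1) _ fun k => ?_
    unfold alpha
    norm_cast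

theorem star_diskA_intKet (x : ℤ) :
    star (diskA q) (intKet x) = (alpha q (x - 1) : ℂ) • intKet (x - 1) := by
  rcases lt_or_ge x 0 with h | h
  · rw [intKet_neg h, map_zero, intKet_neg (by omega), smul_zero]
  · lift x to ℕ using h
    rcases x with _ | x
    · rw [intKet_natCast, apply_ket_eq (hasMatrix_diskA q).adjoint 0 0 0 (fun k => by simp),
        intKet_neg (by simp)]
      simp
    · rw [intKet_natCast, show (((x + 1 : ℕ) : ℤ) - 1) = (x : ℤ) by push_cast; ring, intKet_natCast]
      refine apply_ket_eq (hasMatrix_diskA q).adjoint (x + 1) x _ fun k => ?_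
      by_cases hk : k = x
      · subst hk
        simp only [alpha, if_true, Complex.star_def, Complex.conj_ofReal]
        norm_cast
      · rw [if_neg (by omega), if_neg hk, star_zero]

theorem diskB_intKet (ε : ℤˣ) (x : ℤ) :
    diskB q ε (intKet x) = ((ε : ℂ) * ((q : ℝ) ^ x : ℝ)) • intKet x := by
  rcases lt_or_ge x 0 with h | h
  · rw [intKet_neg h, map_zero, smul_zero]
  · lift x to ℕ using h
    rw [intKet_natCast]
    refine apply_ket_eq (hasMatrix_diskB q ε) x x _ fun k => ?_
    by_cases hk : k = x <;> simp [hk]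

theorem star_diskB (ε : ℤˣ) : star (diskB q ε) = diskB q ε := by
  refine (hasMatrix_diskB q ε).adjoint.unique ((hasMatrix_diskB q ε).congr fun k l => ?_)
  by_cases h : k = l
  · subst h
    rcases Int.units_eq_one_or ε with rfl | rfl <;> simp
  · simp [h, Ne.symm h]

theorem star_rB (ε : ℤˣ) : star (rB q ε) = rB q ε := Subtype.ext (star_diskB q ε)

end Alpha

/-! ### Symbols preserve exponential bounds -/

section Tame

variable (q : Set.Ioo (0 : ℝ) 1)

/-- The decay rate `√q` per unit of `2j` of the errors in the symbol calculus. The rate is chosen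
larger than `q` so that it absorbs polynomial factors. -/
def rate : ℝ := √(q : ℝ)

theorem rate_pos : 0 < rate q := Real.sqrt_pos.mpr q.2.1

theorem rate_lt_one : rate q < 1 := by
  rw [rate, Real.sqrt_lt' one_pos]; simpa using q.2.2

theorem q_le_rate : (q : ℝ) ≤ rate q := by
  have h0 := q.2.1
  have h1 := q.2.2
  rw [rate]
  exact Real.le_sqrt_of_sq_le (by nlinarith)

theorem rate_sq : rate q ^ 2 = q := Real.sq_sqrt q.2.1.le

variable {q}

/-- Bounds of order `rate ^ (2j)` on basis vectors are preserved by composition with `L`, with a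
constant that depends on `L` only. -/
def IsTame (q : Set.Ioo (0 : ℝ) 1) (L : Module.End ℂ ModelSpace) : Prop :=
  ∃ K : ℝ, 0 ≤ K ∧ ∀ (Ψ : ModelSpace →ₗ[ℂ] ℓ²(SpinIndex, ℂ)) (C : ℝ), 0 ≤ C →
    (∀ x y N, ‖Ψ (modelKet x y N)‖ ≤ C * rate q ^ N) →
      ∀ x y N, ‖Ψ (L (modelKet x y N))‖ ≤ K * C * rate q ^ N

theorem IsTame.add {L L' : Module.End ℂ ModelSpace} (h : IsTame q L) (h' : IsTame q L') :
    IsTame q (L + L') := by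
  obtain ⟨K, hK, h⟩ := h
  obtain ⟨K', hK', h'⟩ := h'
  refine ⟨K + K', by positivity, fun Ψ C hC hΨ x y N => ?_⟩
  rw [LinearMap.add_apply, map_add, add_mul, add_mul]
  exact (norm_add_le _ _).trans (add_le_add (h Ψ C hC hΨ x y N) (h' Ψ C hC hΨ x y N))

theorem IsTame.mul {L L' : Module.End ℂ ModelSpace} (h : IsTame q L) (h' : IsTame q L') :
    IsTame q (L * L') := by
  obtain ⟨K, hK, h⟩ := h
  obtain ⟨K', hK', h'⟩ := h'
  refine ⟨K' * K, by positivity, fun Ψ C hC hΨ x y N => ?_⟩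
  have := h' (Ψ ∘ₗ L) (K * C) (by positivity) (fun x y N => h Ψ C hC hΨ x y N) x y N
  rw [mul_assoc K']
  exact this

theorem IsTame.of_shift {L : Module.End ℂ ModelSpace} (dx dy dN : ℤ) (d : ℤ → ℤ → ℂ) (C : ℝ)
    (hd : ∀ x y, 0 ≤ x → 0 ≤ y → ‖d x y‖ ≤ C)
    (hL : ∀ x y N, L (modelKet x y N) = d x y • modelKet (x + dx) (y + dy) (N + dN)) :
    IsTame q L := by
  have hC : 0 ≤ C := (norm_nonneg _).trans (hd 0 0 le_rfl le_rfl)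
  have hr := rate_pos q
  refine ⟨C * rate q ^ dN, by positivity, fun Ψ C' hC' hΨ x y N => ?_⟩
  by_cases h : 0 ≤ x ∧ 0 ≤ y
  · rw [hL, map_smul, norm_smul]
    calc ‖d x y‖ * ‖Ψ (modelKet (x + dx) (y + dy) (N + dN))‖
        ≤ C * (C' * rate q ^ (N + dN)) := by
          gcongr
          · exact hd x y h.1 h.2
          · exact hΨ _ _ _
      _ = _ := by rw [zpow_add₀ hr.ne']; ring
  · have : modelKet x y N = 0 := by
      rw [modelKet]
      rcases (show x < 0 ∨ y < 0 by omega) with h | h <;> rw [intKet_neg h] <;> simp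
    rw [this, map_zero, map_zero, norm_zero]
    positivity

theorem isTame_algebraMap (c : ℂ) : IsTame q (algebraMap ℂ (Module.End ℂ ModelSpace) c) := by
  refine .of_shift 0 0 0 (fun _ _ => c) ‖c‖ (fun _ _ _ _ => le_rfl) fun x y N => ?_
  simp [Module.algebraMap_end_apply]

theorem norm_intCast_unit (ε : ℤˣ) : ‖(ε : ℂ)‖ = 1 := by
  rcases Int.units_eq_one_or ε with rfl | rfl <;> simp

theorem norm_alpha_le (x : ℤ) : ‖(alpha q x : ℂ)‖ ≤ 1 := by
  rw [Complex.norm_real, Real.norm_of_nonneg (alpha_nonneg q x)]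
  exact alpha_le_one q x

theorem zpow_le_one' {x : ℤ} (hx : 0 ≤ x) : (q : ℝ) ^ x ≤ 1 := by
  lift x to ℕ using hx
  rw [zpow_natCast]
  exact pow_le_one₀ q.2.1.le q.2.2.le

theorem norm_beta_le (ε : ℤˣ) {x : ℤ} (hx : 0 ≤ x) : ‖(ε : ℂ) * ((q : ℝ) ^ x : ℝ)‖ ≤ 1 := by
  rw [norm_mul, norm_intCast_unit, one_mul, Complex.norm_real,
    Real.norm_of_nonneg (zpow_nonneg q.2.1.le _)]
  exact zpow_le_one' hx

theorem isTame_of_diskHom {ε : ℤˣ} (ψ : disk q ε →ₐ[ℂ] Module.End ℂ ModelSpace)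
    (hA : IsTame q (ψ (rA q ε))) (hA' : IsTame q (ψ (star (rA q ε)))) (hB : IsTame q (ψ (rB q ε)))
    (a : disk q ε) : IsTame q (ψ a) := by
  refine disk_induction (P := fun a => IsTame q (ψ a)) hA hA' hB ?_ ?_ ?_ ?_ a
  · rwa [star_rB]
  · intro c
    rw [AlgHom.commutes]; exact isTame_algebraMap c
  · intro a b ha hb
    rw [map_add]; exact ha.add hb
  · intro a b ha hb
    rw [map_mul]; exact ha.mul hb

/-- The action of the first disk algebra on the model space. -/
def actX : disk q 1 →ₐ[ℂ] Module.End ℂ ModelSpace where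
  toFun a := (TensorProduct.map (TensorProduct.map (diskEnd a) LinearMap.id) LinearMap.id)
  map_one' := by ext; simp
  map_mul' a b := by ext; simp
  map_zero' := by ext; simp
  map_add' a b := by ext; simp [TensorProduct.add_tmul]
  commutes' c := by ext; simp [Algebra.algebraMap_eq_smul_one, TensorProduct.smul_tmul']

/-- The action of the second disk algebra on the model space. -/
def actY : disk q (-1) →ₐ[ℂ] Module.End ℂ ModelSpace where
  toFun b := (TensorProduct.map (TensorProduct.map LinearMap.id (diskEnd b)) LinearMap.id)
  map_one' := by ext; simp
  map_mul' a b := by ext; simp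
  map_zero' := by ext; simp
  map_add' a b := by ext; simp [TensorProduct.tmul_add, TensorProduct.add_tmul]
  commutes' c := by ext; simp [Algebra.algebraMap_eq_smul_one, TensorProduct.smul_tmul']

theorem actX_modelKet (a : disk q 1) (x y N : ℤ) : actX a (modelKet x y N) =
    ((a : ℓ²(ℕ, ℂ) →L[ℂ] ℓ²(ℕ, ℂ)) (intKet x) ⊗ₜ[ℂ] intKet y) ⊗ₜ[ℂ] LaurentPolynomial.T N := rfl

theorem actY_modelKet (b : disk q (-1)) (x y N : ℤ) : actY b (modelKet x y N) =
    (intKet x ⊗ₜ[ℂ] (b : ℓ²(ℕ, ℂ) →L[ℂ] ℓ²(ℕ, ℂ)) (intKet y)) ⊗ₜ[ℂ] LaurentPolynomial.T N := rfl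

theorem isTame_actX (a : disk q 1) : IsTame q (actX a) := by
  refine isTame_of_diskHom actX ?_ ?_ ?_ a
  · refine .of_shift 1 0 0 (fun x _ => alpha q x) 1 (fun x _ _ _ => norm_alpha_le x) ?_
    intro x y N
    rw [actX_modelKet, add_zero, add_zero, modelKet, rA, diskA_intKet, TensorProduct.smul_tmul',
      TensorProduct.smul_tmul']
  · refine .of_shift (-1) 0 0 (fun x _ => alpha q (x - 1)) 1 (fun x _ _ _ => norm_alpha_le _) ?_
    intro x y N
    rw [actX_modelKet, add_zero, add_zero, modelKet, StarMemClass.coe_star, rA,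
      star_diskA_intKet, TensorProduct.smul_tmul', TensorProduct.smul_tmul', ← sub_eq_add_neg]
  · refine .of_shift 0 0 0 (fun x _ => ((1 : ℤˣ) : ℂ) * ((q : ℝ) ^ x : ℝ)) 1
      (fun x _ hx _ => norm_beta_le _ hx) ?_
    intro x y N
    rw [actX_modelKet, add_zero, add_zero, add_zero, modelKet, rB, diskB_intKet,
      TensorProduct.smul_tmul', TensorProduct.smul_tmul']

theorem isTame_actY (b : disk q (-1)) : IsTame q (actY b) := by
  refine isTame_of_diskHom actY ?_ ?_ ?_ b
  · refine .of_shift 0 1 0 (fun _ y => alpha q y) 1 (fun _ y _ _ => norm_alpha_le y) ?_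
    intro x y N
    rw [actY_modelKet, add_zero, add_zero, modelKet, rA, diskA_intKet, TensorProduct.tmul_smul,
      ← TensorProduct.smul_tmul']
  · refine .of_shift 0 (-1) 0 (fun _ y => alpha q (y - 1)) 1 (fun _ y _ _ => norm_alpha_le _) ?_
    intro x y N
    rw [actY_modelKet, add_zero, add_zero, modelKet, StarMemClass.coe_star, rA,
      star_diskA_intKet, TensorProduct.tmul_smul, ← TensorProduct.smul_tmul', ← sub_eq_add_neg]
  · refine .of_shift 0 0 0 (fun _ y => ((-1 : ℤˣ) : ℂ) * ((q : ℝ) ^ y : ℝ)) 1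
      (fun _ y _ hy => norm_beta_le _ hy) ?_
    intro x y N
    rw [actY_modelKet, add_zero, add_zero, add_zero, modelKet, rB, diskB_intKet,
      TensorProduct.tmul_smul, ← TensorProduct.smul_tmul']

theorem symbolRep_zero : symbolRep (0 : SymbolAlgebra q) = 0 := map_zero symbolRep

theorem symbolRep_add (σ τ : SymbolAlgebra q) :
    symbolRep (σ + τ) = symbolRep σ + symbolRep τ := map_add symbolRep σ τ

theorem symbolRep_neg (σ : SymbolAlgebra q) : symbolRep (-σ) = -symbolRep σ := map_neg symbolRep σ

theorem symbolRep_mul (σ τ : SymbolAlgebra q) :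
    symbolRep (σ * τ) = symbolRep σ * symbolRep τ := map_mul symbolRep σ τ

theorem symbolRep_algebraMap (c : ℂ) :
    symbolRep (algebraMap ℂ (SymbolAlgebra q) c) = algebraMap ℂ _ c := symbolRep.commutes c

theorem symbolRep_eq (a : disk q 1) (b : disk q (-1)) (p : ℂ[T;T⁻¹]) :
    symbolRep ((a ⊗ₜ[ℂ] b) ⊗ₜ[ℂ] p) =
      actX a * actY b * TensorProduct.map LinearMap.id (Algebra.lmul ℂ ℂ[T;T⁻¹] p) := by
  ext f g p'
  rfl

@[elab_as_elim]
theorem symbol_induction {P : SymbolAlgebra q → Prop} (h0 : P 0)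
    (hadd : ∀ σ τ, P σ → P τ → P (σ + τ))
    (htmul : ∀ (a : disk q 1) (b : disk q (-1)) (c : ℂ) (m : ℤ),
      P ((a ⊗ₜ[ℂ] b) ⊗ₜ[ℂ] (LaurentPolynomial.C c * LaurentPolynomial.T m))) (σ : SymbolAlgebra q) :
    P σ := by
  induction σ using TensorProduct.induction_on with
  | zero => exact h0
  | add σ τ h h' => exact hadd _ _ h h'
  | tmul w p =>
    induction w using TensorProduct.induction_on with
    | zero => rw [TensorProduct.zero_tmul]; exact h0
    | add σ τ h h' => rw [TensorProduct.add_tmul]; exact hadd _ _ h h'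
    | tmul a b =>
      induction p using LaurentPolynomial.induction_on' with
      | add p p' hp hp' => rw [TensorProduct.tmul_add]; exact hadd _ _ hp hp'
      | C_mul_T m c => exact htmul a b c m

theorem isTame_symbolRep (σ : SymbolAlgebra q) : IsTame q (symbolRep σ) := by
  induction σ using symbol_induction with
  | h0 =>
    rw [symbolRep_zero]
    simpa using isTame_algebraMap (q := q) 0
  | hadd σ τ h h' => rw [symbolRep_add]; exact h.add h'
  | htmul a b c m =>
    rw [symbolRep_eq]
    refine ((isTame_actX a).mul (isTame_actY b)).mul ?_
    refine .of_shift 0 0 m (fun _ _ => c) ‖c‖ (fun _ _ _ _ => le_rfl) ?_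
    intro x y N
    rw [modelKet, TensorProduct.map_tmul, LinearMap.id_apply, Algebra.coe_lmul_eq_mul,
      LinearMap.mul_apply', mul_assoc, ← LaurentPolynomial.T_add, ← LaurentPolynomial.smul_eq_C_mul, TensorProduct.tmul_smul,
      add_zero, add_zero, modelKet, add_comm m N]

end Tame

/-! ### Operators with a symbol -/

section HasSymbol

variable {q : Set.Ioo (0 : ℝ) 1}

/-- `T` acts on kets of spin `s` like its symbol `σ`, up to errors that decay exponentially in `2j`.
All integer labels are allowed. The vector of the model space is zero if `x` or `y` is negative; if `N`
is negative, the first term vanishes and the bound is weaker than uniform boundedness. -/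
def HasSpinSymbol (s : Fin 2) (T : SpinOp) (σ : SymbolAlgebra q) : Prop :=
  ∃ C : ℝ, 0 ≤ C ∧ ∀ x y N, ‖T (modelToSpin s (modelKet x y N)) -
    modelToSpin s (symbolRep σ (modelKet x y N))‖ ≤ C * rate q ^ N

variable {s : Fin 2} {T S : SpinOp} {σ τ : SymbolAlgebra q}

theorem HasSpinSymbol.add (hT : HasSpinSymbol s T σ) (hS : HasSpinSymbol s S τ) :
    HasSpinSymbol s (T + S) (σ + τ) := by
  obtain ⟨C, hC, h⟩ := hT
  obtain ⟨C', hC', h'⟩ := hS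
  refine ⟨C + C', by positivity, fun x y N => ?_⟩
  rw [symbolRep_add, LinearMap.add_apply, map_add, add_apply, add_sub_add_comm, add_mul]
  exact (norm_add_le _ _).trans (add_le_add (h x y N) (h' x y N))

/-- Symbols are multiplicative: the error of `S` is multiplied by the bounded operator `T`, and the
error of `T` is composed with the action of `τ`, which preserves exponential bounds. -/
theorem HasSpinSymbol.mul (hT : HasSpinSymbol s T σ) (hS : HasSpinSymbol s S τ) :
    HasSpinSymbol s (T * S) (σ * τ) := by
  obtain ⟨C, hC, h⟩ := hT
  obtain ⟨C', hC', h'⟩ := hS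
  obtain ⟨K, hK, hτ⟩ := isTame_symbolRep τ
  refine ⟨‖T‖ * C' + K * C, by positivity, fun x y N => ?_⟩
  have h2 := hτ (T.toLinearMap ∘ₗ modelToSpin s - modelToSpin s ∘ₗ symbolRep σ) C hC h x y N
  have : (T * S) (modelToSpin s (modelKet x y N)) -
      modelToSpin s (symbolRep (σ * τ) (modelKet x y N)) =
      T (S (modelToSpin s (modelKet x y N)) - modelToSpin s (symbolRep τ (modelKet x y N))) +
      (T.toLinearMap ∘ₗ modelToSpin s - modelToSpin s ∘ₗ symbolRep σ)
        (symbolRep τ (modelKet x y N)) := by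
    rw [symbolRep_mul, map_sub]
    simp only [mul_apply_eq_comp, Module.End.mul_apply, LinearMap.sub_apply, LinearMap.comp_apply,
      ContinuousLinearMap.coe_coe]
    abel
  rw [this, add_mul]
  refine (norm_add_le _ _).trans (add_le_add ?_ h2)
  rw [mul_assoc]
  exact (T.le_opNorm _).trans (mul_le_mul_of_nonneg_left (h' x y N) (norm_nonneg _))

theorem hasSpinSymbol_algebraMap (s : Fin 2) (c : ℂ) :
    HasSpinSymbol s (algebraMap ℂ SpinOp c) (algebraMap ℂ (SymbolAlgebra q) c) := by
  refine ⟨0, le_rfl, fun x y N => ?_⟩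
  rw [symbolRep_algebraMap]
  simp [Algebra.algebraMap_eq_smul_one]

theorem HasSpinSymbol.neg (hT : HasSpinSymbol s T σ) : HasSpinSymbol s (-T) (-σ) := by
  obtain ⟨C, hC, h⟩ := hT
  refine ⟨C, hC, fun x y N => ?_⟩
  rw [symbolRep_neg, LinearMap.neg_apply, map_neg, neg_apply, neg_sub_neg, norm_sub_rev]
  exact h x y N

/-- The matrix coefficients of elements of the disk algebra. -/
def diskCoeff {ε : ℤˣ} (x' : ℕ) (x : ℤ) : disk q ε →ₗ[ℂ] ℂ :=
  evalAt x' ∘ₗ LinearMap.applyₗ (intKet x) ∘ₗ diskEnd.toLinearMap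

theorem diskCoeff_apply {ε : ℤˣ} (x' : ℕ) (x : ℤ) (a : disk q ε) :
    diskCoeff x' x a = (a : ℓ²(ℕ, ℂ) →L[ℂ] ℓ²(ℕ, ℂ)) (intKet x) x' := rfl

/-- The matrix coefficients of symbols. -/
def symbolCoeff (x' y' : ℕ) (x y m : ℤ) (σ : SymbolAlgebra q) : ℂ :=
  tensorFun (tensorFun (diskCoeff x' x) (diskCoeff y' y)) (coeffAt m) σ

theorem symbolCoeff_tmul (x' y' : ℕ) (x y m : ℤ) (a : disk q 1) (b : disk q (-1)) (p : ℂ[T;T⁻¹]) :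
    symbolCoeff x' y' x y m ((a ⊗ₜ[ℂ] b) ⊗ₜ[ℂ] p) =
      diskCoeff x' x a * diskCoeff y' y b * p.coeff m := by
  unfold symbolCoeff
  exact (tensorFun_tmul _ _ _ _).trans (congrArg (· * _) (tensorFun_tmul _ _ _ _))

theorem symbolCoeff_add (x' y' : ℕ) (x y m : ℤ) (σ τ : SymbolAlgebra q) :
    symbolCoeff x' y' x y m (σ + τ) = symbolCoeff x' y' x y m σ + symbolCoeff x' y' x y m τ :=
  LinearMap.map_add (tensorFun (tensorFun (diskCoeff x' x) (diskCoeff y' y)) (coeffAt m)) σ τ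

theorem symbolCoeff_zero (x' y' : ℕ) (x y m : ℤ) :
    symbolCoeff x' y' x y m (0 : SymbolAlgebra q) = 0 :=
  LinearMap.map_zero (tensorFun (tensorFun (diskCoeff x' x) (diskCoeff y' y)) (coeffAt m))

theorem coordAt_symbolRep (x' y' : ℕ) (x y m N : ℤ) (σ : SymbolAlgebra q) :
    coordAt x' y' (N + m) (symbolRep σ (modelKet x y N)) = symbolCoeff x' y' x y m σ := by
  induction σ using symbol_induction with
  | h0 => rw [symbolRep_zero, LinearMap.zero_apply, LinearMap.map_zero, symbolCoeff_zero]
  | hadd σ τ h h' =>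
    rw [symbolRep_add, LinearMap.add_apply, LinearMap.map_add, h, h', symbolCoeff_add]
  | htmul a b c k =>
    rw [modelKet, symbolRep_tmul, coordAt, symbolCoeff_tmul, tensorFun_tmul, tensorFun_tmul,
      coeffAt_apply]
    congr 1
    rw [mul_assoc, ← LaurentPolynomial.T_add, ← LaurentPolynomial.single_eq_C_mul_T,
      ← LaurentPolynomial.single_eq_C_mul_T]
    by_cases h : k = m
    · simp [h, add_comm, -LaurentPolynomial.single_eq_C_mul_T]
    · have : ¬ k + N = N + m := by omega
      simp [h, this, -LaurentPolynomial.single_eq_C_mul_T]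

theorem eq_zero_of_symbolCoeff (σ : SymbolAlgebra q)
    (h : ∀ (x' y' x y : ℕ) (m : ℤ), symbolCoeff x' y' x y m σ = 0) : σ = 0 := by
  have hd : ∀ ε : ℤˣ, ∀ a : disk q ε, (∀ i : ℕ × ℕ, diskCoeff i.1 i.2 a = 0) → a = 0 := by
    intro ε a ha
    refine Subtype.ext (clm_ext_ket fun l => lp.ext (funext fun k => ?_))
    have := ha (k, l)
    rw [diskCoeff_apply, intKet_natCast] at this
    exact this
  refine eq_zero_of_tensorFun
    (fun i : (ℕ × ℕ) × (ℕ × ℕ) => tensorFun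
      (diskCoeff i.1.1 i.1.2) (diskCoeff i.2.1 i.2.2))
    coeffAt ?_ ?_ σ ?_
  · intro w hw
    exact eq_zero_of_tensorFun _ _ (hd 1) (hd (-1)) w fun i j => hw (i, j)
  · intro p hp
    exact LaurentPolynomial.ext hp
  · intro i m
    exact h i.1.1 i.2.1 i.1.2 i.2.2 m

/-- The diagonal and off-diagonal matrix entries of `T` within one spin approximate the matrix
coefficients of the symbol. -/
theorem HasSpinSymbol.entry_bound (hT : HasSpinSymbol s T σ) :
    ∃ C : ℝ, 0 ≤ C ∧ ∀ k l : SpinIndex, k.s = s → l.s = s →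
      ‖T (ket l) k - symbolCoeff k.x k.y l.x l.y (k.twoJ - l.twoJ) σ‖ ≤ C * rate q ^ l.twoJ := by
  obtain ⟨C, hC, h⟩ := hT
  refine ⟨C, hC, fun k l hk hl => ?_⟩
  have h1 := (lp.norm_apply_le_norm (by simp) _ k).trans (h l.x l.y l.twoJ)
  rw [modelToSpin_modelKet, lp.coeFn_sub, Pi.sub_apply, modelToSpin_apply, if_pos hk, ← hl,
    spinKet_index] at h1
  have h2 := coordAt_symbolRep k.x k.y l.x l.y (k.twoJ - l.twoJ) l.twoJ σ
  rw [add_sub_cancel] at h2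
  rw [← h2]
  exact_mod_cast h1

/-- An operator has at most one symbol on a given spin: for fixed labels `x`, `y`, `x'`, `y'` the matrix
coefficients of the symbol are limits of matrix entries of `T` as `2j → ∞`. -/
theorem HasSpinSymbol.unique (hT : HasSpinSymbol s T σ) (hT' : HasSpinSymbol s T τ) : σ = τ := by
  have h0 := hT.add hT'.neg
  rw [add_neg_cancel, ← sub_eq_add_neg] at h0
  rw [← sub_eq_zero]
  obtain ⟨C, hC, h⟩ := h0.entry_bound
  refine eq_zero_of_symbolCoeff _ fun x' y' x y m => ?_
  have hlim : Tendsto (fun n : ℕ => C * rate q ^ n) atTop (𝓝 0) := by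
    simpa using (tendsto_pow_atTop_nhds_zero_of_lt_one (rate_pos q).le (rate_lt_one q)).const_mul C
  have : Tendsto (fun _ : ℕ => ‖symbolCoeff x' y' x y m (σ - τ)‖) atTop (𝓝 0) := by
    refine squeeze_zero' (Eventually.of_forall fun _ => norm_nonneg _) ?_ hlim
    filter_upwards [eventually_ge_atTop (x + y + x' + y' + m.natAbs + 2)] with n hn
    obtain ⟨l, hl, hlx, hly, hlN⟩ := (exists_index_iff s x y n).mpr
      ⟨by omega, by omega, by omega, by split_ifs <;> omega⟩
    obtain ⟨k, hk, hkx, hky, hkN⟩ := (exists_index_iff s x' y' (n + m)).mpr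
      ⟨by omega, by omega, by omega, by split_ifs <;> omega⟩
    have := h k l hk hl
    rw [zero_apply, lp.coeFn_zero, Pi.zero_apply, zero_sub, norm_neg, hlx, hly, hkN, hlN,
      add_sub_cancel_left, show k.x = x' by omega, show k.y = y' by omega,
      show l.twoJ = n by omega] at this
    exact this
  exact norm_eq_zero.mp (tendsto_nhds_unique tendsto_const_nhds this)

end HasSymbol

/-! ### Symbols of weighted shifts -/

section ShiftSymbols

variable {q : Set.Ioo (0 : ℝ) 1}

/-- The integer labels that occur for kets of spin `s`. -/
def InRange (s : Fin 2) (x y N : ℤ) : Prop := 0 ≤ x ∧ x ≤ N ∧ 0 ≤ y ∧ y < if s = 0 then N + 2 else N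

theorem inRange_index (k : SpinIndex) : InRange k.s k.x k.y k.twoJ :=
  (exists_index_iff _ _ _ _).mp ⟨k, rfl, rfl, rfl, rfl⟩

theorem InRange.exists_index {s : Fin 2} {x y N : ℤ} (h : InRange s x y N) :
    ∃ k : SpinIndex, k.s = s ∧ (k.x : ℤ) = x ∧ (k.y : ℤ) = y ∧ (k.twoJ : ℤ) = N :=
  (exists_index_iff _ _ _ _).mpr h

theorem spinKet_of_not_inRange {s : Fin 2} {x y N : ℤ} (h : ¬InRange s x y N) :
    spinKet s x y N = 0 :=
  spinKet_of_not_exists fun h' => h ((exists_index_iff _ _ _ _).mp h')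

theorem HasMatrix.shift_spinKet {T : SpinOp} {s t : Fin 2} {dx dy dN : ℤ} {c : ℤ → ℤ → ℤ → ℝ}
    (hT : HasMatrix T (shiftMatrix s t dx dy dN c)) {x y N : ℤ} (h : InRange s x y N) :
    T (spinKet s x y N) = (c x y N : ℂ) • spinKet t (x + dx) (y + dy) (N + dN) := by
  obtain ⟨l, rfl, rfl, rfl, rfl⟩ := h.exists_index
  rw [spinKet_index]
  refine lp.ext (funext fun k => ?_)
  rw [hT k l, lp.coeFn_smul, Pi.smul_apply, spinKet_apply, shiftMatrix, smul_eq_mul, mul_ite,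
    mul_one, mul_zero]
  simp

theorem HasMatrix.shift_spinKet_of_ne {T : SpinOp} {s t s' : Fin 2} {dx dy dN : ℤ}
    {c : ℤ → ℤ → ℤ → ℝ} (hT : HasMatrix T (shiftMatrix s t dx dy dN c)) (hs : s' ≠ s) (x y N : ℤ) :
    T (spinKet s' x y N) = 0 := by
  by_cases h : InRange s' x y N
  · obtain ⟨l, rfl, rfl, rfl, rfl⟩ := h.exists_index
    rw [spinKet_index]
    refine lp.ext (funext fun k => ?_)
    rw [hT k l, shiftMatrix, if_neg fun h => hs h.1]
    rfl
  · rw [spinKet_of_not_inRange h, map_zero]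

theorem hasSpinSymbol_zero_of_ne {T : SpinOp} {s t s' : Fin 2} {dx dy dN : ℤ}
    {c : ℤ → ℤ → ℤ → ℝ} (hT : HasMatrix T (shiftMatrix s t dx dy dN c)) (hs : s' ≠ s) :
    HasSpinSymbol s' T (0 : SymbolAlgebra q) := by
  refine ⟨0, le_rfl, fun x y N => ?_⟩
  rw [modelToSpin_modelKet, hT.shift_spinKet_of_ne hs, symbolRep_zero, LinearMap.zero_apply,
    map_zero]
  simp

/-- Shifts with exponentially small weights have symbol zero. -/
theorem hasSpinSymbol_zero_of_bound {T : SpinOp} {s t : Fin 2} {dx dy dN : ℤ}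
    {c : ℤ → ℤ → ℤ → ℝ} (hT : HasMatrix T (shiftMatrix s t dx dy dN c)) {C : ℝ} (hC : 0 ≤ C)
    (hc : ∀ x y N, InRange s x y N → InRange t (x + dx) (y + dy) (N + dN) →
      |c x y N| ≤ C * rate q ^ N) (s' : Fin 2) :
    HasSpinSymbol s' T (0 : SymbolAlgebra q) := by
  by_cases hs : s' = s
  · subst hs
    refine ⟨C, hC, fun x y N => ?_⟩
    have hr := zpow_nonneg (rate_pos q).le N
    rw [modelToSpin_modelKet, symbolRep_zero, LinearMap.zero_apply, map_zero, sub_zero]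
    by_cases h : InRange s' x y N
    · rw [hT.shift_spinKet h]
      by_cases h' : InRange t (x + dx) (y + dy) (N + dN)
      · rw [norm_smul, Complex.norm_real, Real.norm_eq_abs]
        exact (mul_le_of_le_one_right (abs_nonneg _) (norm_spinKet_le _ _ _ _)).trans (hc _ _ _ h h')
      · rw [spinKet_of_not_inRange h', smul_zero, norm_zero]; positivity
    · rw [spinKet_of_not_inRange h, map_zero, norm_zero]; positivity
  · exact hasSpinSymbol_zero_of_ne hT hs

theorem hasSpinSymbol_zero_star_of_bound {T : SpinOp} {s t : Fin 2} {dx dy dN : ℤ}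
    {c : ℤ → ℤ → ℤ → ℝ} (hT : HasMatrix T (shiftMatrix s t dx dy dN c)) {C : ℝ} (hC : 0 ≤ C)
    (hc : ∀ x y N, InRange s x y N → InRange t (x + dx) (y + dy) (N + dN) →
      |c x y N| ≤ C * rate q ^ N) (s' : Fin 2) :
    HasSpinSymbol s' (star T) (0 : SymbolAlgebra q) := by
  have hr := rate_pos q
  refine hasSpinSymbol_zero_of_bound hT.star_shift (C := C * rate q ^ (-dN)) (by positivity)
    (fun x y N h1 h2 => ?_) s'
  rw [← sub_eq_add_neg, ← sub_eq_add_neg, ← sub_eq_add_neg] at h2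
  refine (hc _ _ _ h2 (by simpa using h1)).trans (le_of_eq ?_)
  rw [sub_eq_add_neg, zpow_add₀ hr.ne']; ring

/-- Comparison of a weighted shift with its symbol. The weights have to agree up to exponentially
small errors; where only one end of the shift is in range, the weight of the symbol has to be
exponentially small itself. -/
theorem hasSpinSymbol_shift {T : SpinOp} {s : Fin 2} {dx dy dN : ℤ}
    {c : ℤ → ℤ → ℤ → ℝ} (hT : HasMatrix T (shiftMatrix s s dx dy dN c)) {σ : SymbolAlgebra q}
    {d : ℤ → ℤ → ℝ} (hσ : ∀ x y N, symbolRep σ (modelKet x y N) =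
      (d x y : ℂ) • modelKet (x + dx) (y + dy) (N + dN)) {C : ℝ} (hC : 0 ≤ C)
    (h1 : ∀ x y N, InRange s x y N → InRange s (x + dx) (y + dy) (N + dN) →
      |c x y N - d x y| ≤ C * rate q ^ N)
    (h2 : ∀ x y N, ¬InRange s x y N → InRange s (x + dx) (y + dy) (N + dN) →
      |d x y| ≤ C * rate q ^ N) : HasSpinSymbol s T σ := by
  refine ⟨C, hC, fun x y N => ?_⟩
  have hr := zpow_nonneg (rate_pos q).le N
  rw [hσ, map_smul, modelToSpin_modelKet, modelToSpin_modelKet]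
  by_cases h' : InRange s (x + dx) (y + dy) (N + dN)
  · by_cases h : InRange s x y N
    · rw [hT.shift_spinKet h, ← sub_smul, norm_smul, ← Complex.ofReal_sub, Complex.norm_real,
        Real.norm_eq_abs]
      exact (mul_le_of_le_one_right (abs_nonneg _) (norm_spinKet_le _ _ _ _)).trans (h1 _ _ _ h h')
    · rw [spinKet_of_not_inRange h, map_zero, zero_sub, norm_neg, norm_smul, Complex.norm_real,
        Real.norm_eq_abs]
      exact (mul_le_of_le_one_right (abs_nonneg _) (norm_spinKet_le _ _ _ _)).trans (h2 _ _ _ h h')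
  · rw [spinKet_of_not_inRange h', smul_zero, sub_zero]
    by_cases h : InRange s x y N
    · rw [hT.shift_spinKet h, spinKet_of_not_inRange h', smul_zero, norm_zero]; positivity
    · rw [spinKet_of_not_inRange h, map_zero, norm_zero]; positivity

theorem hasSpinSymbol_star_shift {T : SpinOp} {s : Fin 2} {dx dy dN : ℤ}
    {c : ℤ → ℤ → ℤ → ℝ} (hT : HasMatrix T (shiftMatrix s s dx dy dN c)) {σ : SymbolAlgebra q}
    {d : ℤ → ℤ → ℝ} (hσ : ∀ x y N, symbolRep σ (modelKet x y N) =
      (d (x - dx) (y - dy) : ℂ) • modelKet (x - dx) (y - dy) (N - dN)) {C : ℝ} (hC : 0 ≤ C)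
    (h1 : ∀ x y N, InRange s x y N → InRange s (x + dx) (y + dy) (N + dN) →
      |c x y N - d x y| ≤ C * rate q ^ N)
    (h2 : ∀ x y N, InRange s x y N → ¬InRange s (x + dx) (y + dy) (N + dN) →
      |d x y| ≤ C * rate q ^ N) : HasSpinSymbol s (star T) σ := by
  have hr := rate_pos q
  have e : ∀ N : ℤ, C * rate q ^ (-dN) * rate q ^ N = C * rate q ^ (N - dN) := fun N => by
    rw [sub_eq_add_neg, zpow_add₀ hr.ne']; ring
  refine hasSpinSymbol_shift hT.star_shift (d := fun x y => d (x - dx) (y - dy))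
    (C := C * rate q ^ (-dN)) (fun x y N => ?_) (by positivity) (fun x y N hs ht => ?_)
    (fun x y N hs ht => ?_)
  · rw [hσ, ← sub_eq_add_neg, ← sub_eq_add_neg, ← sub_eq_add_neg]
  all_goals
    rw [← sub_eq_add_neg, ← sub_eq_add_neg, ← sub_eq_add_neg] at ht
    rw [e]
  · exact h1 _ _ _ ht (by simpa using hs)
  · exact h2 _ _ _ ht (by simpa using hs)

theorem hasSpinSymbol_spinProj_self (s : Fin 2) :
    HasSpinSymbol s (spinProj s) (1 : SymbolAlgebra q) := by
  refine ⟨0, le_rfl, fun x y N => ?_⟩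
  have h : symbolRep (1 : SymbolAlgebra q) = 1 := map_one symbolRep
  rw [h, Module.End.one_apply, modelToSpin_modelKet]
  by_cases h : InRange s x y N
  · obtain ⟨l, rfl, rfl, rfl, rfl⟩ := h.exists_index
    rw [spinKet_index, spinProj_ket, if_pos rfl]; simp
  · rw [spinKet_of_not_inRange h]; simp

end ShiftSymbols

/-! ### Eigenvectors of `δ` and their symbols -/

section DiracCommutator

variable {q : Set.Ioo (0 : ℝ) 1}

/-- The eigenvalue of the Dirac operator as a function of the spin and of `2j`. -/
def diracValue (s : Fin 2) (N : ℤ) : ℝ := if s = 0 then N + 3 / 2 else -(N + 1 / 2)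

theorem diracEigenvalue_eq (k : SpinIndex) : diracEigenvalue k = diracValue k.s k.twoJ := by
  unfold diracEigenvalue diracValue SpinIndex.j
  push_cast
  split_ifs <;> ring

theorem q_zpow_le_rate {N : ℤ} (hN : 0 ≤ N) : (q : ℝ) ^ N ≤ rate q ^ N := by
  lift N to ℕ using hN
  rw [zpow_natCast, zpow_natCast]
  exact pow_le_pow_left₀ q.2.1.le (q_le_rate q) N

theorem exists_mul_q_zpow_le (q : Set.Ioo (0 : ℝ) 1) (m : ℝ) : ∃ C : ℝ, 0 ≤ C ∧
    ∀ N : ℤ, 0 ≤ N → (2 * N + m) * (q : ℝ) ^ N ≤ C * rate q ^ N := by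
  have h := (tendsto_self_mul_const_pow_of_lt_one (rate_pos q).le (rate_lt_one q)).bddAbove_range
  obtain ⟨K, hK⟩ := h
  have hK0 : 0 ≤ K := by simpa using hK ⟨0, rfl⟩
  refine ⟨2 * K + |m|, by positivity, fun N hN => ?_⟩
  lift N to ℕ using hN
  have h1 : (N : ℝ) * rate q ^ N ≤ K := hK ⟨N, rfl⟩
  have hr : 0 ≤ rate q ^ N := pow_nonneg (rate_pos q).le N
  have hr1 : rate q ^ N ≤ 1 := pow_le_one₀ (rate_pos q).le (rate_lt_one q).le
  have e : (q : ℝ) ^ N = rate q ^ N * rate q ^ N := by rw [← rate_sq q]; ring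
  simp only [zpow_natCast, Int.cast_natCast, e]
  have : m * rate q ^ N ≤ |m| := by
    calc m * rate q ^ N ≤ |m| * rate q ^ N := by gcongr; exact le_abs_self m
      _ ≤ |m| * 1 := by gcongr
      _ = |m| := mul_one _
  nlinarith

/-- The commutator of the Dirac operator with an off-diagonal shift whose weights decay like `q ^ (2j)`
is a shift of the same kind, with weights of order `2j q ^ (2j)`. -/
theorem exists_dirac_commutator {T : SpinOp} {s t : Fin 2} {dx dy dN : ℤ}
    {c : ℤ → ℤ → ℤ → ℝ} (hT : HasMatrix T (shiftMatrix s t dx dy dN c)) {C : ℝ} (hC : 0 ≤ C)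
    (hc : ∀ x y N, InRange s x y N → |c x y N| ≤ C * (q : ℝ) ^ N) :
    ∃ S, IsCommutator (diagOp diracEigenvalue) T S ∧
      HasMatrix S (shiftMatrix s t dx dy dN fun x y N =>
        (diracValue t (N + dN) - diracValue s N) * c x y N) ∧
      ∃ C' : ℝ, 0 ≤ C' ∧ ∀ x y N, InRange s x y N →
        |(diracValue t (N + dN) - diracValue s N) * c x y N| ≤ C' * rate q ^ N := by
  obtain ⟨K, hK, hKb⟩ := exists_mul_q_zpow_le q (|(dN : ℝ)| + 3)
  have hb : ∀ x y N, InRange s x y N →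
      |(diracValue t (N + dN) - diracValue s N) * c x y N| ≤ (K * C) * rate q ^ N := by
    intro x y N h
    have hN : 0 ≤ N := h.1.trans h.2.1
    have hN' : (0 : ℝ) ≤ N := by exact_mod_cast hN
    have h1 : |diracValue t (N + dN) - diracValue s N| ≤ 2 * N + (|(dN : ℝ)| + 3) := by
      have := abs_le.mp (le_refl |(dN : ℝ)|)
      rw [abs_le]
      unfold diracValue
      push_cast
      constructor <;> split_ifs <;> linarith
    rw [abs_mul]
    calc |diracValue t (N + dN) - diracValue s N| * |c x y N|
        ≤ (2 * N + (|(dN : ℝ)| + 3)) * (C * (q : ℝ) ^ N) := by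
          gcongr
          exact hc x y N h
      _ = C * ((2 * N + (|(dN : ℝ)| + 3)) * (q : ℝ) ^ N) := by ring
      _ ≤ C * (K * rate q ^ N) := by exact mul_le_mul_of_nonneg_left (hKb N hN) hC
      _ = _ := by ring
  obtain ⟨S, hS⟩ := exists_hasMatrix_shift s t dx dy dN (fun x y N =>
        (diracValue t (N + dN) - diracValue s N) * c x y N) (K * C) (fun l hl => by
    have hr := (rate_pos q).le
    have := inRange_index l
    rw [hl] at this
    refine (hb _ _ _ this).trans (mul_le_of_le_one_right (by positivity) ?_)
    rw [zpow_natCast]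
    exact pow_le_one₀ hr (rate_lt_one q).le)
  refine ⟨S, hT.isCommutator (hS.congr fun k l => ?_), hS, K * C, by positivity, hb⟩
  unfold shiftMatrix
  split_ifs with h
  · obtain ⟨h1, h2, h3, h4, h5⟩ := h
    rw [diracEigenvalue_eq, diracEigenvalue_eq, h1, h2, h5]
    push_cast
    rfl
  · simp

/-- The weights of `P_t X P_s` for the operator `X` with blocks `F`. -/
def blockWeight (F : ℝ → ℝ → ℝ → Matrix (Fin 2) (Fin 2) ℝ) (s t : Fin 2) (x y N : ℤ) : ℝ :=
  F (N / 2) (x - N / 2) (y - N / 2 - spinOffset s) t s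

theorem HasMatrix.corner_eq_zero {T : SpinOp} {dj dn : ℝ}
    {F : ℝ → ℝ → ℝ → Matrix (Fin 2) (Fin 2) ℝ} (hT : HasMatrix T (spinMatrix dj dn F)) (s t : Fin 2)
    (hF : ∀ j μ n, F j μ n t s = 0) : SUq2.corner t T s = 0 := by
  refine (hT.corner t s).unique fun k l => ?_
  simp only [spinMatrix]
  split_ifs with h1
  · obtain ⟨h1, h2⟩ := h1
    rw [h1, h2, hF]; simp
  all_goals rfl

/-- The splitting of `π(a)` and `π(b)` into weight vectors. The integer `e` is the shift of the label
`y` by the raising part within one spin. -/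
theorem exists_spinSplit {Xp Xm : SpinOp} {dn : ℝ} (e : ℤ) (he : (e : ℝ) = dn + 1 / 2)
    {Fp Fm : ℝ → ℝ → ℝ → Matrix (Fin 2) (Fin 2) ℝ}
    (hp : HasMatrix Xp (spinMatrix (1 / 2) dn Fp)) (hm : HasMatrix Xm (spinMatrix (-1 / 2) dn Fm))
    (hp0 : ∀ j μ n, Fp j μ n 0 1 = 0) (hm0 : ∀ j μ n, Fm j μ n 1 0 = 0) {C : ℝ} (hC : 0 ≤ C)
    (hpb : ∀ x y N, InRange 0 x y N → |blockWeight Fp 0 1 x y N| ≤ C * (q : ℝ) ^ N)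
    (hmb : ∀ x y N, InRange 1 x y N → |blockWeight Fm 1 0 x y N| ≤ C * (q : ℝ) ^ N) :
    ∃ d, SpinSplit (Xp + Xm) (corner 0 Xp 0) (corner 1 Xp 1) (corner 0 Xm 0) (corner 1 Xm 1)
        (offDiag Xp Xm) d ∧
      ∀ s, HasSpinSymbol s (offDiag Xp Xm) (0 : SymbolAlgebra q) ∧
        HasSpinSymbol s (star (offDiag Xp Xm)) (0 : SymbolAlgebra q) ∧
        HasSpinSymbol s d (0 : SymbolAlgebra q) ∧
        HasSpinSymbol s (star d) (0 : SymbolAlgebra q) := by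
  have mp : ∀ s : Fin 2, HasMatrix (corner s Xp s)
      (shiftMatrix s s 1 e 1 (blockWeight Fp s s)) := fun s =>
    hp.shift s s 1 e 1 (by norm_num) (by norm_num) (by rw [he]; ring)
  have mm : ∀ s : Fin 2, HasMatrix (corner s Xm s)
      (shiftMatrix s s 0 (e - 1) (-1) (blockWeight Fm s s)) := fun s =>
    hm.shift s s 0 (e - 1) (-1) (by norm_num) (by norm_num) (by push_cast; rw [he]; ring)
  have op : HasMatrix (corner 1 Xp 0) (shiftMatrix 0 1 1 (e - 1) 1 (blockWeight Fp 0 1)) :=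
    hp.shift 0 1 1 (e - 1) 1 (by norm_num) (by norm_num)
      (by push_cast; rw [he]; simp [spinOffset]; ring)
  have om : HasMatrix (corner 0 Xm 1) (shiftMatrix 1 0 0 e (-1) (blockWeight Fm 1 0)) :=
    hm.shift 1 0 0 e (-1) (by norm_num) (by norm_num)
      (by rw [he]; simp [spinOffset]; ring)
  have zp : corner 0 Xp 1 = 0 := hp.corner_eq_zero 1 0 hp0
  have zm : corner 1 Xm 0 = 0 := hm.corner_eq_zero 0 1 hm0
  obtain ⟨dp, hdp, mdp, Cp, hCp, hCp'⟩ := exists_dirac_commutator op hC hpb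
  obtain ⟨dm, hdm, mdm, Cm, hCm, hCm'⟩ := exists_dirac_commutator om hC hmb
  have hpb' : ∀ x y N, InRange 0 x y N → InRange 1 (x + 1) (y + (e - 1)) (N + 1) →
      |blockWeight Fp 0 1 x y N| ≤ C * rate q ^ N := fun x y N h _ =>
    (hpb x y N h).trans (mul_le_mul_of_nonneg_left (q_zpow_le_rate (h.1.trans h.2.1)) hC)
  have hmb' : ∀ x y N, InRange 1 x y N → InRange 0 (x + 0) (y + e) (N + -1) →
      |blockWeight Fm 1 0 x y N| ≤ C * rate q ^ N := fun x y N h _ =>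
    (hmb x y N h).trans (mul_le_mul_of_nonneg_left (q_zpow_le_rate (h.1.trans h.2.1)) hC)
  have w0 : spinOffset 0 = 1 / 2 := rfl
  have w1 : spinOffset 1 = -1 / 2 := rfl
  have e0 : offDiag Xp Xm = corner 1 Xp 0 + corner 0 Xm 1 := rfl
  refine ⟨dp + dm, ⟨?_, ?_, ?_, ?_, ?_, ?_, ?_, ?_, ?_, ?_, ?_, ?_⟩, fun s => ⟨?_, ?_, ?_, ?_⟩⟩
  · conv_lhs => rw [corner_decomp Xp, corner_decomp Xm, zp, zm]
    rw [e0]; abel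
  · simpa using (mp 0).abs_commutator_shift 1 (by simp)
  · simpa using (mp 1).abs_commutator_shift 1 (by simp)
  · simpa using (mm 0).abs_commutator_shift (-1) (by simp)
  · simpa using (mm 1).abs_commutator_shift (-1) (by simp)
  · rw [e0]
    simpa using (op.abs_commutator_shift 0 (by rw [w0, w1]; norm_num)).add
      (om.abs_commutator_shift 0 (by rw [w0, w1]; norm_num))
  · simpa using (mdp.abs_commutator_shift 0 (by rw [w0, w1]; norm_num)).add
      (mdm.abs_commutator_shift 0 (by rw [w0, w1]; norm_num))
  · simpa using (mp 0).commutator_shift 1 (by simp)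
  · simpa using (mp 1).commutator_shift (-1) (by simp)
  · simpa using (mm 0).commutator_shift (-1) (by simp)
  · simpa using (mm 1).commutator_shift 1 (by simp)
  · exact hdp.add hdm
  · rw [← add_zero (0 : SymbolAlgebra q)]
    exact (hasSpinSymbol_zero_of_bound op hC hpb' s).add (hasSpinSymbol_zero_of_bound om hC hmb' s)
  · rw [← add_zero (0 : SymbolAlgebra q), e0, star_add]
    exact (hasSpinSymbol_zero_star_of_bound op hC hpb' s).add
      (hasSpinSymbol_zero_star_of_bound om hC hmb' s)
  · rw [← add_zero (0 : SymbolAlgebra q)]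
    exact (hasSpinSymbol_zero_of_bound mdp hCp (fun x y N h _ => hCp' x y N h) s).add
      (hasSpinSymbol_zero_of_bound mdm hCm (fun x y N h _ => hCm' x y N h) s)
  · rw [← add_zero (0 : SymbolAlgebra q), star_add]
    exact (hasSpinSymbol_zero_star_of_bound mdp hCp (fun x y N h _ => hCp' x y N h) s).add
      (hasSpinSymbol_zero_star_of_bound mdm hCm (fun x y N h _ => hCm' x y N h) s)

end DiracCommutator

/-! ### Asymptotics of `q`-integers -/

section Weights

/-- The factor `√(1 - q^(2u))` that distinguishes `√[u]` from a power of `q`. -/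
def qFactor (q u : ℝ) : ℝ := √(1 - q ^ (2 * u))

theorem qFactor_nonneg (q u : ℝ) : 0 ≤ qFactor q u := Real.sqrt_nonneg _

theorem qFactor_le_one {q : ℝ} (h0 : 0 < q) (u : ℝ) : qFactor q u ≤ 1 := by
  apply Real.sqrt_le_one.mpr
  have := Real.rpow_pos_of_pos h0 (2 * u)
  linarith

theorem one_sub_qFactor_le {q : ℝ} (h0 : 0 < q) (h1 : q < 1) {u : ℝ} (hu : 0 ≤ u) :
    1 - qFactor q u ≤ q ^ (2 * u) := by
  have h := abs_sqrt_sub_one (Real.rpow_pos_of_pos h0 (2 * u)).le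
    (Real.rpow_le_one h0.le h1.le (by linarith))
  have := (abs_le.mp h).1
  unfold qFactor
  linarith

theorem qInt_eq {q : ℝ} (h0 : 0 < q) (N : ℝ) :
    qInt q N = q ^ (-N) * (1 - q ^ (2 * N)) / (q⁻¹ - q) := by
  rw [qInt, mul_sub, mul_one, ← Real.rpow_add h0]
  ring_nf

theorem sqrt_qInt {q : ℝ} (h0 : 0 < q) (h1 : q < 1) (N : ℝ) :
    √(qInt q N) = q ^ (-N / 2) * qFactor q N / √(q⁻¹ - q) := by
  have hd : 0 < q⁻¹ - q := by
    have := (one_lt_inv₀ h0).mpr h1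
    linarith
  have h2 : q ^ (-N / 2) = √(q ^ (-N)) := by
    rw [Real.sqrt_eq_rpow, ← Real.rpow_mul h0.le]; ring_nf
  rw [qInt_eq h0, Real.sqrt_div' _ hd.le, Real.sqrt_mul (Real.rpow_nonneg h0.le _), h2, qFactor]

/-- A diagonal entry of the blocks, with `q`-integers replaced by powers of `q` times factors close
to `1`. The powers of `q^{-1} - q` cancel. -/
theorem qInt_entry {q : ℝ} (h0 : 0 < q) (h1 : q < 1) {e e' A B M E a b m : ℝ} (hm : 1 ≤ m)
    (hE : e + e' - A / 2 - B / 2 + M = E) (hA : A = a) (hB : B = b) (hM : M = m) :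
    q ^ e * √(qInt q A) * (q ^ e' * (√(qInt q B) / qInt q M)) =
      q ^ E * qFactor q a * qFactor q b / (1 - q ^ (2 * m)) := by
  subst hA hB hM
  have hd : 0 < q⁻¹ - q := by
    have := (one_lt_inv₀ h0).mpr h1
    linarith
  have ht : 1 - q ^ (2 * M) ≠ 0 := by
    have := Real.rpow_lt_one h0.le h1 (show 0 < 2 * M by linarith)
    linarith
  have hs : √(q⁻¹ - q) ≠ 0 := (Real.sqrt_pos.mpr hd).ne'
  have hs2 : q⁻¹ - q = √(q⁻¹ - q) * √(q⁻¹ - q) := (Real.mul_self_sqrt hd.le).symm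
  have hM' := (Real.rpow_pos_of_pos h0 M).ne'
  have e1 : q ^ E = q ^ e * q ^ e' * q ^ (-A / 2) * q ^ (-B / 2) * q ^ M := by
    rw [← hE, ← Real.rpow_add h0, ← Real.rpow_add h0, ← Real.rpow_add h0, ← Real.rpow_add h0]
    ring_nf
  rw [sqrt_qInt h0 h1, sqrt_qInt h0 h1, qInt_eq h0 M, e1, Real.rpow_neg h0.le]
  generalize √(q⁻¹ - q) = d at *
  rw [hs2]
  field_simp

theorem qInt_entry_zero {q : ℝ} (h0 : 0 < q) (h1 : q < 1) {e A B M E a b m : ℝ} (hm : 1 ≤ m)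
    (hE : e - A / 2 - B / 2 + M = E) (hA : A = a) (hB : B = b) (hM : M = m) :
    q ^ e * √(qInt q A) * (√(qInt q B) / qInt q M) =
      q ^ E * qFactor q a * qFactor q b / (1 - q ^ (2 * m)) := by
  have := qInt_entry h0 h1 (e := e) (e' := 0) (E := E) hm (by rw [add_zero]; exact hE) hA hB hM
  rwa [Real.rpow_zero, one_mul] at this

/-- Replacing `a`, `b` and `1 - t` by `1` in the weight `P a b / (1 - t)` costs at most a multiple of the
largest of `P (1 - a)`, `P (1 - b)` and `P t`. -/
theorem abs_weight_sub_le {q P a b t R : ℝ} (h0 : 0 < q) (h1 : q < 1) (hP : 0 ≤ P) (ha : 0 ≤ a)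
    (ha' : a ≤ 1) (hb' : b ≤ 1) (ht : 0 ≤ t) (ht' : t ≤ q ^ 2)
    (h1a : P * (1 - a) ≤ R) (h1b : P * (1 - b) ≤ R) (hPt : P * t ≤ R) :
    |P * a * b / (1 - t) - P| ≤ 3 / (1 - q ^ 2) * R := by
  have hq : 0 < 1 - q ^ 2 := by nlinarith
  have hR : 0 ≤ R := (mul_nonneg hP ht).trans hPt
  have ht1 : 0 < 1 - t := by linarith
  have e : P * a * b / (1 - t) - P = (P * (a * b - 1) + P * t) / (1 - t) := by
    field_simp; ring
  have h2 : |P * (a * b - 1) + P * t| ≤ 3 * R := by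
    have : P * (1 - a * b) ≤ P * (1 - a) + P * (1 - b) := by
      rw [← mul_add]
      refine mul_le_mul_of_nonneg_left ?_ hP
      nlinarith
    have h3 : 0 ≤ P * t := mul_nonneg hP ht
    have h4 : 0 ≤ P * (1 - a * b) := mul_nonneg hP (by nlinarith)
    rw [abs_le]
    constructor <;> linarith
  rw [e, abs_div, abs_of_pos ht1, div_mul_eq_mul_div]
  gcongr

end Weights

/-! ### The weights of the generators -/

section Blocks

variable {q : Set.Ioo (0 : ℝ) 1}

theorem alpha_eq (x : ℤ) : alpha q x = qFactor q (x + 1) := by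
  unfold alpha qFactor
  rw [← Real.rpow_intCast]
  push_cast
  ring_nf

theorem aPlus_weight_up {x y N : ℤ} (h : InRange 0 x y N) : blockWeight (aPlusBlock q) 0 0 x y N =
    (q : ℝ) ^ (0 : ℝ) * qFactor q (x + 1) * qFactor q (y + 1) /
      (1 - (q : ℝ) ^ (2 * ((N : ℝ) + 2))) := by
  have hN : (0 : ℝ) ≤ N := by exact_mod_cast h.1.trans h.2.1
  simp only [blockWeight, aPlusBlock, spinOffset, Matrix.smul_apply, smul_eq_mul, Matrix.of_apply,
    Matrix.cons_val', Matrix.cons_val_zero, Matrix.cons_val_fin_one, if_true]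
  exact qInt_entry q.2.1 q.2.2 (by linarith) (by ring) (by ring) (by ring) (by ring)

theorem aPlus_weight_down {x y N : ℤ} (h : InRange 1 x y N) :
    blockWeight (aPlusBlock q) 1 1 x y N =
      (q : ℝ) ^ (0 : ℝ) * qFactor q (x + 1) * qFactor q (y + 1) /
        (1 - (q : ℝ) ^ (2 * ((N : ℝ) + 1))) := by
  have hN : (0 : ℝ) ≤ N := by exact_mod_cast h.1.trans h.2.1
  simp only [blockWeight, aPlusBlock, spinOffset, Matrix.smul_apply, smul_eq_mul, Matrix.of_apply,
    Matrix.cons_val', Matrix.cons_val_one, Matrix.cons_val_fin_one,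
    one_ne_zero, if_false]
  exact qInt_entry q.2.1 q.2.2 (by linarith) (by ring) (by ring) (by ring) (by ring)

theorem aMinus_weight_up {x y N : ℤ} (h : InRange 0 x y N) : blockWeight (aMinusBlock q) 0 0 x y N =
    (q : ℝ) ^ ((x : ℝ) + y + 1) * qFactor q (N - x) * qFactor q (N + 1 - y) /
      (1 - (q : ℝ) ^ (2 * ((N : ℝ) + 1))) := by
  have hN : (0 : ℝ) ≤ N := by exact_mod_cast h.1.trans h.2.1
  simp only [blockWeight, aMinusBlock, spinOffset, Matrix.smul_apply, smul_eq_mul, Matrix.of_apply,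
    Matrix.cons_val', Matrix.cons_val_zero, Matrix.cons_val_fin_one, if_true]
  exact qInt_entry q.2.1 q.2.2 (by linarith) (by ring) (by ring) (by ring) (by ring)

theorem InRange.one_le {x y N : ℤ} (h : InRange 1 x y N) : 1 ≤ N := by
  have h3 := h.2.2.1
  have h4 : y < N := h.2.2.2
  omega

theorem aMinus_weight_down {x y N : ℤ} (h : InRange 1 x y N) :
    blockWeight (aMinusBlock q) 1 1 x y N =
      (q : ℝ) ^ ((x : ℝ) + y + 1) * qFactor q (N - x) * qFactor q (N - 1 - y) /
        (1 - (q : ℝ) ^ (2 * (N : ℝ))) := by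
  have hN : (1 : ℝ) ≤ N := by exact_mod_cast h.one_le
  simp only [blockWeight, aMinusBlock, spinOffset, Matrix.smul_apply, smul_eq_mul, Matrix.of_apply,
    Matrix.cons_val', Matrix.cons_val_one, Matrix.cons_val_fin_one,
    one_ne_zero, if_false]
  exact qInt_entry q.2.1 q.2.2 hN (by ring) (by ring) (by ring) (by ring)

theorem bPlus_weight_up {x y N : ℤ} (h : InRange 0 x y N) : blockWeight (bPlusBlock q) 0 0 x y N =
    (q : ℝ) ^ (y : ℝ) * qFactor q (x + 1) * qFactor q (N + 2 - y) /
      (1 - (q : ℝ) ^ (2 * ((N : ℝ) + 2))) := by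
  have hN : (0 : ℝ) ≤ N := by exact_mod_cast h.1.trans h.2.1
  simp only [blockWeight, bPlusBlock, spinOffset, Matrix.smul_apply, smul_eq_mul, Matrix.of_apply,
    Matrix.cons_val', Matrix.cons_val_zero, Matrix.cons_val_fin_one, if_true]
  exact qInt_entry_zero q.2.1 q.2.2 (by linarith) (by ring) (by ring) (by ring) (by ring)

theorem bPlus_weight_down {x y N : ℤ} (h : InRange 1 x y N) :
    blockWeight (bPlusBlock q) 1 1 x y N =
      (q : ℝ) ^ (y : ℝ) * qFactor q (x + 1) * qFactor q (N - y) /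
        (1 - (q : ℝ) ^ (2 * ((N : ℝ) + 1))) := by
  have hN : (0 : ℝ) ≤ N := by exact_mod_cast h.1.trans h.2.1
  simp only [blockWeight, bPlusBlock, spinOffset, Matrix.smul_apply, smul_eq_mul, Matrix.of_apply,
    Matrix.cons_val', Matrix.cons_val_one, Matrix.cons_val_fin_one,
    one_ne_zero, if_false]
  exact qInt_entry q.2.1 q.2.2 (by linarith) (by ring) (by ring) (by ring) (by ring)

theorem bMinus_weight_up {x y N : ℤ} (h : InRange 0 x y N) : blockWeight (bMinusBlock q) 0 0 x y N =
    -((q : ℝ) ^ (x : ℝ) * qFactor q (N - x) * qFactor q y /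
      (1 - (q : ℝ) ^ (2 * ((N : ℝ) + 1)))) := by
  have hN : (0 : ℝ) ≤ N := by exact_mod_cast h.1.trans h.2.1
  simp only [blockWeight, bMinusBlock, spinOffset, Matrix.smul_apply, smul_eq_mul, Matrix.of_apply,
    Matrix.cons_val', Matrix.cons_val_zero, Matrix.cons_val_fin_one, if_true, mul_neg]
  congr 1
  exact qInt_entry q.2.1 q.2.2 (by linarith) (by ring) (by ring) (by ring) (by ring)

theorem bMinus_weight_down {x y N : ℤ} (h : InRange 1 x y N) :
    blockWeight (bMinusBlock q) 1 1 x y N =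
      -((q : ℝ) ^ (x : ℝ) * qFactor q (N - x) * qFactor q y /
        (1 - (q : ℝ) ^ (2 * (N : ℝ)))) := by
  have hN : (1 : ℝ) ≤ N := by exact_mod_cast h.one_le
  simp only [blockWeight, bMinusBlock, spinOffset, Matrix.smul_apply, smul_eq_mul, Matrix.of_apply,
    Matrix.cons_val', Matrix.cons_val_one, Matrix.cons_val_fin_one,
    one_ne_zero, if_false, mul_neg]
  congr 1
  exact qInt_entry_zero q.2.1 q.2.2 hN (by ring) (by ring) (by ring) (by ring)

/-- The constant in the bound on the off-diagonal blocks. -/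
def offDiagConst (q : Set.Ioo (0 : ℝ) 1) : ℝ := ((q : ℝ)⁻¹ - q)⁻¹ * (q : ℝ) ^ (-4 : ℝ)

/-- The two `q`-integers in the denominators of the off-diagonal entries make these entries
exponentially small. -/
theorem offDiag_entry_le {e e' A B M M' : ℝ} {N : ℤ} (hM : 1 ≤ M) (hM' : 1 ≤ M')
    (h : N - 4 ≤ e + e' - A / 2 - B / 2 + (M - 1) + (M' - 1)) :
    |(q : ℝ) ^ e * √(qInt q A) * ((q : ℝ) ^ e' * (√(qInt q B) / (qInt q M * qInt q M')))| ≤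
      offDiagConst q * (q : ℝ) ^ N := by
  have h2 := entry_bound' q.2.1 q.2.2 (e := e - N) (e' := e') (A := A) (B := B) hM hM' (by linarith)
  have hp := zpow_pos q.2.1 N
  have : (q : ℝ) ^ e = (q : ℝ) ^ (e - N) * (q : ℝ) ^ N := by
    rw [← Real.rpow_intCast, ← Real.rpow_add q.2.1]; ring_nf
  calc _ = |(q : ℝ) ^ (e - N) * √(qInt q A) *
        ((q : ℝ) ^ e' * (√(qInt q B) / (qInt q M * qInt q M')))| * (q : ℝ) ^ N := by
        rw [this, ← abs_of_pos hp, ← abs_mul, abs_of_pos hp]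
        congr 1; ring
    _ ≤ _ := mul_le_mul_of_nonneg_right h2 hp.le

theorem InRange.real {s : Fin 2} {x y N : ℤ} (h : InRange s x y N) :
    (0 : ℝ) ≤ x ∧ (x : ℝ) ≤ N ∧ (0 : ℝ) ≤ y ∧ (s = 0 → (y : ℝ) ≤ N + 1) ∧
      (s = 1 → (y : ℝ) ≤ N - 1) := by
  obtain ⟨h1, h2, h3, h4⟩ := h
  refine ⟨by exact_mod_cast h1, by exact_mod_cast h2, by exact_mod_cast h3, fun hs => ?_,
    fun hs => ?_⟩
  · have : y ≤ N + 1 := by rw [if_pos hs] at h4; omega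
    exact_mod_cast this
  · have : y ≤ N - 1 := by rw [if_neg (by simp [hs])] at h4; omega
    exact_mod_cast this

theorem aPlus_offDiag_le {x y N : ℤ} (h : InRange 0 x y N) :
    |blockWeight (aPlusBlock q) 0 1 x y N| ≤ offDiagConst q * (q : ℝ) ^ N := by
  obtain ⟨h1, h2, h3, -, -⟩ := h.real
  simp only [blockWeight, aPlusBlock, spinOffset, Matrix.smul_apply, smul_eq_mul, Matrix.of_apply,
    Matrix.cons_val', Matrix.cons_val_zero, Matrix.cons_val_one, Matrix.cons_val_fin_one, if_true]
  exact offDiag_entry_le (by linarith) (by linarith) (by linarith)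

theorem aMinus_offDiag_le {x y N : ℤ} (h : InRange 1 x y N) :
    |blockWeight (aMinusBlock q) 1 0 x y N| ≤ offDiagConst q * (q : ℝ) ^ N := by
  obtain ⟨h1, h2, h3, -, h4⟩ := h.real
  have h4 := h4 rfl
  simp only [blockWeight, aMinusBlock, spinOffset, Matrix.smul_apply, smul_eq_mul, Matrix.of_apply,
    Matrix.cons_val', Matrix.cons_val_zero, Matrix.cons_val_one, Matrix.cons_val_fin_one,
    one_ne_zero, if_false, mul_neg, abs_neg]
  exact offDiag_entry_le (by linarith) (by linarith) (by linarith)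

theorem bPlus_offDiag_le {x y N : ℤ} (h : InRange 0 x y N) :
    |blockWeight (bPlusBlock q) 0 1 x y N| ≤ offDiagConst q * (q : ℝ) ^ N := by
  obtain ⟨h1, h2, h3, -, -⟩ := h.real
  simp only [blockWeight, bPlusBlock, spinOffset, Matrix.smul_apply, smul_eq_mul, Matrix.of_apply,
    Matrix.cons_val', Matrix.cons_val_zero, Matrix.cons_val_one, Matrix.cons_val_fin_one, if_true,
    mul_neg, abs_neg]
  exact offDiag_entry_le (by linarith) (by linarith) (by linarith)

theorem bMinus_offDiag_le {x y N : ℤ} (h : InRange 1 x y N) :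
    |blockWeight (bMinusBlock q) 1 0 x y N| ≤ offDiagConst q * (q : ℝ) ^ N := by
  obtain ⟨h1, h2, h3, -, h4⟩ := h.real
  have h4 := h4 rfl
  simp only [blockWeight, bMinusBlock, spinOffset, Matrix.smul_apply, smul_eq_mul, Matrix.of_apply,
    Matrix.cons_val', Matrix.cons_val_zero, Matrix.cons_val_one, Matrix.cons_val_fin_one,
    one_ne_zero, if_false, mul_neg, abs_neg]
  exact offDiag_entry_le (by linarith) (by linarith) (by linarith)

end Blocks

/-! ### Symbols of the generators -/

section GeneratorSymbols

variable {q : Set.Ioo (0 : ℝ) 1}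

theorem symbolRep_symb (a : disk q 1) (b : disk q (-1)) (m x y N : ℤ) {f g : ℂ} {x' y' : ℤ}
    (ha : (a : ℓ²(ℕ, ℂ) →L[ℂ] ℓ²(ℕ, ℂ)) (intKet x) = f • intKet x')
    (hb : (b : ℓ²(ℕ, ℂ) →L[ℂ] ℓ²(ℕ, ℂ)) (intKet y) = g • intKet y') :
    symbolRep (symb a b m) (modelKet x y N) = (f * g) • modelKet x' y' (N + m) := by
  rw [symb, modelKet, symbolRep_tmul, ha, hb, ← LaurentPolynomial.T_add, add_comm m N,
    TensorProduct.tmul_smul, ← TensorProduct.smul_tmul', ← TensorProduct.smul_tmul',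
    ← TensorProduct.smul_tmul', smul_smul, mul_comm g f, modelKet]

theorem symbolRep_smul (c : ℂ) (σ : SymbolAlgebra q) : symbolRep (c • σ) = c • symbolRep σ :=
  map_smul symbolRep c σ

theorem symbolRep_neg_apply (σ : SymbolAlgebra q) (w : ModelSpace) :
    symbolRep (-σ) w = (-1 : ℂ) • symbolRep σ w := by
  rw [symbolRep_neg, LinearMap.neg_apply]
  exact (neg_one_smul ℂ _).symm

/-- The constant in the comparison of the diagonal blocks with their symbols. -/
def diagConst (q : Set.Ioo (0 : ℝ) 1) : ℝ := 3 / (1 - (q : ℝ) ^ 2)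

theorem one_le_diagConst : 1 ≤ diagConst q := by
  have h0 := q.2.1
  have h1 := q.2.2
  have hq : 0 < 1 - (q : ℝ) ^ 2 := by nlinarith
  rw [diagConst, le_div_iff₀ hq]
  nlinarith

theorem diagConst_nonneg : 0 ≤ diagConst q := zero_le_one.trans one_le_diagConst

/-- Comparison of a weighted shift and of its adjoint with their symbols. At the boundary of the range
of the labels the weight of the symbol has to vanish or to be of order `q ^ (2j)`. -/
theorem hasSpinSymbol_shift_pair {T : SpinOp} {s : Fin 2} {dx dy dN : ℤ}
    {c : ℤ → ℤ → ℤ → ℝ} (hT : HasMatrix T (shiftMatrix s s dx dy dN c)) {σ σ' : SymbolAlgebra q}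
    {d : ℤ → ℤ → ℝ} (hσ : ∀ x y N, symbolRep σ (modelKet x y N) =
      (d x y : ℂ) • modelKet (x + dx) (y + dy) (N + dN))
    (hσ' : ∀ x y N, symbolRep σ' (modelKet x y N) =
      (d (x - dx) (y - dy) : ℂ) • modelKet (x - dx) (y - dy) (N - dN))
    (h1 : ∀ x y N, InRange s x y N → |c x y N - d x y| ≤ diagConst q * (q : ℝ) ^ (N : ℝ))
    (h2 : ∀ x y N, InRange s x y N → ¬InRange s (x + dx) (y + dy) (N + dN) →
      |d x y| ≤ (q : ℝ) ^ (N : ℝ))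
    (h3 : ∀ x y N, ¬InRange s x y N → InRange s (x + dx) (y + dy) (N + dN) →
      d x y = 0 ∨ 0 ≤ N ∧ |d x y| ≤ (q : ℝ) ^ (N : ℝ)) :
    HasSpinSymbol s T σ ∧ HasSpinSymbol s (star T) σ' := by
  have hK := diagConst_nonneg (q := q)
  have hN : ∀ N : ℤ, 0 ≤ N → (q : ℝ) ^ (N : ℝ) ≤ rate q ^ N := fun N h => by
    rw [Real.rpow_intCast]; exact q_zpow_le_rate h
  have hK1 : ∀ N : ℤ, rate q ^ N ≤ diagConst q * rate q ^ N := fun N =>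
    le_mul_of_one_le_left (zpow_nonneg (rate_pos q).le N) one_le_diagConst
  have h1' : ∀ x y N, InRange s x y N → InRange s (x + dx) (y + dy) (N + dN) →
      |c x y N - d x y| ≤ diagConst q * rate q ^ N := fun x y N h _ =>
    (h1 x y N h).trans (mul_le_mul_of_nonneg_left (hN N (h.1.trans h.2.1)) hK)
  refine ⟨hasSpinSymbol_shift hT hσ hK h1' fun x y N h h' => ?_,
    hasSpinSymbol_star_shift hT hσ' hK h1' fun x y N h h' => ?_⟩
  · rcases h3 x y N h h' with h0 | ⟨hN0, h0⟩
    · rw [h0, abs_zero]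
      have := zpow_nonneg (rate_pos q).le N
      positivity
    · exact h0.trans ((hN N hN0).trans (hK1 N))
  · exact (h2 x y N h h').trans ((hN N (h.1.trans h.2.1)).trans (hK1 N))

theorem rpow_le_of_le {u v : ℝ} (h : v ≤ u) : (q : ℝ) ^ u ≤ (q : ℝ) ^ v :=
  Real.rpow_le_rpow_of_exponent_ge q.2.1 q.2.2.le h

theorem rpow_le_sq {u : ℝ} (h : 2 ≤ u) : (q : ℝ) ^ u ≤ (q : ℝ) ^ 2 := by
  have := rpow_le_of_le (q := q) h
  rwa [Real.rpow_two] at this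

/-- Comparison of a weight `P a b / (1 - q^(2m))` with `P ≤ q^E`, where `a` and `b` are close to `1`. -/
theorem weight_error {P E a b m N : ℝ} (hP : 0 ≤ P) (hPE : P ≤ (q : ℝ) ^ E) (ha : 0 ≤ a)
    (ha' : a ≤ 1) (hb' : b ≤ 1) (hm : 1 ≤ m) (h1 : (q : ℝ) ^ E * (1 - a) ≤ (q : ℝ) ^ N)
    (h2 : (q : ℝ) ^ E * (1 - b) ≤ (q : ℝ) ^ N) (h3 : N ≤ E + 2 * m) :
    |P * a * b / (1 - (q : ℝ) ^ (2 * m)) - P| ≤ diagConst q * (q : ℝ) ^ N := by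
  have h0 := q.2.1
  have ht := Real.rpow_nonneg h0.le (2 * m)
  refine abs_weight_sub_le h0 q.2.2 hP ha ha' hb' ht (rpow_le_sq (by linarith))
    ((mul_le_mul_of_nonneg_right hPE (sub_nonneg.mpr ha')).trans h1)
    ((mul_le_mul_of_nonneg_right hPE (sub_nonneg.mpr hb')).trans h2) ?_
  refine (mul_le_mul_of_nonneg_right hPE ht).trans ?_
  rw [← Real.rpow_add h0]
  exact rpow_le_of_le h3

theorem rpow_mul_one_sub_qFactor_le {E u N : ℝ} (hu : 0 ≤ u) (h : N ≤ E + 2 * u) :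
    (q : ℝ) ^ E * (1 - qFactor q u) ≤ (q : ℝ) ^ N := by
  have h0 := q.2.1
  refine (mul_le_mul_of_nonneg_left (one_sub_qFactor_le h0 q.2.2 hu)
    (Real.rpow_nonneg h0.le E)).trans ?_
  rw [← Real.rpow_add h0]
  exact rpow_le_of_le h

theorem rpow_mul_one_sub_one_le {E N : ℝ} : (q : ℝ) ^ E * (1 - 1) ≤ (q : ℝ) ^ N := by
  rw [sub_self, mul_zero]
  exact Real.rpow_nonneg q.2.1.le N

theorem fin_two_cases (s : Fin 2) : s = 0 ∨ s = 1 := by omega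

theorem hasMatrix_diag {X : SpinOp} {dj dn : ℝ} {F : ℝ → ℝ → ℝ → Matrix (Fin 2) (Fin 2) ℝ}
    (hX : HasMatrix X (spinMatrix dj dn F)) (s : Fin 2) (dx dy dN : ℤ) (hN : (dN : ℝ) = 2 * dj)
    (hx : (dx : ℝ) = dj + 1 / 2) (hy : (dy : ℝ) = dn + dj) :
    HasMatrix (corner s X s) (shiftMatrix s s dx dy dN (blockWeight F s s)) :=
  hX.shift s s dx dy dN hN hx (by rw [hy]; ring)

theorem aMinus_symbol (s : Fin 2) :
    HasSpinSymbol s (corner s (aMinus q) s)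
      (-((q : ℝ) : ℂ) • symb (rB q 1) (star (rB q (-1))) (-1)) ∧
    HasSpinSymbol s (star (corner s (aMinus q) s))
      (-((q : ℝ) : ℂ) • symb (star (rB q 1)) (rB q (-1)) 1) := by
  have h0 := q.2.1
  have hd : ∀ x y : ℤ, -((q : ℝ) : ℂ) * (((1 : ℤˣ) : ℂ) * ((q : ℝ) ^ x : ℝ) *
      (((-1 : ℤˣ) : ℂ) * ((q : ℝ) ^ y : ℝ))) = (((q : ℝ) ^ ((x : ℝ) + y + 1) : ℝ) : ℂ) := by
    intro x y
    rw [Real.rpow_add h0, Real.rpow_add h0, Real.rpow_one, Real.rpow_intCast, Real.rpow_intCast]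
    push_cast
    simp
    ring
  refine hasSpinSymbol_shift_pair (hasMatrix_diag (hasMatrix_aMinus q) s 0 0 (-1) (by norm_num)
    (by norm_num) (by norm_num)) (d := fun x y => (q : ℝ) ^ ((x : ℝ) + y + 1))
    (fun x y N => ?_) (fun x y N => ?_) (fun x y N h => ?_) (fun x y N h h' => ?_)
    (fun x y N h h' => ?_)
  · rw [symbolRep_smul, LinearMap.smul_apply, star_rB, symbolRep_symb _ _ _ _ _ _
      (diskB_intKet q 1 x) (diskB_intKet q (-1) y), smul_smul, hd, add_zero, add_zero]
  · rw [symbolRep_smul, LinearMap.smul_apply, star_rB, symbolRep_symb _ _ _ _ _ _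
      (diskB_intKet q 1 x) (diskB_intKet q (-1) y), smul_smul, hd, sub_zero, sub_zero,
      sub_neg_eq_add]
  · obtain ⟨g1, g2, g3, g4, g5⟩ := h.real
    have key : ∀ u v m : ℝ, 0 ≤ u → 0 ≤ v → 1 ≤ m → N ≤ x + y + 1 + 2 * u → N ≤ x + y + 1 + 2 * v →
        N ≤ x + y + 1 + 2 * m → |(q : ℝ) ^ ((x : ℝ) + y + 1) * qFactor q u * qFactor q v /
          (1 - (q : ℝ) ^ (2 * m)) - (q : ℝ) ^ ((x : ℝ) + y + 1)| ≤
            diagConst q * (q : ℝ) ^ (N : ℝ) := fun u v m hu hv hm hu' hv' hm' =>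
      weight_error (Real.rpow_nonneg h0.le _) le_rfl (qFactor_nonneg _ _) (qFactor_le_one h0 _)
        (qFactor_le_one h0 _) hm (rpow_mul_one_sub_qFactor_le hu hu')
        (rpow_mul_one_sub_qFactor_le hv hv') hm'
    rcases fin_two_cases s with rfl | rfl
    · have g4 := g4 rfl
      rw [aMinus_weight_up h]
      apply key <;> linarith
    · have g5 := g5 rfl
      rw [aMinus_weight_down h]
      apply key <;> linarith
  · obtain ⟨g1, g2, g3, g4, g5⟩ := h.real
    rw [abs_of_nonneg (Real.rpow_nonneg h0.le _)]
    refine rpow_le_of_le ?_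
    have : N ≤ x + y + 1 := by
      unfold InRange at h h'
      split_ifs at h h' <;> omega
    exact_mod_cast this
  -- Lowering `2j` without lowering `x` or `y` does not lead into the range of the labels from outside.
  · exfalso
    unfold InRange at h h'
    split_ifs at h h' <;> omega

theorem aPlus_symbol (s : Fin 2) :
    HasSpinSymbol s (corner s (aPlus q) s) (symb (rA q 1) (rA q (-1)) 1) ∧
    HasSpinSymbol s (star (corner s (aPlus q) s)) (symb (star (rA q 1)) (star (rA q (-1))) (-1)) := by
  have h0 := q.2.1
  refine hasSpinSymbol_shift_pair (hasMatrix_diag (hasMatrix_aPlus q) s 1 1 1 (by norm_num)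
    (by norm_num) (by norm_num)) (d := fun x y => alpha q x * alpha q y)
    (fun x y N => ?_) (fun x y N => ?_) (fun x y N h => ?_) (fun x y N h h' => ?_)
    (fun x y N h h' => ?_)
  · rw [symbolRep_symb _ _ _ _ _ _ (diskA_intKet q x) (diskA_intKet q y)]
    push_cast; rfl
  · rw [symbolRep_symb _ _ _ _ _ _ (star_diskA_intKet q x) (star_diskA_intKet q y)]
    push_cast; rfl
  · obtain ⟨g1, g2, g3, g4, g5⟩ := h.real
    have key : ∀ m : ℝ, N + 1 ≤ m → |(q : ℝ) ^ (0 : ℝ) * qFactor q (x + 1) * qFactor q (y + 1) /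
        (1 - (q : ℝ) ^ (2 * m)) - alpha q x * alpha q y| ≤ diagConst q * (q : ℝ) ^ (N : ℝ) := by
      intro m hm
      have hP : 0 ≤ alpha q x * alpha q y := mul_nonneg (alpha_nonneg q x) (alpha_nonneg q y)
      have hP1 : alpha q x * alpha q y ≤ (q : ℝ) ^ (0 : ℝ) := by
        rw [Real.rpow_zero]
        exact mul_le_one₀ (alpha_le_one q x) (alpha_nonneg q y) (alpha_le_one q y)
      have := weight_error hP hP1 zero_le_one le_rfl le_rfl (by linarith)
        rpow_mul_one_sub_one_le (rpow_mul_one_sub_one_le (N := N)) (show (N : ℝ) ≤ 0 + 2 * m by linarith)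
      rw [mul_one, mul_one] at this
      rw [Real.rpow_zero, one_mul, ← alpha_eq, ← alpha_eq]
      exact this
    rcases fin_two_cases s with rfl | rfl
    · rw [aPlus_weight_up h]; exact key _ (by linarith)
    · rw [aPlus_weight_down h]; exact key _ le_rfl
  -- Raising all labels does not lead out of their range.
  · exfalso
    unfold InRange at h h'
    split_ifs at h h' <;> omega
  -- The range is entered from `x = -1` or `y = -1` only, where the weight of the symbol vanishes.
  · left
    have : x = -1 ∨ y = -1 := by
      unfold InRange at h h'
      split_ifs at h h' <;> omega
    rcases this with rfl | rfl <;> simp [alpha_neg_one]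

theorem bPlus_symbol (s : Fin 2) :
    HasSpinSymbol s (corner s (bPlus q) s) (-symb (rA q 1) (rB q (-1)) 1) ∧
    HasSpinSymbol s (star (corner s (bPlus q) s))
      (-symb (star (rA q 1)) (star (rB q (-1))) (-1)) := by
  have h0 := q.2.1
  refine hasSpinSymbol_shift_pair (hasMatrix_diag (hasMatrix_bPlus q) s 1 0 1 (by norm_num)
    (by norm_num) (by norm_num)) (d := fun x y => (q : ℝ) ^ (y : ℝ) * alpha q x)
    (fun x y N => ?_) (fun x y N => ?_) (fun x y N h => ?_) (fun x y N h h' => ?_)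
    (fun x y N h h' => ?_)
  · rw [symbolRep_neg_apply, symbolRep_symb _ _ _ _ _ _ (diskA_intKet q x)
      (diskB_intKet q (-1) y), smul_smul, add_zero, Real.rpow_intCast]
    congr 1
    push_cast
    simp
    ring
  · rw [symbolRep_neg_apply, star_rB, symbolRep_symb _ _ _ _ _ _
      (star_diskA_intKet q x) (diskB_intKet q (-1) y), smul_smul, sub_zero, Real.rpow_intCast]
    congr 1
    push_cast
    simp
    ring
  · obtain ⟨g1, g2, g3, g4, g5⟩ := h.real
    have key : ∀ v m : ℝ, N - y ≤ v → 0 ≤ v → N + 1 ≤ m → |(q : ℝ) ^ (y : ℝ) * qFactor q (x + 1) *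
        qFactor q v / (1 - (q : ℝ) ^ (2 * m)) - (q : ℝ) ^ (y : ℝ) * alpha q x| ≤
          diagConst q * (q : ℝ) ^ (N : ℝ) := by
      intro v m hv hv0 hm
      have hy := Real.rpow_pos_of_pos h0 (y : ℝ)
      have := weight_error (mul_nonneg hy.le (alpha_nonneg q x))
        (mul_le_of_le_one_right hy.le (alpha_le_one q x)) zero_le_one le_rfl (qFactor_le_one h0 v)
        (by linarith) rpow_mul_one_sub_one_le
        (rpow_mul_one_sub_qFactor_le hv0 (show (N : ℝ) ≤ y + 2 * v by linarith))
        (show (N : ℝ) ≤ y + 2 * m by linarith)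
      rw [mul_one] at this
      rw [← alpha_eq]
      exact this
    rcases fin_two_cases s with rfl | rfl
    · have g4 := g4 rfl
      rw [bPlus_weight_up h]; exact key _ _ (by linarith) (by linarith) (by linarith)
    · have g5 := g5 rfl
      rw [bPlus_weight_down h]; exact key _ _ le_rfl (by linarith) le_rfl
  -- Raising `2j` and `x` together does not lead out of the range of the labels.
  · exfalso
    unfold InRange at h h'
    split_ifs at h h' <;> omega
  -- The range is entered from `x = -1`, where the weight vanishes, or from `y ≥ 2j`, where it is small.
  · by_cases hx : x = -1
    · left; simp [hx, alpha_neg_one]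
    · right
      have : 0 ≤ N ∧ N ≤ y := by
        unfold InRange at h h'
        split_ifs at h h' <;> omega
      refine ⟨this.1, ?_⟩
      have hy := Real.rpow_pos_of_pos h0 (y : ℝ)
      rw [abs_of_nonneg (mul_nonneg hy.le (alpha_nonneg q x))]
      exact (mul_le_of_le_one_right hy.le (alpha_le_one q x)).trans
        (rpow_le_of_le (by exact_mod_cast this.2))

theorem bMinus_symbol (s : Fin 2) :
    HasSpinSymbol s (corner s (bMinus q) s) (-symb (rB q 1) (star (rA q (-1))) (-1)) ∧
    HasSpinSymbol s (star (corner s (bMinus q) s)) (-symb (star (rB q 1)) (rA q (-1)) 1) := by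
  have h0 := q.2.1
  have hx1 : ∀ x y : ℤ, 0 ≤ x → |-((q : ℝ) ^ (x : ℝ) * alpha q (y - 1))| ≤ (q : ℝ) ^ (x : ℝ) := by
    intro x y _
    have hx := Real.rpow_pos_of_pos h0 (x : ℝ)
    rw [abs_neg, abs_of_nonneg (mul_nonneg hx.le (alpha_nonneg q _))]
    exact mul_le_of_le_one_right hx.le (alpha_le_one q _)
  refine hasSpinSymbol_shift_pair (hasMatrix_diag (hasMatrix_bMinus q) s 0 (-1) (-1) (by norm_num)
    (by norm_num) (by norm_num)) (d := fun x y => -((q : ℝ) ^ (x : ℝ) * alpha q (y - 1)))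
    (fun x y N => ?_) (fun x y N => ?_) (fun x y N h => ?_) (fun x y N h h' => ?_)
    (fun x y N h h' => ?_)
  · rw [symbolRep_neg_apply, symbolRep_symb _ _ _ _ _ _ (diskB_intKet q 1 x)
      (star_diskA_intKet q y), smul_smul, add_zero, Real.rpow_intCast]
    congr 1
    push_cast
    simp
  · rw [symbolRep_neg_apply, star_rB, symbolRep_symb _ _ _ _ _ _ (diskB_intKet q 1 x)
      (diskA_intKet q y), smul_smul, sub_zero, Real.rpow_intCast, sub_neg_eq_add, sub_neg_eq_add,
      add_sub_cancel_right]
    congr 1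
    push_cast
    simp
  · obtain ⟨g1, g2, g3, g4, g5⟩ := h.real
    have e : alpha q (y - 1) = qFactor q y := by rw [alpha_eq]; push_cast; ring_nf
    have key : ∀ m : ℝ, 1 ≤ m → N ≤ m → |-((q : ℝ) ^ (x : ℝ) * qFactor q (N - x) * qFactor q y /
        (1 - (q : ℝ) ^ (2 * m))) - -((q : ℝ) ^ (x : ℝ) * alpha q (y - 1))| ≤
          diagConst q * (q : ℝ) ^ (N : ℝ) := by
      intro m hm1 hm
      have hx := Real.rpow_pos_of_pos h0 (x : ℝ)
      have := weight_error (mul_nonneg hx.le (alpha_nonneg q (y - 1)))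
        (mul_le_of_le_one_right hx.le (alpha_le_one q (y - 1))) (qFactor_nonneg _ _)
        (qFactor_le_one h0 (N - x)) le_rfl hm1
        (rpow_mul_one_sub_qFactor_le (by linarith) (show (N : ℝ) ≤ x + 2 * (N - x) by linarith))
        rpow_mul_one_sub_one_le (show (N : ℝ) ≤ x + 2 * m by linarith)
      rw [mul_one] at this
      rw [neg_sub_neg, abs_sub_comm, mul_right_comm, ← e]
      exact this
    rcases fin_two_cases s with rfl | rfl
    · rw [bMinus_weight_up h]; exact key _ (by linarith) (by linarith)
    · have hN : (1 : ℝ) ≤ N := by exact_mod_cast h.one_le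
      rw [bMinus_weight_down h]; exact key _ hN le_rfl
  -- The range is left from `x = 2j`, where the weight of the symbol is small, or from `y = 0`, where it
  -- vanishes.
  · have : N ≤ x ∨ y = 0 := by
      unfold InRange at h h'
      split_ifs at h h' <;> omega
    rcases this with hx | rfl
    · refine (hx1 x y h.1).trans (rpow_le_of_le ?_)
      exact_mod_cast hx
    · simp only [zero_sub, alpha_neg_one, mul_zero, neg_zero, abs_zero]
      positivity
  -- Lowering `2j` and `y` together does not lead into the range of the labels from outside.
  · exfalso
    unfold InRange at h h'
    split_ifs at h h' <;> omega

end GeneratorSymbols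

/-! ### Generators of algebras of operators -/

section StarGeneration
variable {ι : Type*}

theorem exists_isCommutator_of_mem_starAdjoin {lam : ι → ℝ}
    {G : Set (ℓ²(ι, ℂ) →L[ℂ] ℓ²(ι, ℂ))} {A : StarSubalgebra ℂ (ℓ²(ι, ℂ) →L[ℂ] ℓ²(ι, ℂ))}
    (hA : StarAlgebra.adjoin ℂ G ≤ A) (hG : ∀ g ∈ G, ∃ S ∈ A, IsCommutator (diagOp lam) g S)
    {T : ℓ²(ι, ℂ) →L[ℂ] ℓ²(ι, ℂ)} (hT : T ∈ StarAlgebra.adjoin ℂ G) :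
    ∃ S ∈ A, IsCommutator (diagOp lam) T S := by
  have e : Algebra.adjoin ℂ (G ∪ star G) = (StarAlgebra.adjoin ℂ G).toSubalgebra :=
    (StarAlgebra.adjoin_toSubalgebra ℂ G).symm
  refine exists_isCommutator_of_mem_adjoin (A := A.toSubalgebra) (G := G ∪ star G)
    (by rw [e]; exact hA) ?_ (by rw [e]; exact hT)
  rintro g (hg | hg)
  · exact hG g hg
  · obtain ⟨S, hS, h⟩ := hG _ hg
    have h' := h.star
    rw [star_star] at h'
    exact ⟨_, (show _ ∈ A from neg_mem (star_mem (show S ∈ A from hS))), h'⟩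

theorem starAdjoin_eq_adjoin (G : Set (ℓ²(ι, ℂ) →L[ℂ] ℓ²(ι, ℂ))) :
    (StarAlgebra.adjoin ℂ G).toSubalgebra = Algebra.adjoin ℂ (G ∪ star G) :=
  StarAlgebra.adjoin_toSubalgebra ℂ G

theorem algHom_ext_of_generators {R : Type*} [Semiring R] [Algebra ℂ R]
    {A : Subalgebra ℂ (ℓ²(ι, ℂ) →L[ℂ] ℓ²(ι, ℂ))} {G : Set (ℓ²(ι, ℂ) →L[ℂ] ℓ²(ι, ℂ))}
    (hA : A = Algebra.adjoin ℂ G) (f g : A →ₐ[ℂ] R)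
    (h : ∀ x (hx : x ∈ A), x ∈ G → f ⟨x, hx⟩ = g ⟨x, hx⟩) : f = g := by
  subst hA
  refine AlgHom.ext fun ⟨x, hx⟩ => ?_
  induction hx using Algebra.adjoin_induction with
  | mem x hx => exact h x _ hx
  | algebraMap c => exact (f.commutes c).trans (g.commutes c).symm
  | add x y hx hy ihx ihy =>
    have e : (⟨x + y, add_mem hx hy⟩ : Algebra.adjoin ℂ G) = ⟨x, hx⟩ + ⟨y, hy⟩ := rfl
    rw [e, map_add, map_add, ihx, ihy]
  | mul x y hx hy ihx ihy =>
    have e : (⟨x * y, mul_mem hx hy⟩ : Algebra.adjoin ℂ G) = ⟨x, hx⟩ * ⟨y, hy⟩ := rfl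
    rw [e, map_mul, map_mul, ihx, ihy]

/-- A functional relation compatible with the algebra operations is an algebra homomorphism. -/
theorem exists_algHom_of_rel {R : Type*} [Semiring R] [Algebra ℂ R]
    (A : Subalgebra ℂ (ℓ²(ι, ℂ) →L[ℂ] ℓ²(ι, ℂ))) (r : (ℓ²(ι, ℂ) →L[ℂ] ℓ²(ι, ℂ)) → R → Prop)
    (hex : ∀ T ∈ A, ∃ σ, r T σ) (huniq : ∀ T σ τ, r T σ → r T τ → σ = τ)
    (hadd : ∀ T S σ τ, r T σ → r S τ → r (T + S) (σ + τ))
    (hmul : ∀ T S σ τ, r T σ → r S τ → r (T * S) (σ * τ))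
    (hc : ∀ c : ℂ, r (algebraMap ℂ _ c) (algebraMap ℂ R c)) :
    ∃ f : A →ₐ[ℂ] R, ∀ T : A, r T (f T) := by
  choose f hf using fun T : A => hex T T.2
  exact ⟨{
    toFun := f
    map_one' := huniq _ _ _ (hf 1) (by simpa using hc 1)
    map_mul' := fun T S => huniq _ _ _ (hf (T * S)) (hmul _ _ _ _ (hf T) (hf S))
    map_zero' := huniq _ _ _ (hf 0) (by simpa using hc 0)
    map_add' := fun T S => huniq _ _ _ (hf (T + S)) (hadd _ _ _ _ (hf T) (hf S))
    commutes' := fun c => huniq _ _ _ (hf (algebraMap ℂ A c)) (hc c) }, hf⟩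

end StarGeneration

/-! ### Diagonal parts -/

section Diagonal

theorem spinProj_mul_self (s : Fin 2) : spinProj s * spinProj s = spinProj s := by
  refine clm_ext_ket fun l => ?_
  rw [mul_apply_eq_comp, spinProj_ket]
  split_ifs with h
  · rw [spinProj_ket, if_pos h]
  · simp

theorem spinProj_mul_ne {s t : Fin 2} (h : s ≠ t) : spinProj s * spinProj t = 0 := by
  refine clm_ext_ket fun l => ?_
  rw [mul_apply_eq_comp, spinProj_ket]
  split_ifs with hl
  · rw [spinProj_ket, if_neg (by rw [hl]; exact h.symm)]; rfl
  · simp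

theorem corner_add (s t : Fin 2) (T S : SpinOp) : corner t (T + S) s = corner t T s + corner t S s := by
  simp only [corner, mul_add, add_mul]

theorem corner_corner_self (s : Fin 2) (T : SpinOp) : corner s (corner s T s) s = corner s T s := by
  simp only [corner, ← mul_assoc, spinProj_mul_self]
  simp only [mul_assoc, spinProj_mul_self]

theorem corner_corner_ne_left {s t : Fin 2} (h : s ≠ t) (T : SpinOp) (u v : Fin 2) :
    corner s (corner t T u) v = 0 := by
  simp only [corner, ← mul_assoc, spinProj_mul_ne h, zero_mul]

theorem corner_corner_ne_right {s t : Fin 2} (h : s ≠ t) (T : SpinOp) (u v : Fin 2) :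
    corner v (corner u T t) s = 0 := by
  simp only [corner, mul_assoc, spinProj_mul_ne h.symm, mul_zero]

theorem corner_diagPart (s : Fin 2) (T : SpinOp) : corner s (diagPart T) s = corner s T s := by
  change corner s (corner 0 T 0 + corner 1 T 1) s = _
  rcases fin_two_cases s with rfl | rfl
  · rw [corner_add, corner_corner_self, corner_corner_ne_left (by decide), add_zero]
  · rw [corner_add, corner_corner_self, corner_corner_ne_left (by decide), zero_add]

theorem diagPart_offDiag (R S : SpinOp) : diagPart (offDiag R S) = 0 := by
  change corner 0 (corner 1 R 0 + corner 0 S 1) 0 + corner 1 (corner 1 R 0 + corner 0 S 1) 1 = 0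
  rw [corner_add, corner_add, corner_corner_ne_left (by decide), corner_corner_ne_right (by decide),
    corner_corner_ne_right (by decide), corner_corner_ne_left (by decide)]
  simp

theorem star_diagPart (T : SpinOp) : star (diagPart T) = diagPart (star T) := by
  change star (corner 0 T 0 + corner 1 T 1) = corner 0 (star T) 0 + corner 1 (star T) 1
  rw [star_add, star_corner, star_corner]

theorem hasMatrix_diagPart {T : SpinOp} {M : SpinIndex → SpinIndex → ℂ} (hT : HasMatrix T M) :
    HasMatrix (diagPart T) fun k l => if k.s = l.s then M k l else 0 := by
  refine ((hT.corner 0 0).add (hT.corner 1 1)).congr fun k l => ?_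
  rcases fin_two_cases k.s with hk | hk <;> rcases fin_two_cases l.s with hl | hl <;> simp [hk, hl]

theorem diagPart_commutator_eq_zero {lam : SpinIndex → ℝ} {T S : SpinOp}
    (h : IsCommutator (diagOp lam) T S) (hT : diagPart T = 0) : diagPart S = 0 := by
  have h1 := hasMatrix_diagPart (hasMatrix_self T)
  rw [hT] at h1
  refine (hasMatrix_diagPart (h.hasMatrix (hasMatrix_self T))).unique fun k l => ?_
  have := h1 k l
  simp only [zero_apply, lp.coeFn_zero, Pi.zero_apply] at this ⊢
  split_ifs at this ⊢ with hkl
  · rw [← this, mul_zero]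
  · rfl

end Diagonal

/-! ### Generators of `ℬ` and of `Ψ⁰(𝒜)` -/

section Generation

variable (q : Set.Ioo (0 : ℝ) 1)

theorem offDiagConst_nonneg : 0 ≤ offDiagConst q := const_nonneg q

theorem exists_spinSplit_spinA : ∃ d, SpinSplit (spinA q) (corner 0 (aPlus q) 0)
      (corner 1 (aPlus q) 1) (corner 0 (aMinus q) 0) (corner 1 (aMinus q) 1)
      (offDiag (aPlus q) (aMinus q)) d ∧
    ∀ s, HasSpinSymbol s (offDiag (aPlus q) (aMinus q)) (0 : SymbolAlgebra q) ∧
      HasSpinSymbol s (star (offDiag (aPlus q) (aMinus q))) (0 : SymbolAlgebra q) ∧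
      HasSpinSymbol s d (0 : SymbolAlgebra q) ∧ HasSpinSymbol s (star d) (0 : SymbolAlgebra q) :=
  exists_spinSplit 1 (by norm_num) (hasMatrix_aPlus q) (hasMatrix_aMinus q)
    (fun _ _ _ => by simp [aPlusBlock]) (fun _ _ _ => by simp [aMinusBlock])
    (offDiagConst_nonneg q) (fun _ _ _ h => aPlus_offDiag_le h) (fun _ _ _ h => aMinus_offDiag_le h)

theorem exists_spinSplit_spinB : ∃ d, SpinSplit (spinB q) (corner 0 (bPlus q) 0)
      (corner 1 (bPlus q) 1) (corner 0 (bMinus q) 0) (corner 1 (bMinus q) 1)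
      (offDiag (bPlus q) (bMinus q)) d ∧
    ∀ s, HasSpinSymbol s (offDiag (bPlus q) (bMinus q)) (0 : SymbolAlgebra q) ∧
      HasSpinSymbol s (star (offDiag (bPlus q) (bMinus q))) (0 : SymbolAlgebra q) ∧
      HasSpinSymbol s d (0 : SymbolAlgebra q) ∧ HasSpinSymbol s (star d) (0 : SymbolAlgebra q) :=
  exists_spinSplit 0 (by norm_num) (hasMatrix_bPlus q) (hasMatrix_bMinus q)
    (fun _ _ _ => by simp [bPlusBlock]) (fun _ _ _ => by simp [bMinusBlock])
    (offDiagConst_nonneg q) (fun _ _ _ h => bPlus_offDiag_le h) (fun _ _ _ h => bMinus_offDiag_le h)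

/-- `[D, o]` for the off-diagonal part `o` of `π(a)`. -/
def diracOffA : SpinOp := (exists_spinSplit_spinA q).choose

/-- `[D, o]` for the off-diagonal part `o` of `π(b)`. -/
def diracOffB : SpinOp := (exists_spinSplit_spinB q).choose

theorem spinSplit_spinA : SpinSplit (spinA q) (corner 0 (aPlus q) 0)
    (corner 1 (aPlus q) 1) (corner 0 (aMinus q) 0) (corner 1 (aMinus q) 1)
    (offDiag (aPlus q) (aMinus q)) (diracOffA q) := (exists_spinSplit_spinA q).choose_spec.1

theorem spinSplit_spinB : SpinSplit (spinB q) (corner 0 (bPlus q) 0)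
    (corner 1 (bPlus q) 1) (corner 0 (bMinus q) 0) (corner 1 (bMinus q) 1)
    (offDiag (bPlus q) (bMinus q)) (diracOffB q) := (exists_spinSplit_spinB q).choose_spec.1

/-- `*`-generators of `ℬ` that are eigenvectors of `δ`. -/
def gensB : Set SpinOp :=
  {diagPart (aPlus q), diagPart (aMinus q), offDiag (aPlus q) (aMinus q),
    diagPart (bPlus q), diagPart (bMinus q), offDiag (bPlus q) (bMinus q)}

/-- `*`-generators of `Ψ⁰(𝒜)` that are eigenvectors of `δ`. -/
def gensPsi : Set SpinOp :=
  {corner 0 (aPlus q) 0, corner 1 (aPlus q) 1, corner 0 (aMinus q) 0, corner 1 (aMinus q) 1,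
    offDiag (aPlus q) (aMinus q), diracOffA q,
    corner 0 (bPlus q) 0, corner 1 (bPlus q) 1, corner 0 (bMinus q) 0, corner 1 (bMinus q) 1,
    offDiag (bPlus q) (bMinus q), diracOffB q}

theorem spinA_mem : spinA q ∈ spinAlgebra q := StarAlgebra.subset_adjoin ℂ _ (by simp)

theorem spinB_mem : spinB q ∈ spinAlgebra q := StarAlgebra.subset_adjoin ℂ _ (by simp)

/-- The algebra `ℬ` is generated by the eigenvectors of `δ` that make up `π(a)` and `π(b)`. -/
theorem algB_eq : algB q = (StarAlgebra.adjoin ℂ (gensB q)).toSubalgebra := by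
  have hA := spinSplit_spinA q
  have hB := spinSplit_spinB q
  have hg : gensB q ⊆ StarAlgebra.adjoin ℂ (gensB q) := StarAlgebra.subset_adjoin ℂ _
  apply le_antisymm
  · refine Algebra.adjoin_le fun T hT => ?_
    have hsub : spinAlgebra q ≤ StarAlgebra.adjoin ℂ (gensB q) := by
      refine StarAlgebra.adjoin_le ?_
      rintro X (rfl | rfl)
      · have : spinA q = diagPart (aPlus q) + diagPart (aMinus q) +
            offDiag (aPlus q) (aMinus q) := by
          rw [hA.sum]; simp only [diagPart]; abel
        rw [this]
        exact add_mem (add_mem (hg (by simp [gensB])) (hg (by simp [gensB])))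
          (hg (by simp [gensB]))
      · have : spinB q = diagPart (bPlus q) + diagPart (bMinus q) +
            offDiag (bPlus q) (bMinus q) := by
          rw [hB.sum]; simp only [diagPart]; abel
        rw [this]
        exact add_mem (add_mem (hg (by simp [gensB])) (hg (by simp [gensB])))
          (hg (by simp [gensB]))
    refine DeltaOrbit.mem_of_stable (A := (StarAlgebra.adjoin ℂ (gensB q)).toSubalgebra)
      (fun g hg => hsub hg) (fun T hT => ?_) hT
    refine exists_isCommutator_of_mem_starAdjoin le_rfl (fun g hg' => ?_) hT
    rcases hg' with rfl | rfl | rfl | rfl | rfl | rfl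
    · exact ⟨diagPart (aPlus q), hg (by simp [gensB]), hA.abs_pu.add hA.abs_pd⟩
    · refine ⟨-diagPart (aMinus q), neg_mem (hg (by simp [gensB])), ?_⟩
      have := hA.abs_mu.add hA.abs_md
      rwa [← neg_add] at this
    · exact ⟨0, zero_mem _, hA.abs_o⟩
    · exact ⟨diagPart (bPlus q), hg (by simp [gensB]), hB.abs_pu.add hB.abs_pd⟩
    · refine ⟨-diagPart (bMinus q), neg_mem (hg (by simp [gensB])), ?_⟩
      have := hB.abs_mu.add hB.abs_md
      rwa [← neg_add] at this
    · exact ⟨0, zero_mem _, hB.abs_o⟩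
  · rw [starAdjoin_eq_adjoin]
    refine Algebra.adjoin_le ?_
    obtain ⟨a1, a2, a3⟩ := hA.mem_deltaAlgebra (spinA_mem q)
    obtain ⟨b1, b2, b3⟩ := hB.mem_deltaAlgebra (spinB_mem q)
    obtain ⟨a4, a5, a6⟩ := hA.star.mem_deltaAlgebra (star_mem (spinA_mem q))
    obtain ⟨b4, b5, b6⟩ := hB.star.mem_deltaAlgebra (star_mem (spinB_mem q))
    rw [← star_add] at a4 a5 b4 b5
    rintro T (hT | hT)
    · rcases hT with rfl | rfl | rfl | rfl | rfl | rfl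
      exacts [a1, a2, a3, b1, b2, b3]
    · rw [Set.mem_star] at hT
      rw [← star_star T]
      rcases hT with h | h | h | h | h | h <;> rw [h]
      exacts [a5, a4, a6, b5, b4, b6]

/-- The algebra `Ψ⁰(𝒜)` is generated by the corners of the eigenvectors of `δ` that make up `π(a)` and
`π(b)`, together with the off-diagonal parts and their commutators with `D`. -/
theorem algPsi_eq : algPsi q = (StarAlgebra.adjoin ℂ (gensPsi q)).toSubalgebra := by
  have hA := spinSplit_spinA q
  have hB := spinSplit_spinB q
  have hg : gensPsi q ⊆ StarAlgebra.adjoin ℂ (gensPsi q) := StarAlgebra.subset_adjoin ℂ _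
  have hmem : ∀ X pu pd mu md o d : SpinOp, SpinSplit X pu pd mu md o d →
      pu ∈ StarAlgebra.adjoin ℂ (gensPsi q) → pd ∈ StarAlgebra.adjoin ℂ (gensPsi q) →
      mu ∈ StarAlgebra.adjoin ℂ (gensPsi q) → md ∈ StarAlgebra.adjoin ℂ (gensPsi q) →
      o ∈ StarAlgebra.adjoin ℂ (gensPsi q) → d ∈ StarAlgebra.adjoin ℂ (gensPsi q) →
      X ∈ StarAlgebra.adjoin ℂ (gensPsi q) ∧ ∃ S ∈ StarAlgebra.adjoin ℂ (gensPsi q),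
        IsCommutator (diagOp diracEigenvalue) X S := by
    intro X pu pd mu md o d h h1 h2 h3 h4 h5 h6
    refine ⟨?_, _, ?_, h.dirac⟩
    · rw [h.sum]
      exact add_mem (add_mem (add_mem (add_mem h1 h2) h3) h4) h5
    · exact add_mem (add_mem (sub_mem (sub_mem h1 h2) h3) h4) h6
  have mA := hmem _ _ _ _ _ _ _ hA (hg (by simp [gensPsi])) (hg (by simp [gensPsi]))
    (hg (by simp [gensPsi])) (hg (by simp [gensPsi])) (hg (by simp [gensPsi]))
    (hg (by simp [gensPsi]))
  have mB := hmem _ _ _ _ _ _ _ hB (hg (by simp [gensPsi])) (hg (by simp [gensPsi]))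
    (hg (by simp [gensPsi])) (hg (by simp [gensPsi])) (hg (by simp [gensPsi]))
    (hg (by simp [gensPsi]))
  have hsub : spinAlgebra q ≤ StarAlgebra.adjoin ℂ (gensPsi q) := by
    refine StarAlgebra.adjoin_le ?_
    rintro X (rfl | rfl)
    exacts [mA.1, mB.1]
  apply le_antisymm
  · refine Algebra.adjoin_le fun T hT => ?_
    refine DeltaOrbit.mem_of_stable (A := (StarAlgebra.adjoin ℂ (gensPsi q)).toSubalgebra)
      (fun g hg => ?_) (fun T hT => ?_) hT
    · rcases hg with hg | ⟨T, hT, h⟩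
      · exact hsub hg
      · obtain ⟨S, hS, h'⟩ := exists_isCommutator_of_mem_starAdjoin
          (A := StarAlgebra.adjoin ℂ (gensPsi q)) hsub (by
            rintro X (rfl | rfl)
            exacts [mA.2, mB.2]) hT
        rw [h.unique h']; exact hS
    · refine exists_isCommutator_of_mem_starAdjoin le_rfl (fun g hg' => ?_) hT
      rcases hg' with rfl | rfl | rfl | rfl | rfl | rfl | rfl | rfl | rfl | rfl | rfl | rfl
      · exact ⟨_, hg (by simp [gensPsi]), hA.abs_pu⟩
      · exact ⟨_, hg (by simp [gensPsi]), hA.abs_pd⟩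
      · exact ⟨_, neg_mem (hg (by simp [gensPsi])), hA.abs_mu⟩
      · exact ⟨_, neg_mem (hg (by simp [gensPsi])), hA.abs_md⟩
      · exact ⟨0, zero_mem _, hA.abs_o⟩
      · exact ⟨0, zero_mem _, hA.abs_d⟩
      · exact ⟨_, hg (by simp [gensPsi]), hB.abs_pu⟩
      · exact ⟨_, hg (by simp [gensPsi]), hB.abs_pd⟩
      · exact ⟨_, neg_mem (hg (by simp [gensPsi])), hB.abs_mu⟩
      · exact ⟨_, neg_mem (hg (by simp [gensPsi])), hB.abs_md⟩
      · exact ⟨0, zero_mem _, hB.abs_o⟩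
      · exact ⟨0, zero_mem _, hB.abs_d⟩
  · rw [starAdjoin_eq_adjoin]
    refine Algebra.adjoin_le ?_
    obtain ⟨a1, a2, a3, a4, a5, a6⟩ := hA.mem_psiZero (spinA_mem q)
    obtain ⟨b1, b2, b3, b4, b5, b6⟩ := hB.mem_psiZero (spinB_mem q)
    obtain ⟨c1, c2, c3, c4, c5, c6⟩ := hA.star.mem_psiZero (star_mem (spinA_mem q))
    obtain ⟨d1, d2, d3, d4, d5, d6⟩ := hB.star.mem_psiZero (star_mem (spinB_mem q))
    rintro T (hT | hT)
    · rcases hT with rfl | rfl | rfl | rfl | rfl | rfl | rfl | rfl | rfl | rfl | rfl | rfl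
      exacts [a1, a2, a3, a4, a5, a6, b1, b2, b3, b4, b5, b6]
    · rw [Set.mem_star] at hT
      rw [← star_star T]
      rcases hT with h | h | h | h | h | h | h | h | h | h | h | h <;> rw [h]
      exacts [c3, c4, c1, c2, c5, neg_neg (star (diracOffA q)) ▸ neg_mem c6,
        d3, d4, d1, d2, d5, neg_neg (star (diracOffB q)) ▸ neg_mem d6]

end Generation

/-! ### Symbols of corners and diagonal parts -/

section DiagonalSymbols
variable {q : Set.Ioo (0 : ℝ) 1}

theorem hasSpinSymbol_mul_spinProj_ne {s t : Fin 2} (hst : t ≠ s) (T : SpinOp) :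
    HasSpinSymbol t (T * spinProj s) (0 : SymbolAlgebra q) := by
  refine ⟨0, le_rfl, fun x y N => ?_⟩
  rw [symbolRep_zero, LinearMap.zero_apply, map_zero, modelToSpin_modelKet, mul_apply_eq_comp]
  by_cases h : InRange t x y N
  · obtain ⟨l, rfl, rfl, rfl, rfl⟩ := h.exists_index
    rw [spinKet_index, spinProj_ket, if_neg hst]; simp
  · rw [spinKet_of_not_inRange h]; simp

theorem HasSpinSymbol.corner {s : Fin 2} {T : SpinOp} {σ : SymbolAlgebra q}
    (h : HasSpinSymbol s T σ) : HasSpinSymbol s (corner s T s) σ := by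
  have := ((hasSpinSymbol_spinProj_self (q := q) s).mul h).mul (hasSpinSymbol_spinProj_self s)
  rwa [one_mul, mul_one] at this

/-- The diagonal part of `X` and the corner `P_s X P_s` agree on kets of spin `s`. -/
theorem hasSpinSymbol_diagPart {X : SpinOp} {σ : SymbolAlgebra q} {s : Fin 2}
    (h : HasSpinSymbol s (corner s X s) σ) : HasSpinSymbol s (diagPart X) σ := by
  rcases fin_two_cases s with rfl | rfl
  · have := h.add (hasSpinSymbol_mul_spinProj_ne (q := q) (s := 1) (t := 0) (by decide)
      (spinProj 1 * X))
    rwa [add_zero] at this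
  · have := (hasSpinSymbol_mul_spinProj_ne (q := q) (s := 0) (t := 1) (by decide)
      (spinProj 0 * X)).add h
    rwa [zero_add] at this

theorem hasSpinSymbol_diagPart_pair {X : SpinOp} {σ τ : SymbolAlgebra q}
    (h : ∀ s, HasSpinSymbol s (corner s X s) σ ∧ HasSpinSymbol s (star (corner s X s)) τ) :
    (∀ s, HasSpinSymbol s (diagPart X) σ) ∧ ∀ s, HasSpinSymbol s (star (diagPart X)) τ := by
  refine ⟨fun s => hasSpinSymbol_diagPart (h s).1, fun s => ?_⟩
  rw [star_diagPart]
  refine hasSpinSymbol_diagPart ?_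
  rw [← star_corner]
  exact (h s).2

theorem exists_symbol_corner {X : SpinOp} {s : Fin 2} {σ τ : SymbolAlgebra q}
    (h : HasSpinSymbol s (corner s X s) σ ∧ HasSpinSymbol s (star (corner s X s)) τ) (t : Fin 2) :
    (∃ σ : SymbolAlgebra q, HasSpinSymbol t (corner s X s) σ) ∧
      ∃ σ : SymbolAlgebra q, HasSpinSymbol t (star (corner s X s)) σ := by
  by_cases hst : t = s
  · subst hst
    exact ⟨⟨_, h.1⟩, _, h.2⟩
  · refine ⟨⟨0, hasSpinSymbol_mul_spinProj_ne hst _⟩, 0, ?_⟩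
    rw [star_corner]
    exact hasSpinSymbol_mul_spinProj_ne hst _

end DiagonalSymbols

/-! ### The symbol maps -/

section SymbolMap
variable (q : Set.Ioo (0 : ℝ) 1)

theorem offDiag_a_symbol (s : Fin 2) :
    HasSpinSymbol s (offDiag (aPlus q) (aMinus q)) (0 : SymbolAlgebra q) ∧
      HasSpinSymbol s (star (offDiag (aPlus q) (aMinus q))) (0 : SymbolAlgebra q) ∧
      HasSpinSymbol s (diracOffA q) (0 : SymbolAlgebra q) ∧
      HasSpinSymbol s (star (diracOffA q)) (0 : SymbolAlgebra q) :=
  (exists_spinSplit_spinA q).choose_spec.2 s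

theorem offDiag_b_symbol (s : Fin 2) :
    HasSpinSymbol s (offDiag (bPlus q) (bMinus q)) (0 : SymbolAlgebra q) ∧
      HasSpinSymbol s (star (offDiag (bPlus q) (bMinus q))) (0 : SymbolAlgebra q) ∧
      HasSpinSymbol s (diracOffB q) (0 : SymbolAlgebra q) ∧
      HasSpinSymbol s (star (diracOffB q)) (0 : SymbolAlgebra q) :=
  (exists_spinSplit_spinB q).choose_spec.2 s

theorem exists_symbol_of_mem_algB {T : SpinOp} (hT : T ∈ algB q) :
    ∃ σ : SymbolAlgebra q, ∀ s, HasSpinSymbol s T σ := by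
  rw [algB_eq, starAdjoin_eq_adjoin] at hT
  induction hT using Algebra.adjoin_induction with
  | mem x hx =>
    rcases hx with hx | hx
    · rcases hx with rfl | rfl | rfl | rfl | rfl | rfl
      · exact ⟨_, (hasSpinSymbol_diagPart_pair aPlus_symbol).1⟩
      · exact ⟨_, (hasSpinSymbol_diagPart_pair aMinus_symbol).1⟩
      · exact ⟨0, fun s => (offDiag_a_symbol q s).1⟩
      · exact ⟨_, (hasSpinSymbol_diagPart_pair bPlus_symbol).1⟩
      · exact ⟨_, (hasSpinSymbol_diagPart_pair bMinus_symbol).1⟩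
      · exact ⟨0, fun s => (offDiag_b_symbol q s).1⟩
    · rw [Set.mem_star] at hx
      rw [← star_star x]
      rcases hx with h | h | h | h | h | h <;> rw [h]
      · exact ⟨_, (hasSpinSymbol_diagPart_pair aPlus_symbol).2⟩
      · exact ⟨_, (hasSpinSymbol_diagPart_pair aMinus_symbol).2⟩
      · exact ⟨0, fun s => (offDiag_a_symbol q s).2.1⟩
      · exact ⟨_, (hasSpinSymbol_diagPart_pair bPlus_symbol).2⟩
      · exact ⟨_, (hasSpinSymbol_diagPart_pair bMinus_symbol).2⟩
      · exact ⟨0, fun s => (offDiag_b_symbol q s).2.1⟩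
  | algebraMap c => exact ⟨_, fun s => hasSpinSymbol_algebraMap s c⟩
  | add x y _ _ ihx ihy =>
    obtain ⟨σ, hσ⟩ := ihx
    obtain ⟨τ, hτ⟩ := ihy
    exact ⟨_, fun s => (hσ s).add (hτ s)⟩
  | mul x y _ _ ihx ihy =>
    obtain ⟨σ, hσ⟩ := ihx
    obtain ⟨τ, hτ⟩ := ihy
    exact ⟨_, fun s => (hσ s).mul (hτ s)⟩

theorem exists_symbol_of_mem_algPsi {T : SpinOp} (hT : T ∈ algPsi q) (s : Fin 2) :
    ∃ σ : SymbolAlgebra q, HasSpinSymbol s T σ := by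
  rw [algPsi_eq, starAdjoin_eq_adjoin] at hT
  induction hT using Algebra.adjoin_induction with
  | mem x hx =>
    rcases hx with hx | hx
    · rcases hx with rfl | rfl | rfl | rfl | rfl | rfl | rfl | rfl | rfl | rfl | rfl | rfl
      · exact (exists_symbol_corner (aPlus_symbol 0) s).1
      · exact (exists_symbol_corner (aPlus_symbol 1) s).1
      · exact (exists_symbol_corner (aMinus_symbol 0) s).1
      · exact (exists_symbol_corner (aMinus_symbol 1) s).1
      · exact ⟨0, (offDiag_a_symbol q s).1⟩
      · exact ⟨0, (offDiag_a_symbol q s).2.2.1⟩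
      · exact (exists_symbol_corner (bPlus_symbol 0) s).1
      · exact (exists_symbol_corner (bPlus_symbol 1) s).1
      · exact (exists_symbol_corner (bMinus_symbol 0) s).1
      · exact (exists_symbol_corner (bMinus_symbol 1) s).1
      · exact ⟨0, (offDiag_b_symbol q s).1⟩
      · exact ⟨0, (offDiag_b_symbol q s).2.2.1⟩
    · rw [Set.mem_star] at hx
      rw [← star_star x]
      rcases hx with h | h | h | h | h | h | h | h | h | h | h | h <;> rw [h]
      · exact (exists_symbol_corner (aPlus_symbol 0) s).2
      · exact (exists_symbol_corner (aPlus_symbol 1) s).2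
      · exact (exists_symbol_corner (aMinus_symbol 0) s).2
      · exact (exists_symbol_corner (aMinus_symbol 1) s).2
      · exact ⟨0, (offDiag_a_symbol q s).2.1⟩
      · exact ⟨0, (offDiag_a_symbol q s).2.2.2⟩
      · exact (exists_symbol_corner (bPlus_symbol 0) s).2
      · exact (exists_symbol_corner (bPlus_symbol 1) s).2
      · exact (exists_symbol_corner (bMinus_symbol 0) s).2
      · exact (exists_symbol_corner (bMinus_symbol 1) s).2
      · exact ⟨0, (offDiag_b_symbol q s).2.1⟩
      · exact ⟨0, (offDiag_b_symbol q s).2.2.2⟩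
  | algebraMap c => exact ⟨_, hasSpinSymbol_algebraMap s c⟩
  | add x y _ _ ihx ihy =>
    obtain ⟨σ, hσ⟩ := ihx
    obtain ⟨τ, hτ⟩ := ihy
    exact ⟨_, hσ.add hτ⟩
  | mul x y _ _ ihx ihy =>
    obtain ⟨σ, hσ⟩ := ihx
    obtain ⟨τ, hτ⟩ := ihy
    exact ⟨_, hσ.mul hτ⟩

theorem exists_rho : ∃ ρ : algB q →ₐ[ℂ] SymbolAlgebra q,
    ∀ T : algB q, ∀ s, HasSpinSymbol s (T : SpinOp) (ρ T) :=
  exists_algHom_of_rel (algB q) (fun T σ => ∀ s, HasSpinSymbol s T σ)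
    (fun _ hT => exists_symbol_of_mem_algB q hT) (fun _ _ _ h h' => (h 0).unique (h' 0))
    (fun _ _ _ _ h h' s => (h s).add (h' s)) (fun _ _ _ _ h h' s => (h s).mul (h' s))
    (fun c s => hasSpinSymbol_algebraMap s c)

theorem exists_symbolMap_algPsi (s : Fin 2) : ∃ f : algPsi q →ₐ[ℂ] SymbolAlgebra q,
    ∀ T : algPsi q, HasSpinSymbol s (T : SpinOp) (f T) :=
  exists_algHom_of_rel (R := SymbolAlgebra q) (algPsi q) (HasSpinSymbol s)
    (fun _ hT => exists_symbol_of_mem_algPsi q hT s) (fun _ _ _ h h' => h.unique h')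
    (fun _ _ _ _ h h' => h.add h') (fun _ _ _ _ h h' => h.mul h') (hasSpinSymbol_algebraMap s)

/-- The symbol map `ρ` on `ℬ`: the common symbol on the up and the down kets. -/
def rho : algB q →ₐ[ℂ] SymbolAlgebra q := (exists_rho q).choose

/-- The symbol map `ρ'` on `Ψ⁰(𝒜)`: the pair of the symbols on the up and on the down kets. -/
def rhoExt : algPsi q →ₐ[ℂ] SymbolAlgebra q × SymbolAlgebra q :=
  AlgHom.prod (exists_symbolMap_algPsi q 0).choose (exists_symbolMap_algPsi q 1).choose

variable {q}

theorem hasSpinSymbol_rho (T : algB q) (s : Fin 2) : HasSpinSymbol s (T : SpinOp) (rho q T) :=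
  (exists_rho q).choose_spec T s

theorem hasSpinSymbol_rhoExt (T : algPsi q) : HasSpinSymbol 0 (T : SpinOp) (rhoExt q T).1 ∧
    HasSpinSymbol 1 (T : SpinOp) (rhoExt q T).2 :=
  ⟨(exists_symbolMap_algPsi q 0).choose_spec T, (exists_symbolMap_algPsi q 1).choose_spec T⟩

theorem mem_algB_of_gensB {T : SpinOp} (hT : T ∈ gensB q) : T ∈ algB q ∧ star T ∈ algB q := by
  rw [algB_eq]
  have : T ∈ StarAlgebra.adjoin ℂ (gensB q) := StarAlgebra.subset_adjoin ℂ _ hT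
  exact ⟨this, star_mem (s := StarAlgebra.adjoin ℂ (gensB q)) this⟩

theorem rho_eq {T : SpinOp} {σ τ : SymbolAlgebra q} (hT : T ∈ gensB q)
    (h : (∀ s, HasSpinSymbol s T σ) ∧ ∀ s, HasSpinSymbol s (star T) τ) :
    (∃ hm, rho q ⟨T, hm⟩ = σ) ∧ ∃ hm, rho q ⟨star T, hm⟩ = τ :=
  ⟨⟨(mem_algB_of_gensB hT).1, (hasSpinSymbol_rho _ 0).unique (h.1 0)⟩,
    (mem_algB_of_gensB hT).2, (hasSpinSymbol_rho _ 0).unique (h.2 0)⟩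

variable (q) in
theorem isSymbolMap_rho : IsSymbolMap q (rho q) := by
  have hp := rho_eq (by simp [gensB]) (hasSpinSymbol_diagPart_pair (aPlus_symbol (q := q)))
  have hm := rho_eq (by simp [gensB]) (hasSpinSymbol_diagPart_pair (aMinus_symbol (q := q)))
  have hp' := rho_eq (by simp [gensB]) (hasSpinSymbol_diagPart_pair (bPlus_symbol (q := q)))
  have hm' := rho_eq (by simp [gensB]) (hasSpinSymbol_diagPart_pair (bMinus_symbol (q := q)))
  have ho := rho_eq (by simp [gensB])
    ⟨fun s => (offDiag_a_symbol q s).1, fun s => (offDiag_a_symbol q s).2.1⟩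
  have ho' := rho_eq (by simp [gensB])
    ⟨fun s => (offDiag_b_symbol q s).1, fun s => (offDiag_b_symbol q s).2.1⟩
  exact ⟨hp.1, hp.2, hm.1, hm.2, hp'.1, hp'.2, hm'.1, hm'.2, ho.1, ho.2, ho'.1, ho'.2⟩

theorem IsSymbolMap.ext {ρ ρ₁ : algB q →ₐ[ℂ] SymbolAlgebra q} (h : IsSymbolMap q ρ)
    (h₁ : IsSymbolMap q ρ₁) : ρ = ρ₁ := by
  have key : ∀ {T : SpinOp} {σ : SymbolAlgebra q}, (∃ hm, ρ ⟨T, hm⟩ = σ) →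
      (∃ hm, ρ₁ ⟨T, hm⟩ = σ) → ∀ hm, ρ ⟨T, hm⟩ = ρ₁ ⟨T, hm⟩ :=
    fun ⟨_, e⟩ ⟨_, e'⟩ _ => e.trans e'.symm
  refine algHom_ext_of_generators ((algB_eq q).trans (starAdjoin_eq_adjoin _)) ρ ρ₁
    fun x hx hg => ?_
  rcases hg with hg | hg
  · rcases hg with rfl | rfl | rfl | rfl | rfl | rfl
    exacts [key h.map_aPlus h₁.map_aPlus _, key h.map_aMinus h₁.map_aMinus _,
      key h.map_offDiag_a h₁.map_offDiag_a _, key h.map_bPlus h₁.map_bPlus _,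
      key h.map_bMinus h₁.map_bMinus _, key h.map_offDiag_b h₁.map_offDiag_b _]
  · rw [Set.mem_star] at hg
    obtain ⟨y, rfl⟩ : ∃ y, x = star y := ⟨star x, (star_star x).symm⟩
    rw [star_star] at hg
    rcases hg with rfl | rfl | rfl | rfl | rfl | rfl
    exacts [key h.map_aPlus_star h₁.map_aPlus_star _, key h.map_aMinus_star h₁.map_aMinus_star _,
      key h.map_offDiag_a_star h₁.map_offDiag_a_star _, key h.map_bPlus_star h₁.map_bPlus_star _,
      key h.map_bMinus_star h₁.map_bMinus_star _, key h.map_offDiag_b_star h₁.map_offDiag_b_star _]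

theorem rhoExt_eq {S : algPsi q} {σ τ : SymbolAlgebra q} (h : HasSpinSymbol 0 (S : SpinOp) σ)
    (h' : HasSpinSymbol 1 (S : SpinOp) τ) : rhoExt q S = (σ, τ) :=
  Prod.ext ((hasSpinSymbol_rhoExt S).1.unique h) ((hasSpinSymbol_rhoExt S).2.unique h')

/-- An operator without diagonal part has symbol zero, because its diagonal part has the same
symbol. -/
theorem HasSpinSymbol.eq_zero_of_diagPart {s : Fin 2} {T : SpinOp} {σ : SymbolAlgebra q}
    (h : HasSpinSymbol s T σ) (hT : diagPart T = 0) : σ = 0 := by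
  have h1 := hasSpinSymbol_diagPart h.corner
  rw [hT] at h1
  refine h1.unique ?_
  have := hasSpinSymbol_algebraMap (q := q) s 0
  rwa [map_zero, map_zero] at this

variable (q) in
theorem isExtendedSymbolMap_rhoExt : IsExtendedSymbolMap (rho q) (rhoExt q) where
  extends_symbol S T e := by
    refine rhoExt_eq ?_ ?_ <;> rw [e] <;> exact hasSpinSymbol_rho T _
  map_cornerUp S T e := by
    refine rhoExt_eq ?_ ?_ <;> rw [e]
    · exact (hasSpinSymbol_rho T 0).corner
    · exact hasSpinSymbol_mul_spinProj_ne (by decide) _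
  map_cornerDn S T e := by
    refine rhoExt_eq ?_ ?_ <;> rw [e]
    · exact hasSpinSymbol_mul_spinProj_ne (by decide) _
    · exact (hasSpinSymbol_rho T 1).corner
  map_offDiag S e := Prod.ext ((hasSpinSymbol_rhoExt S).1.eq_zero_of_diagPart e)
    ((hasSpinSymbol_rhoExt S).2.eq_zero_of_diagPart e)

/-- The generators of `Ψ⁰(𝒜)` and their adjoints are corners of elements of `ℬ` or have no diagonal
part, so that the defining properties of the extended symbol map apply to them. -/
theorem gensPsi_cases {x : SpinOp} (hx : x ∈ gensPsi q ∪ star (gensPsi q)) :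
    (∃ T : algB q, x = spinProj 0 * T * spinProj 0) ∨
      (∃ T : algB q, x = spinProj 1 * T * spinProj 1) ∨ diagPart x = 0 := by
  have hc : ∀ X : SpinOp, diagPart X ∈ gensB q → ∀ s : Fin 2,
      (∃ T : algB q, corner s X s = spinProj s * T * spinProj s) ∧
        ∃ T : algB q, star (corner s X s) = spinProj s * T * spinProj s := by
    intro X hX s
    refine ⟨⟨⟨_, (mem_algB_of_gensB hX).1⟩, (corner_diagPart s X).symm⟩,
      ⟨_, (mem_algB_of_gensB hX).2⟩, ?_⟩
    exact (star_corner s s X).trans ((corner_diagPart s (star X)).symm.trans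
      (congrArg (fun S => corner s S s) (star_diagPart X).symm))
  have ap := hc (aPlus q) (by simp [gensB])
  have am := hc (aMinus q) (by simp [gensB])
  have bp := hc (bPlus q) (by simp [gensB])
  have bm := hc (bMinus q) (by simp [gensB])
  have hoa : diagPart (offDiag (aPlus q) (aMinus q)) = 0 := diagPart_offDiag _ _
  have hob : diagPart (offDiag (bPlus q) (bMinus q)) = 0 := diagPart_offDiag _ _
  have hda := diagPart_commutator_eq_zero (spinSplit_spinA q).dir_o hoa
  have hdb := diagPart_commutator_eq_zero (spinSplit_spinB q).dir_o hob
  have hs : ∀ {T : SpinOp}, diagPart T = 0 → diagPart (star T) = 0 := by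
    intro T hT; rw [← star_diagPart, hT, star_zero]
  rcases hx with hx | hx
  · rcases hx with rfl | rfl | rfl | rfl | rfl | rfl | rfl | rfl | rfl | rfl | rfl | rfl
    exacts [.inl (ap 0).1, .inr (.inl (ap 1).1), .inl (am 0).1, .inr (.inl (am 1).1),
      .inr (.inr hoa), .inr (.inr hda), .inl (bp 0).1, .inr (.inl (bp 1).1), .inl (bm 0).1,
      .inr (.inl (bm 1).1), .inr (.inr hob), .inr (.inr hdb)]
  · rw [Set.mem_star] at hx
    rw [← star_star x]
    rcases hx with h | h | h | h | h | h | h | h | h | h | h | h <;> rw [h]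
    exacts [.inl (ap 0).2, .inr (.inl (ap 1).2), .inl (am 0).2, .inr (.inl (am 1).2),
      .inr (.inr (hs hoa)), .inr (.inr (hs hda)), .inl (bp 0).2, .inr (.inl (bp 1).2),
      .inl (bm 0).2, .inr (.inl (bm 1).2), .inr (.inr (hs hob)), .inr (.inr (hs hdb))]

theorem IsExtendedSymbolMap.ext {ρ : algB q →ₐ[ℂ] SymbolAlgebra q}
    {ρ₁ ρ₂ : algPsi q →ₐ[ℂ] SymbolAlgebra q × SymbolAlgebra q} (h₁ : IsExtendedSymbolMap ρ ρ₁)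
    (h₂ : IsExtendedSymbolMap ρ ρ₂) : ρ₁ = ρ₂ := by
  refine algHom_ext_of_generators (R := SymbolAlgebra q × SymbolAlgebra q)
    ((algPsi_eq q).trans (starAdjoin_eq_adjoin _)) ρ₁ ρ₂ fun x hx hg => ?_
  rcases gensPsi_cases hg with ⟨T, e⟩ | ⟨T, e⟩ | e
  · exact (h₁.map_cornerUp ⟨x, hx⟩ T e).trans (h₂.map_cornerUp ⟨x, hx⟩ T e).symm
  · exact (h₁.map_cornerDn ⟨x, hx⟩ T e).trans (h₂.map_cornerDn ⟨x, hx⟩ T e).symm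
  · exact (h₁.map_offDiag ⟨x, hx⟩ e).trans (h₂.map_offDiag ⟨x, hx⟩ e).symm

end SymbolMap

/-! ### Simple poles -/

section SimplePole

/-- `f` is holomorphic near `s` except possibly at `s`, where it has at most a simple pole with
residue `v`. -/
def HasResidue (f : ℂ → ℂ) (s v : ℂ) : Prop :=
  (∀ᶠ z in 𝓝[≠] s, DifferentiableAt ℂ f z) ∧ Tendsto (fun z => (z - s) * f z) (𝓝[≠] s) (𝓝 v)

variable {f g : ℂ → ℂ} {s v w : ℂ}

theorem HasResidue.add (hf : HasResidue f s v) (hg : HasResidue g s w) :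
    HasResidue (fun z => f z + g z) s (v + w) := by
  refine ⟨?_, (hf.2.add hg.2).congr fun z => by ring⟩
  filter_upwards [hf.1, hg.1] with z h h' using h.add h'

theorem HasResidue.const_mul (hf : HasResidue f s v) (c : ℂ) :
    HasResidue (fun z => c * f z) s (c * v) := by
  refine ⟨?_, (hf.2.const_mul c).congr fun z => by ring⟩
  filter_upwards [hf.1] with z h using h.const_mul c

theorem hasResidue_zero (hd : ∀ᶠ z in 𝓝[≠] s, DifferentiableAt ℂ f z) (hf : ContinuousAt f s) :
    HasResidue f s 0 := by
  refine ⟨hd, ?_⟩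
  have : Tendsto (fun z => (z - s) * f z) (𝓝 s) (𝓝 ((s - s) * f s)) :=
    (continuousAt_id.sub continuousAt_const).mul hf
  rw [sub_self, zero_mul] at this
  exact this.mono_left nhdsWithin_le_nhds

theorem _root_.Differentiable.hasResidue (hf : Differentiable ℂ f) (s : ℂ) : HasResidue f s 0 :=
  hasResidue_zero (Eventually.of_forall fun z => hf z) (hf s).continuousAt

theorem tendsto_add_punctured (s c : ℂ) :
    Tendsto (fun z => z + c) (𝓝[≠] s) (𝓝[≠] (s + c)) := by
  refine tendsto_nhdsWithin_iff.mpr ⟨?_, ?_⟩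
  · exact ((continuous_id.add continuous_const).tendsto s).mono_left nhdsWithin_le_nhds
  · filter_upwards [self_mem_nhdsWithin] with z hz
    simpa using hz

theorem HasResidue.comp_add {c : ℂ} (hf : HasResidue f (s + c) v) :
    HasResidue (fun z => f (z + c)) s v := by
  have ht := tendsto_add_punctured s c
  refine ⟨?_, (hf.2.comp ht).congr fun z => ?_⟩
  · filter_upwards [ht.eventually hf.1] with z hz
    exact hz.comp z (differentiableAt_id.add_const c)
  · simp

/-- Near `s`, the function `(z - s) f(z)` extends holomorphically. -/
theorem HasResidue.exists_analytic (hf : HasResidue f s v) :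
    ∃ g : ℂ → ℂ, AnalyticAt ℂ g s ∧ g s = v ∧ ∀ᶠ z in 𝓝[≠] s, f z = (z - s)⁻¹ * g z := by
  classical
  refine ⟨Function.update (fun z => (z - s) * f z) s v, ?_, by simp, ?_⟩
  · refine Complex.analyticAt_of_differentiable_on_punctured_nhds_of_continuousAt ?_
      (continuousAt_update_same.mpr hf.2)
    filter_upwards [hf.1, self_mem_nhdsWithin] with z hz hzs
    have hd : DifferentiableAt ℂ (fun z => (z - s) * f z) z :=
      (differentiableAt_id.sub_const s).mul hz
    refine hd.congr_of_eventuallyEq ?_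
    filter_upwards [isOpen_ne.mem_nhds hzs] with y hy
    exact Function.update_of_ne hy _ _
  · filter_upwards [self_mem_nhdsWithin] with z hz
    have : z - s ≠ 0 := sub_ne_zero.mpr hz
    rw [Function.update_of_ne hz]
    field_simp

theorem HasResidue.meromorphicAt (hf : HasResidue f s v) : MeromorphicAt f s := by
  obtain ⟨g, hg, -, he⟩ := hf.exists_analytic
  refine MeromorphicAt.congr ?_ (EventuallyEq.symm he)
  have : AnalyticAt ℂ (fun z : ℂ => z - s) s := analyticAt_id.sub analyticAt_const
  exact this.meromorphicAt.inv.mul hg.meromorphicAt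

theorem meromorphicOrderAt_inv_sub (s : ℂ) :
    meromorphicOrderAt (fun z : ℂ => (z - s)⁻¹) s = ((-1 : ℤ) : WithTop ℤ) := by
  have h : MeromorphicAt (fun z : ℂ => (z - s)⁻¹) s :=
    (analyticAt_id.sub analyticAt_const).meromorphicAt.inv
  exact (meromorphicOrderAt_eq_int_iff h).mpr ⟨fun _ => 1, analyticAt_const, one_ne_zero, by simp⟩

theorem HasResidue.order_eq (hf : HasResidue f s v) : ∃ g : ℂ → ℂ, AnalyticAt ℂ g s ∧ g s = v ∧
    meromorphicOrderAt f s = ((-1 : ℤ) : WithTop ℤ) + meromorphicOrderAt g s := by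
  obtain ⟨g, hg, hv, he⟩ := hf.exists_analytic
  refine ⟨g, hg, hv, ?_⟩
  rw [meromorphicOrderAt_congr he, ← meromorphicOrderAt_inv_sub s]
  exact meromorphicOrderAt_mul (f := fun z : ℂ => (z - s)⁻¹)
    (analyticAt_id.sub analyticAt_const).meromorphicAt.inv hg.meromorphicAt

theorem HasResidue.neg_one_le_order (hf : HasResidue f s v) :
    ((-1 : ℤ) : WithTop ℤ) ≤ meromorphicOrderAt f s := by
  obtain ⟨g, hg, -, he⟩ := hf.order_eq
  rw [he]
  exact le_add_of_nonneg_right hg.meromorphicOrderAt_nonneg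

theorem HasResidue.order_neg (hf : HasResidue f s v) (hv : v ≠ 0) : meromorphicOrderAt f s < 0 := by
  obtain ⟨g, hg, hgs, he⟩ := hf.order_eq
  have h0 : meromorphicOrderAt g s = 0 :=
    (tendsto_ne_zero_iff_meromorphicOrderAt_eq_zero hg.meromorphicAt).mp
      ⟨v, hv, hgs ▸ hg.continuousAt.tendsto.mono_left nhdsWithin_le_nhds⟩
  rw [he, h0, add_zero]
  exact WithTop.coe_lt_coe.mpr (by norm_num)

/-- Two meromorphic functions on `ℂ` that agree on a right half plane agree near every point, up to
the point itself. -/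
theorem eventuallyEq_of_eq_on_halfPlane (hf : MeromorphicOn f Set.univ)
    (hg : MeromorphicOn g Set.univ) {p : ℝ} (h : ∀ z : ℂ, p < z.re → f z = g z) (s : ℂ) :
    f =ᶠ[𝓝[≠] s] g := by
  have hm : MeromorphicOn (f - g) Set.univ := hf.sub hg
  have htop : meromorphicOrderAt (f - g) ((p : ℂ) + 1) = ⊤ := by
    rw [meromorphicOrderAt_eq_top_iff]
    have : {z : ℂ | p < z.re} ∈ 𝓝 ((p : ℂ) + 1) :=
      (isOpen_lt continuous_const Complex.continuous_re).mem_nhds (by simp)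
    filter_upwards [mem_nhdsWithin_of_mem_nhds this] with z hz
    rw [Pi.sub_apply, h z hz, sub_self]
  have hs : meromorphicOrderAt (f - g) s = ⊤ := by
    by_contra hne
    exact hm.meromorphicOrderAt_ne_top_of_isPreconnected isPreconnected_univ (Set.mem_univ s)
      (Set.mem_univ _) hne htop
  rw [meromorphicOrderAt_eq_top_iff] at hs
  filter_upwards [hs] with z hz
  exact sub_eq_zero.mp hz

end SimplePole

/-! ### Dirichlet series over the eigenvalues of `|D|` -/

section LevelSeries

/-- The eigenvalue `N + 3/2` of `|D|`. -/
def level (N : ℕ) : ℝ := N + 3 / 2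

theorem level_pos (N : ℕ) : 0 < level N := by unfold level; positivity

theorem one_le_level (N : ℕ) : 1 ≤ level N := by
  have : (0 : ℝ) ≤ N := N.cast_nonneg
  unfold level; linarith

theorem norm_level_cpow (N : ℕ) (z : ℂ) : ‖(level N : ℂ) ^ z‖ = level N ^ z.re :=
  Complex.norm_cpow_eq_rpow_re_of_pos (level_pos N) z

theorem level_ne_zero (N : ℕ) : (level N : ℂ) ≠ 0 := by exact_mod_cast (level_pos N).ne'

/-- Sequences that decay faster than every power of the eigenvalue. -/
def RapidDecay (e : ℕ → ℂ) : Prop := ∀ M : ℕ, Summable fun N : ℕ => ‖e N‖ * level N ^ M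

theorem RapidDecay.add {e e' : ℕ → ℂ} (h : RapidDecay e) (h' : RapidDecay e') :
    RapidDecay fun N => e N + e' N := by
  intro M
  refine Summable.of_nonneg_of_le (fun N => ?_) (fun N => ?_) ((h M).add (h' M))
  · have := (level_pos N).le; positivity
  · rw [← add_mul]
    exact mul_le_mul_of_nonneg_right (norm_add_le _ _) (pow_nonneg (level_pos N).le _)

theorem RapidDecay.mono {e e' : ℕ → ℂ} (h : RapidDecay e) (K : ℝ) (m : ℕ)
    (hK : ∀ N, ‖e' N‖ ≤ K * level N ^ m * ‖e N‖) : RapidDecay e' := by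
  intro M
  refine Summable.of_nonneg_of_le (fun N => ?_) (fun N => ?_) ((h (m + M)).mul_left K)
  · have := (level_pos N).le; positivity
  · have hl := pow_nonneg (level_pos N).le M
    calc ‖e' N‖ * level N ^ M ≤ K * level N ^ m * ‖e N‖ * level N ^ M :=
          mul_le_mul_of_nonneg_right (hK N) hl
      _ = K * (‖e N‖ * level N ^ (m + M)) := by rw [pow_add]; ring

theorem rapidDecay_zero : RapidDecay fun _ => 0 := fun M => by simp

theorem rapidDecay_geometric {r : ℝ} (h0 : 0 < r) (h1 : r < 1) :
    RapidDecay fun N => ((r ^ N : ℝ) : ℂ) := by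
  intro M
  have hs : Summable fun n : ℕ => (n : ℝ) ^ M * r ^ n :=
    summable_pow_mul_geometric_of_norm_lt_one M (by rwa [Real.norm_of_nonneg h0.le])
  have hs2 := ((summable_nat_add_iff 2).mpr hs).mul_left (r ^ 2)⁻¹
  refine Summable.of_nonneg_of_le (fun N => ?_) (fun N => ?_) hs2
  · have := (level_pos N).le; positivity
  · have hl : level N ^ M ≤ ((N + 2 : ℕ) : ℝ) ^ M := by
      refine pow_le_pow_left₀ (level_pos N).le ?_ M
      unfold level; push_cast; linarith
    have hr : 0 < r ^ N := pow_pos h0 N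
    rw [Complex.norm_real, Real.norm_of_nonneg hr.le, pow_add]
    calc r ^ N * level N ^ M ≤ r ^ N * ((N + 2 : ℕ) : ℝ) ^ M :=
          mul_le_mul_of_nonneg_left hl hr.le
      _ = _ := by field_simp

theorem RapidDecay.bound {e : ℕ → ℂ} {z : ℂ} {M : ℕ} (hz : -(M : ℝ) ≤ z.re) (N : ℕ) :
    ‖e N * (level N : ℂ) ^ (-z)‖ ≤ ‖e N‖ * level N ^ M := by
  rw [norm_mul, norm_level_cpow, ← Real.rpow_natCast]
  refine mul_le_mul_of_nonneg_left ?_ (norm_nonneg _)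
  exact Real.rpow_le_rpow_of_exponent_le (one_le_level N) (by rw [Complex.neg_re]; linarith)

theorem RapidDecay.summable {e : ℕ → ℂ} (h : RapidDecay e) (z : ℂ) :
    Summable fun N => e N * (level N : ℂ) ^ (-z) := by
  obtain ⟨M, hM⟩ := exists_nat_ge (-z.re)
  exact Summable.of_norm_bounded (h M) (RapidDecay.bound (by linarith))

/-- The Dirichlet series of a rapidly decaying sequence converges uniformly on every right half plane
and is therefore entire. -/
theorem RapidDecay.differentiable {e : ℕ → ℂ} (h : RapidDecay e) :
    Differentiable ℂ fun z : ℂ => ∑' N, e N * (level N : ℂ) ^ (-z) := by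
  intro z
  obtain ⟨M, hM⟩ := exists_nat_gt (-z.re)
  have hU : IsOpen {w : ℂ | -(M : ℝ) < w.re} := isOpen_lt continuous_const Complex.continuous_re
  refine (Complex.differentiableOn_tsum_of_summable_norm (h M) (fun N => ?_) hU
    (fun N w hw => RapidDecay.bound (le_of_lt hw) N)).differentiableAt
    (hU.mem_nhds (show -(M : ℝ) < z.re by linarith))
  refine Differentiable.differentiableOn fun w => ?_
  exact ((differentiableAt_id.neg).const_cpow (.inl (level_ne_zero N))).const_mul (e N)

/-- The meromorphic function `Σ_N (N + 3/2)^{-z}`, `N ≥ 0`: the Hurwitz zeta function at `1/2` without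
its first term. -/
def levelZeta (z : ℂ) : ℂ := HurwitzZeta.hurwitzZeta ((1 / 2 : ℝ) : UnitAddCircle) z -
  ((1 / 2 : ℝ) : ℂ) ^ (-z)

theorem hasSum_levelZeta {z : ℂ} (hz : 1 < z.re) :
    HasSum (fun N => (level N : ℂ) ^ (-z)) (levelZeta z) := by
  have h := HurwitzZeta.hasSum_hurwitzZeta_of_one_lt_re (a := 1 / 2) ⟨by norm_num, by norm_num⟩ hz
  rw [← hasSum_nat_add_iff' 1] at h
  simp only [Finset.range_one, Finset.sum_singleton, Nat.cast_zero, zero_add] at h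
  rw [levelZeta, Complex.cpow_neg, ← one_div]
  refine (congrArg (HasSum · _) (funext fun N => ?_)).mp h
  rw [Complex.cpow_neg, ← one_div]
  congr 2
  rw [level]
  push_cast
  ring

theorem hasResidue_levelZeta (s : ℂ) : HasResidue levelZeta s (if s = 1 then 1 else 0) := by
  have hd : ∀ z : ℂ, z ≠ 1 → DifferentiableAt ℂ levelZeta z := fun z hz =>
    (HurwitzZeta.differentiableAt_hurwitzZeta _ hz).sub
      ((differentiableAt_id.neg).const_cpow (.inl (by norm_num)))
  have hd' : ∀ᶠ z in 𝓝[≠] s, DifferentiableAt ℂ levelZeta z := by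
    have : ∀ᶠ z in 𝓝[≠] s, z ≠ 1 := by
      by_cases h : s = 1
      · subst h; exact self_mem_nhdsWithin
      · exact mem_nhdsWithin_of_mem_nhds (isOpen_ne.mem_nhds h)
    filter_upwards [this] with z hz using hd z hz
  by_cases h : s = 1
  · subst h
    rw [if_pos rfl]
    refine ⟨hd', ?_⟩
    have h1 := HurwitzZeta.hurwitzZeta_residue_one ((1 / 2 : ℝ) : UnitAddCircle)
    have h2 : HasResidue (fun z : ℂ => ((1 / 2 : ℝ) : ℂ) ^ (-z)) 1 0 :=
      Differentiable.hasResidue (fun z => (differentiableAt_id.neg).const_cpow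
        (.inl (by norm_num))) 1
    have := h1.sub h2.2
    rw [sub_zero] at this
    exact this.congr fun z => by rw [levelZeta]; ring
  · rw [if_neg h]
    exact hasResidue_zero hd' (hd s h).continuousAt

/-- The function `Σ_N (A λ_N² + B λ_N + C + e_N) λ_N^{-z}` with `λ_N = N + 3/2`. -/
def levelSeries (A B C : ℂ) (e : ℕ → ℂ) (z : ℂ) : ℂ :=
  A * levelZeta (z + -2) + B * levelZeta (z + -1) + C * levelZeta z +
    ∑' N, e N * (level N : ℂ) ^ (-z)

theorem hasResidue_levelSeries (A B C : ℂ) {e : ℕ → ℂ} (he : RapidDecay e) (s : ℂ) :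
    HasResidue (levelSeries A B C e) s (A * (if s + -2 = 1 then 1 else 0) +
      B * (if s + -1 = 1 then 1 else 0) + C * (if s = 1 then 1 else 0) + 0) :=
  ((((hasResidue_levelZeta (s + -2)).comp_add.const_mul A).add
    ((hasResidue_levelZeta (s + -1)).comp_add.const_mul B)).add
    ((hasResidue_levelZeta s).const_mul C)).add (he.differentiable.hasResidue s)

theorem hasSum_levelSeries (A B C : ℂ) {e : ℕ → ℂ} (he : RapidDecay e) {z : ℂ} (hz : 3 < z.re) :
    HasSum (fun N => (A * level N ^ 2 + B * level N + C + e N) * (level N : ℂ) ^ (-z))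
      (levelSeries A B C e z) := by
  have h2 := (hasSum_levelZeta (z := z + -2) (by simp; linarith)).mul_left A
  have h1 := (hasSum_levelZeta (z := z + -1) (by simp; linarith)).mul_left B
  have h0 := (hasSum_levelZeta (z := z) (by linarith)).mul_left C
  refine (congrArg (HasSum · _) (funext fun N => ?_)).mp
    (((h2.add h1).add h0).add (he.summable z).hasSum)
  have hl := level_ne_zero N
  have e2 : (level N : ℂ) ^ (-(z + -2)) = (level N : ℂ) ^ 2 * (level N : ℂ) ^ (-z) := by
    rw [show -(z + -2) = ((2 : ℕ) : ℂ) + -z by push_cast; ring, Complex.cpow_add _ _ hl,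
      Complex.cpow_natCast]
  have e1 : (level N : ℂ) ^ (-(z + -1)) = level N * (level N : ℂ) ^ (-z) := by
    rw [show -(z + -1) = 1 + -z by ring, Complex.cpow_add _ _ hl, Complex.cpow_one]
  rw [e1, e2]
  ring

end LevelSeries

/-! ### The coefficient of `u⁰` -/

section RestrictLinear
variable {A : Type*} [Ring A] [Algebra ℂ A]

theorem restrictZero_add (s t : A ⊗[ℂ] ℂ[T;T⁻¹]) :
    restrictZero (s + t) = restrictZero s + restrictZero t := by
  simp only [restrictZero, map_add]

theorem restrictZero_zero : restrictZero (0 : A ⊗[ℂ] ℂ[T;T⁻¹]) = 0 := by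
  simp only [restrictZero, map_zero]

theorem restrictZero_tmul_C_mul_T (x : A) (c : ℂ) (m : ℤ) :
    restrictZero (x ⊗ₜ[ℂ] (LaurentPolynomial.C c * LaurentPolynomial.T m : ℂ[T;T⁻¹])) =
      if m = 0 then c • x else 0 := by
  rw [← LaurentPolynomial.smul_eq_C_mul, TensorProduct.tmul_smul, TensorProduct.smul_tmul',
    restrictZero_tmul_T]

theorem tensorFun_restrictZero {B : Type*} [Ring B] [Algebra ℂ B] (f : A →ₗ[ℂ] ℂ) (g : B →ₗ[ℂ] ℂ)
    (a : A) (b : B) (c : ℂ) (m : ℤ) :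
    tensorFun f g (restrictZero ((a ⊗ₜ[ℂ] b) ⊗ₜ[ℂ]
      (LaurentPolynomial.C c * LaurentPolynomial.T m : ℂ[T;T⁻¹]))) =
      f a * g b * (LaurentPolynomial.C c * LaurentPolynomial.T m : ℂ[T;T⁻¹]).coeff 0 := by
  rw [restrictZero_tmul_C_mul_T, ← LaurentPolynomial.single_eq_C_mul_T]
  by_cases h : m = 0
  · simp [h, -LaurentPolynomial.single_eq_C_mul_T, mul_comm]
  · simp [h, -LaurentPolynomial.single_eq_C_mul_T]

theorem tensorFun_restrictZero_add {B : Type*} [Ring B] [Algebra ℂ B] (f : A →ₗ[ℂ] ℂ)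
    (g : B →ₗ[ℂ] ℂ) (s t : (A ⊗[ℂ] B) ⊗[ℂ] ℂ[T;T⁻¹]) :
    tensorFun f g (restrictZero (s + t)) =
      tensorFun f g (restrictZero s) + tensorFun f g (restrictZero t) := by
  rw [restrictZero_add, map_add]

theorem tensorFun_restrictZero_zero {B : Type*} [Ring B] [Algebra ℂ B] (f : A →ₗ[ℂ] ℂ)
    (g : B →ₗ[ℂ] ℂ) :
    tensorFun f g (restrictZero (0 : (A ⊗[ℂ] B) ⊗[ℂ] ℂ[T;T⁻¹])) = 0 := by
  rw [restrictZero_zero, map_zero]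

end RestrictLinear

/-! ### Asymptotics of truncated traces -/

section TruncatedTraces
variable {q : Set.Ioo (0 : ℝ) 1}

theorem RapidDecay.mul_of_le {e g : ℕ → ℂ} (h : RapidDecay e) (K : ℝ)
    (hg : ∀ N, ‖g N‖ ≤ K * level N) : RapidDecay fun N => e N * g N := by
  refine h.mono K 1 fun N => ?_
  rw [norm_mul, pow_one, mul_comm]
  exact mul_le_mul_of_nonneg_right (hg N) (norm_nonneg _)

theorem RapidDecay.exists_bound {e : ℕ → ℂ} (h : RapidDecay e) : ∃ K : ℝ, ∀ N, ‖e N‖ ≤ K := by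
  have hs := h 0
  simp only [pow_zero, mul_one] at hs
  exact ⟨_, fun N => hs.le_tsum N fun _ _ => norm_nonneg _⟩

/-- Products of asymptotically affine sequences are asymptotically quadratic. -/
theorem RapidDecay.mul_affine {t t' : ℕ → ℂ} {α β α' β' : ℂ}
    (h : RapidDecay fun N => t N - (level N * α + β))
    (h' : RapidDecay fun N => t' N - (level N * α' + β')) :
    RapidDecay fun N => t N * t' N -
      (α * α' * level N ^ 2 + (α * β' + β * α') * level N + β * β') := by
  have haff : ∀ (γ δ : ℂ) (N : ℕ), ‖level N * γ + δ‖ ≤ (‖γ‖ + ‖δ‖) * level N := by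
    intro γ δ N
    have hl := one_le_level N
    refine (norm_add_le _ _).trans ?_
    rw [norm_mul, Complex.norm_real, Real.norm_of_nonneg (level_pos N).le, add_mul, mul_comm]
    gcongr
    exact le_mul_of_one_le_right (norm_nonneg _) hl
  obtain ⟨K, hK⟩ := h'.exists_bound
  have h1 := h.mul_of_le (g := t') (K + (‖α'‖ + ‖β'‖)) fun N => by
    have hl := one_le_level N
    have hK0 := (norm_nonneg _).trans (hK N)
    calc ‖t' N‖ = ‖(t' N - (level N * α' + β')) + (level N * α' + β')‖ := by rw [sub_add_cancel]
      _ ≤ K * level N + (‖α'‖ + ‖β'‖) * level N :=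
        (norm_add_le _ _).trans (add_le_add ((hK N).trans (le_mul_of_one_le_right hK0 hl))
          (haff _ _ _))
      _ = _ := by ring
  have h2 := h'.mul_of_le _ (haff α β)
  refine (h1.add h2).mono 1 0 fun N => ?_
  rw [pow_zero, one_mul, one_mul]
  refine le_of_eq (congrArg norm ?_)
  ring

theorem truncTrace_eq_sum {ε : ℤˣ} (N : ℕ) (a : disk q ε) :
    truncTrace N a = ∑ k ∈ Finset.range (N + 1), diskCoeff k k a := by
  refine Finset.sum_congr rfl fun k _ => ?_
  rw [inner_ket, diskCoeff_apply, intKet_natCast]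

/-- The limit that defines `τ₀` is approached exponentially fast, since consecutive terms differ by
the distance from a diagonal entry to the constant coefficient of the symbol. -/
theorem exists_truncTrace_bound {ε : ℤˣ} (c : ℂ) (a : disk q ε) : ∃ K : ℝ, ∀ N : ℕ,
    ‖truncTrace N a - ((N + c) * tau1 q ε a + tau0 q ε c a)‖ ≤ K * (q : ℝ) ^ N := by
  obtain ⟨C, hC, h⟩ := (isAsymptotic_symbol a).coeff_bound 0
  have h0 := q.2.1
  have h1 := q.2.2
  have hstep : ∀ n : ℕ, dist (truncTrace n a - (n + c) * tau1 q ε a)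
      (truncTrace (n + 1) a - ((n + 1 : ℕ) + c) * tau1 q ε a) ≤ C * (q : ℝ) ^ n := by
    intro n
    have h' := h ((n + 1 : ℕ) : ℤ) (by omega)
    rw [add_zero, intKet_natCast, Int.toNat_natCast, zpow_natCast] at h'
    rw [dist_comm, dist_eq_norm]
    have e : truncTrace (n + 1) a = truncTrace n a +
        (a : ℓ²(ℕ, ℂ) →L[ℂ] ℓ²(ℕ, ℂ)) (ket (n + 1)) (n + 1) := by
      rw [truncTrace, Finset.sum_range_succ, inner_ket]; rfl
    calc _ = ‖(a : ℓ²(ℕ, ℂ) →L[ℂ] ℓ²(ℕ, ℂ)) (ket (n + 1)) (n + 1) - (symbol q ε a).coeff 0‖ := by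
          rw [e]
          congr 1
          change _ = _ - tau1 q ε a
          push_cast
          ring
      _ ≤ C * (q : ℝ) ^ (n + 1) := h'
      _ ≤ C * (q : ℝ) ^ n :=
        mul_le_mul_of_nonneg_left (pow_le_pow_of_le_one h0.le h1.le (by omega)) hC
  refine ⟨C / (1 - q), fun N => ?_⟩
  have := dist_le_of_le_geometric_of_tendsto (q : ℝ) C h1 hstep (tendsto_tau0 q ε c a) N
  rw [dist_eq_norm, sub_sub] at this
  rwa [div_mul_eq_mul_div]

/-- `Tr_{N+d} = λ τ₁ + τ₀` up to a rapidly decaying error, where `λ = N + 3/2` and `τ₀` is normalised by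
the constant `c = 3/2 - d`. -/
theorem rapidDecay_truncTrace {ε : ℤˣ} (c : ℂ) (d : ℕ) (hd : c + d = 3 / 2) (a : disk q ε) :
    RapidDecay fun N => truncTrace (N + d) a - (level N * tau1 q ε a + tau0 q ε c a) := by
  obtain ⟨K, hK⟩ := exists_truncTrace_bound c a
  have h0 := q.2.1
  have h1 := q.2.2
  refine (rapidDecay_geometric h0 h1).mono K 0 fun N => ?_
  have hK0 : 0 ≤ K := by
    have := (norm_nonneg _).trans (hK 0)
    simpa using this
  have e : (level N : ℂ) = ((N + d : ℕ) : ℂ) + c := by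
    rw [level]; push_cast; rw [← hd]; ring
  rw [e, pow_zero, mul_one, Complex.norm_real, Real.norm_of_nonneg (pow_nonneg h0.le N)]
  exact (hK (N + d)).trans
    (mul_le_mul_of_nonneg_left (pow_le_pow_of_le_one h0.le h1.le (by omega)) hK0)

theorem rapidDecay_of_tmul {A B : Type*} [AddCommGroup A] [AddCommGroup B] [Module ℂ A] [Module ℂ B]
    (L : ℕ → A ⊗[ℂ] B →ₗ[ℂ] ℂ) (h : ∀ a b, RapidDecay fun N => L N (a ⊗ₜ[ℂ] b)) (w : A ⊗[ℂ] B) :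
    RapidDecay fun N => L N w := by
  induction w using TensorProduct.induction_on with
  | zero => simpa using rapidDecay_zero
  | tmul a b => exact h a b
  | add u v hu hv => simpa only [map_add] using hu.add hv

/-- The partial traces of a tensor product of two families with affine partial traces are
quadratic up to rapidly decaying errors. -/
theorem rapidDecay_tensor {A B : Type*} [AddCommGroup A] [AddCommGroup B] [Module ℂ A] [Module ℂ B]
    {f : ℕ → A →ₗ[ℂ] ℂ} {g : ℕ → B →ₗ[ℂ] ℂ} {M M' : ℕ → ℕ} {α β : A →ₗ[ℂ] ℂ} {α' β' : B →ₗ[ℂ] ℂ}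
    (hf : ∀ a, RapidDecay fun N => ∑ x ∈ Finset.range (M N), f x a - (level N * α a + β a))
    (hg : ∀ b, RapidDecay fun N => ∑ y ∈ Finset.range (M' N), g y b - (level N * α' b + β' b))
    (w : A ⊗[ℂ] B) :
    RapidDecay fun N => ∑ x ∈ Finset.range (M N), ∑ y ∈ Finset.range (M' N), tensorFun (f x) (g y) w -
      (tensorFun α α' w * level N ^ 2 + (tensorFun α β' + tensorFun β α') w * level N +
        tensorFun β β' w) := by
  have := rapidDecay_of_tmul (fun N => ∑ x ∈ Finset.range (M N), ∑ y ∈ Finset.range (M' N),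
      tensorFun (f x) (g y) - ((level N : ℂ) ^ 2 • tensorFun α α' +
        (level N : ℂ) • (tensorFun α β' + tensorFun β α') + tensorFun β β')) (fun a b => ?_) w
  · refine this.mono 1 0 fun N => ?_
    rw [pow_zero, one_mul, one_mul]
    refine le_of_eq (congrArg norm ?_)
    simp only [LinearMap.sub_apply, LinearMap.add_apply, LinearMap.smul_apply, smul_eq_mul,
      LinearMap.sum_apply]
    ring
  · refine ((hf a).mul_affine (hg b)).mono 1 0 fun N => ?_
    rw [pow_zero, one_mul, one_mul]
    refine le_of_eq (congrArg norm ?_)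
    simp only [LinearMap.sub_apply, LinearMap.add_apply, LinearMap.smul_apply, smul_eq_mul,
      LinearMap.sum_apply, tensorFun_tmul, Finset.sum_mul_sum]
    ring

theorem rapidDecay_sum_diskCoeff {ε : ℤˣ} {c : ℂ} {d : ℕ} (hd : c + d = 3 / 2) (a : disk q ε) :
    RapidDecay fun N => ∑ x ∈ Finset.range (N + d + 1), diskCoeff x x a -
      (level N * tau1 q ε a + tau0 q ε c a) := by
  simpa only [truncTrace_eq_sum] using rapidDecay_truncTrace c d hd a

theorem rapidDecay_blockTrace {c c' : ℂ} {d d' : ℕ} (hd : c + d = 3 / 2) (hd' : c' + d' = 3 / 2)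
    (w : disk q 1 ⊗[ℂ] disk q (-1)) :
    RapidDecay fun N => ∑ x ∈ Finset.range (N + d + 1), ∑ y ∈ Finset.range (N + d' + 1),
        tensorFun (diskCoeff x x) (diskCoeff y y) w -
      (tensorFunctional (tau1 q 1) (tau1 q (-1)) w * level N ^ 2 +
        (tensorFunctional (tau1 q 1) (tau0 q (-1) c') + tensorFunctional (tau0 q 1 c) (tau1 q (-1))) w
          * level N + tensorFunctional (tau0 q 1 c) (tau0 q (-1) c') w) :=
  rapidDecay_tensor (rapidDecay_sum_diskCoeff hd) (rapidDecay_sum_diskCoeff hd') w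

/-- The diagonal coefficients of degree zero depend only on the coefficient of `u⁰`. -/
theorem symbolCoeff_diag (x y : ℕ) (σ : SymbolAlgebra q) :
    symbolCoeff x y x y 0 σ = tensorFun (diskCoeff x x) (diskCoeff y y) (restrictZero σ) := by
  induction σ using symbol_induction with
  | h0 => exact (symbolCoeff_zero _ _ _ _ _).trans (tensorFun_restrictZero_zero _ _).symm
  | hadd σ τ h h' =>
    exact ((symbolCoeff_add _ _ _ _ _ σ τ).trans (congrArg₂ (· + ·) h h')).trans
      (tensorFun_restrictZero_add _ _ σ τ).symm
  | htmul a b c k =>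
    exact (symbolCoeff_tmul _ _ _ _ _ _ _ _).trans (tensorFun_restrictZero _ _ a b c k).symm

end TruncatedTraces

/-! ### The eigenspaces of `|D|` -/

section Levels

/-- The kets with eigenvalue `N + 3/2` of `|D|`: the up kets with `2j = N` and the down kets with
`2j = N + 1`. -/
abbrev LevelIndex (N : ℕ) : Type := (Fin (N + 1) × Fin (N + 2)) ⊕ (Fin (N + 2) × Fin (N + 1))

/-- The up kets with `2j = N`. -/
def levelUp (N : ℕ) (i : Fin (N + 1) × Fin (N + 2)) : SpinIndex :=
  ⟨N, i.1, i.2, 0, Nat.lt_succ_iff.mp i.1.2, by rw [if_pos rfl]; exact i.2.2⟩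

/-- The down kets with `2j = N + 1`. -/
def levelDn (N : ℕ) (i : Fin (N + 2) × Fin (N + 1)) : SpinIndex :=
  ⟨N + 1, i.1, i.2, 1, Nat.lt_succ_iff.mp i.1.2, by rw [if_neg (by decide)]; exact i.2.2⟩

/-- The ket with a given label among those with eigenvalue `N + 3/2` of `|D|`. -/
def levelKet (i : Σ N, LevelIndex N) : SpinIndex := Sum.elim (levelUp i.1) (levelDn i.1) i.2

theorem levelKet_bijective : Function.Bijective levelKet := by
  constructor
  · rintro ⟨N, ⟨x, y⟩ | ⟨x, y⟩⟩ ⟨N', ⟨x', y'⟩ | ⟨x', y'⟩⟩ h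
    · simp only [levelKet, Sum.elim_inl, levelUp, SpinIndex.mk.injEq, and_true] at h
      obtain ⟨rfl, hx, hy⟩ := h
      rw [Fin.ext hx, Fin.ext hy]
    · simp [levelKet, levelUp, levelDn] at h
    · simp [levelKet, levelUp, levelDn] at h
    · simp only [levelKet, Sum.elim_inr, levelDn, SpinIndex.mk.injEq, and_true] at h
      obtain ⟨hN, hx, hy⟩ := h
      obtain rfl : N = N' := Nat.succ_injective hN
      rw [Fin.ext hx, Fin.ext hy]
  · rintro ⟨N, x, y, s, hx, hy⟩
    rcases fin_two_cases s with rfl | rfl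
    · exact ⟨⟨N, .inl (⟨x, by omega⟩, ⟨y, by simpa using hy⟩)⟩, rfl⟩
    · have hy' : y < N := by simpa using hy
      obtain ⟨M, rfl⟩ : ∃ M, N = M + 1 := ⟨N - 1, by omega⟩
      exact ⟨⟨M, .inr (⟨x, by omega⟩, ⟨y, hy'⟩)⟩, rfl⟩

/-- The kets, grouped by the eigenvalue of `|D|`. -/
def levelEquiv : (Σ N, LevelIndex N) ≃ SpinIndex := Equiv.ofBijective _ levelKet_bijective

theorem abs_diracEigenvalue_levelEquiv (N : ℕ) (i : LevelIndex N) :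
    |diracEigenvalue (levelEquiv ⟨N, i⟩)| = level N := by
  change |diracEigenvalue (levelKet ⟨N, i⟩)| = level N
  rw [abs_diracEigenvalue]
  rcases i with i | i
  · simp [levelKet, levelUp, spinOffset, level]; ring
  · simp [levelKet, levelDn, spinOffset, level]; ring

theorem card_levelIndex (N : ℕ) : (Fintype.card (LevelIndex N) : ℝ) ≤ 2 * level N ^ 2 := by
  simp [level]
  nlinarith

theorem summable_absEigenvalue_rpow {a : ℝ} (ha : 3 < a) :
    Summable fun k : SpinIndex => |diracEigenvalue k| ^ (-a) := by
  rw [← levelEquiv.summable_iff, summable_sigma_of_nonneg fun i => by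
    simp only [Function.comp]; positivity]
  refine ⟨fun N => (hasSum_fintype _).summable, ?_⟩
  have hs : Summable fun N : ℕ => 2 * (1 / |(N : ℝ) + 3 / 2| ^ (a - 2)) :=
    ((Real.summable_one_div_nat_add_rpow (3 / 2) (a - 2)).mpr (by linarith)).mul_left 2
  refine Summable.of_nonneg_of_le (fun N => ?_) (fun N => ?_) hs
  · exact tsum_nonneg fun i => by simp only [Function.comp]; positivity
  · have hl := level_pos N
    simp only [Function.comp, abs_diracEigenvalue_levelEquiv, tsum_fintype, Finset.sum_const,
      Finset.card_univ, nsmul_eq_mul]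
    calc (Fintype.card (LevelIndex N) : ℝ) * level N ^ (-a) ≤ 2 * level N ^ 2 * level N ^ (-a) :=
          mul_le_mul_of_nonneg_right (card_levelIndex N) (by positivity)
      _ = 2 * (1 / level N ^ (a - 2)) := by
          rw [one_div, ← Real.rpow_neg hl.le, show -(a - 2) = ((2 : ℕ) : ℝ) + -a by push_cast; ring,
            Real.rpow_add hl, Real.rpow_natCast, mul_assoc]
      _ = _ := by rw [← abs_of_pos hl]; rfl

end Levels

/-! ### Complex powers and trace class -/

section AbsPow
variable {ι : Type*} {lam : ι → ℝ}

theorem absPow_ket (hlam : ∀ i, 1 ≤ |lam i|) {w : ℂ} (hw : w.re ≤ 0) (l : ι) :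
    absPow lam w (ket l) = ((|lam l| : ℝ) : ℂ) ^ w • ket l := by
  apply lp.ext
  funext k
  rw [hasMatrix_absPow hlam hw k l]
  by_cases h : k = l
  · subst h; simp [ket_apply_self]
  · simp [h, ket_apply_ne h]

theorem absPow_mul (hlam : ∀ i, 1 ≤ |lam i|) {u v : ℂ} (hu : u.re ≤ 0) (hv : v.re ≤ 0) :
    absPow lam u * absPow lam v = absPow lam (u + v) := by
  refine clm_ext_ket fun l => ?_
  have hl : ((|lam l| : ℝ) : ℂ) ≠ 0 := by
    exact_mod_cast (zero_lt_one.trans_le (hlam l)).ne'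
  rw [mul_apply_eq_comp, absPow_ket hlam hv, map_smul, absPow_ket hlam hu,
    absPow_ket hlam (by simp; linarith), smul_smul, Complex.cpow_add _ _ hl, mul_comm]

theorem isHilbertSchmidt_mul_absPow (hlam : ∀ i, 1 ≤ |lam i|) {a : ℝ}
    (hs : Summable fun i => |lam i| ^ (-a)) (T : ℓ²(ι, ℂ) →L[ℂ] ℓ²(ι, ℂ)) {w : ℂ} (hw : w.re ≤ 0)
    (ha : w.re + w.re = -a) : IsHilbertSchmidt (T * absPow lam w) := by
  refine Summable.of_nonneg_of_le (fun _ => by positivity) (fun i => ?_) (hs.mul_left (‖T‖ ^ 2))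
  have hi := zero_lt_one.trans_le (hlam i)
  rw [mul_apply_eq_comp, absPow_ket hlam hw, map_smul, norm_smul, mul_pow, mul_comm,
    Complex.norm_cpow_eq_rpow_re_of_pos hi, ← ha, Real.rpow_add hi, ← pow_two]
  have hT : ‖T (ket i)‖ ≤ ‖T‖ := (T.le_opNorm _).trans (by rw [norm_ket, mul_one])
  gcongr

/-- `T |D|^{-z}` is the product of the Hilbert-Schmidt operators `T |D|^{-z/2}` and `|D|^{-z/2}`. -/
theorem isTraceClass_mul_absPow (hlam : ∀ i, 1 ≤ |lam i|) {z : ℂ}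
    (hs : Summable fun i => |lam i| ^ (-z.re)) (hz : 0 ≤ z.re) (T : ℓ²(ι, ℂ) →L[ℂ] ℓ²(ι, ℂ)) :
    IsTraceClass (T * absPow lam (-z)) := by
  have hre : (-(z / 2)).re = -(z.re / 2) := by simp
  have hw : (-(z / 2)).re ≤ 0 := by rw [hre]; linarith
  refine ⟨T * absPow lam (-(z / 2)), 1 * absPow lam (-(z / 2)),
    isHilbertSchmidt_mul_absPow hlam hs T hw (by rw [hre]; ring),
    isHilbertSchmidt_mul_absPow hlam hs 1 hw (by rw [hre]; ring), ?_⟩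
  rw [one_mul, mul_assoc, absPow_mul hlam hw hw]
  congr 2
  ring

theorem inner_ket_mul_absPow (hlam : ∀ i, 1 ≤ |lam i|) {w : ℂ} (hw : w.re ≤ 0)
    (T : ℓ²(ι, ℂ) →L[ℂ] ℓ²(ι, ℂ)) (i : ι) :
    ⟪ket i, (T * absPow lam w) (ket i)⟫_ℂ = T (ket i) i * ((|lam i| : ℝ) : ℂ) ^ w := by
  rw [inner_ket, mul_apply_eq_comp, absPow_ket hlam hw, map_smul, lp.coeFn_smul, Pi.smul_apply,
    smul_eq_mul, mul_comm]

theorem norm_entry_le (T : ℓ²(ι, ℂ) →L[ℂ] ℓ²(ι, ℂ)) (i : ι) : ‖T (ket i) i‖ ≤ ‖T‖ :=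
  (lp.norm_apply_le_norm (by simp) _ i).trans ((T.le_opNorm _).trans (by rw [norm_ket, mul_one]))

theorem hasSum_trace (hlam : ∀ i, 1 ≤ |lam i|) {z : ℂ} (hs : Summable fun i => |lam i| ^ (-z.re))
    (hz : 0 ≤ z.re) (T : ℓ²(ι, ℂ) →L[ℂ] ℓ²(ι, ℂ)) :
    HasSum (fun i => T (ket i) i * ((|lam i| : ℝ) : ℂ) ^ (-z)) (trace (T * absPow lam (-z))) := by
  have hw : (-z).re ≤ 0 := by rw [Complex.neg_re]; linarith
  simp only [trace, inner_ket_mul_absPow hlam hw]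
  refine (Summable.of_norm_bounded (hs.mul_left ‖T‖) fun i => ?_).hasSum
  rw [norm_mul, Complex.norm_cpow_eq_rpow_re_of_pos (zero_lt_one.trans_le (hlam i)), Complex.neg_re]
  exact mul_le_mul_of_nonneg_right (norm_entry_le T i) (by positivity)

end AbsPow

/-! ### Zeta functions -/

section Zeta
variable {q : Set.Ioo (0 : ℝ) 1} {T : SpinOp}

/-- The trace of `T` over the eigenspace of `|D|` with eigenvalue `N + 3/2`. -/
def levelTrace (T : SpinOp) (N : ℕ) : ℂ :=
  ∑ i : LevelIndex N, T (ket (levelEquiv ⟨N, i⟩)) (levelEquiv ⟨N, i⟩)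

theorem hasSum_levelTrace (T : SpinOp) {z : ℂ} (hz : 3 < z.re) :
    HasSum (fun N => levelTrace T N * (level N : ℂ) ^ (-z))
      (trace (T * absPow diracEigenvalue (-z))) := by
  have h := hasSum_trace one_le_abs_diracEigenvalue (summable_absEigenvalue_rpow hz)
    (by linarith) T
  rw [← levelEquiv.hasSum_iff] at h
  refine (congrArg (HasSum · _) (funext fun N => ?_)).mp
    (h.sigma fun N => hasSum_fintype _)
  simp only [Function.comp, abs_diracEigenvalue_levelEquiv, levelTrace, Finset.sum_mul]

/-- If the diagonal entries of `T` within one spin are exponentially close to `F x y`, then so are the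
sums over rectangular blocks. -/
theorem norm_block_sub_le {s : Fin 2} {F : ℕ → ℕ → ℂ} {C r : ℝ} (hC : 0 ≤ C) (h0 : 0 < r) (h1 : r < 1)
    (h : ∀ k : SpinIndex, k.s = s → ‖T (ket k) k - F k.x k.y‖ ≤ C * r ^ k.twoJ) {a b N : ℕ}
    {k : Fin a × Fin b → SpinIndex} (hs : ∀ i, (k i).s = s) (hx : ∀ i, (k i).x = i.1)
    (hy : ∀ i, (k i).y = i.2) (hN : ∀ i, N ≤ (k i).twoJ) :
    ‖∑ i, T (ket (k i)) (k i) - ∑ x ∈ Finset.range a, ∑ y ∈ Finset.range b, F x y‖ ≤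
      a * b * (C * r ^ N) := by
  have e : ∑ x ∈ Finset.range a, ∑ y ∈ Finset.range b, F x y =
      ∑ i : Fin a × Fin b, F i.1 i.2 := by
    rw [Fintype.sum_prod_type, Finset.sum_range]
    exact Finset.sum_congr rfl fun x _ => Finset.sum_range _
  rw [e, ← Finset.sum_sub_distrib]
  refine (norm_sum_le_of_le _ (f := fun i : Fin a × Fin b => T (ket (k i)) (k i) - F i.1 i.2)
    (n := fun _ => C * r ^ N) fun i _ => ?_).trans (le_of_eq ?_)
  · have := h (k i) (hs i)
    rw [hx, hy] at this
    exact this.trans (mul_le_mul_of_nonneg_left (pow_le_pow_of_le_one h0.le h1.le (hN i)) hC)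
  · simp

/-- If the diagonal entries of `T` on up and on down kets are exponentially close to `F x y` and to
`G x y`, then the trace over an eigenspace of `|D|` is the sum of two rectangular sums, up to a rapidly
decaying error. -/
theorem rapidDecay_levelTrace_of {F G : ℕ → ℕ → ℂ} {r : ℝ} (h0 : 0 < r) (h1 : r < 1)
    (hF : ∃ C, 0 ≤ C ∧ ∀ k : SpinIndex, k.s = 0 → ‖T (ket k) k - F k.x k.y‖ ≤ C * r ^ k.twoJ)
    (hG : ∃ C, 0 ≤ C ∧ ∀ k : SpinIndex, k.s = 1 → ‖T (ket k) k - G k.x k.y‖ ≤ C * r ^ k.twoJ)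
    {f g : ℕ → ℂ}
    (hf : RapidDecay fun N => ∑ x ∈ Finset.range (N + 0 + 1), ∑ y ∈ Finset.range (N + 1 + 1), F x y -
      f N)
    (hg : RapidDecay fun N => ∑ x ∈ Finset.range (N + 1 + 1), ∑ y ∈ Finset.range (N + 0 + 1), G x y -
      g N) :
    RapidDecay fun N => levelTrace T N - (f N + g N) := by
  obtain ⟨C, hC, hF⟩ := hF
  obtain ⟨C', hC', hG⟩ := hG
  have card : ∀ N : ℕ, ((N + 1 : ℕ) : ℝ) * ((N + 2 : ℕ) : ℝ) ≤ level N ^ 2 := by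
    intro N
    rw [level]; push_cast; nlinarith
  have hr : ∀ N : ℕ, ‖((r ^ N : ℝ) : ℂ)‖ = r ^ N := fun N => by
    rw [Complex.norm_real, Real.norm_of_nonneg (pow_nonneg h0.le N)]
  have hrp : ∀ N : ℕ, 0 ≤ r ^ N := fun N => pow_nonneg h0.le N
  have r0 := (rapidDecay_geometric h0 h1).mono C 2
    (e' := fun N => ∑ i, T (ket (levelUp N i)) (levelUp N i) -
      ∑ x ∈ Finset.range (N + 0 + 1), ∑ y ∈ Finset.range (N + 1 + 1), F x y) fun N => by
    refine (norm_block_sub_le hC h0 h1 hF (a := N + 1) (b := N + 2) (N := N) (k := levelUp N)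
      (fun _ => rfl) (fun _ => rfl) (fun _ => rfl) fun _ => le_rfl).trans ?_
    rw [hr, mul_comm C (level N ^ 2), mul_assoc (level N ^ 2)]
    exact mul_le_mul_of_nonneg_right (card N) (mul_nonneg hC (hrp N))
  have r1 := (rapidDecay_geometric h0 h1).mono C' 2
    (e' := fun N => ∑ i, T (ket (levelDn N i)) (levelDn N i) -
      ∑ x ∈ Finset.range (N + 1 + 1), ∑ y ∈ Finset.range (N + 0 + 1), G x y) fun N => by
    refine (norm_block_sub_le hC' h0 h1 hG (a := N + 2) (b := N + 1) (N := N) (k := levelDn N)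
      (fun _ => rfl) (fun _ => rfl) (fun _ => rfl) fun _ => Nat.le_succ N).trans ?_
    rw [hr, mul_comm C' (level N ^ 2), mul_assoc (level N ^ 2), mul_comm ((N + 2 : ℕ) : ℝ)]
    exact mul_le_mul_of_nonneg_right (card N) (mul_nonneg hC' (hrp N))
  refine ((r0.add r1).add (hf.add hg)).mono 1 0 fun N => ?_
  rw [pow_zero, one_mul, one_mul]
  refine le_of_eq (congrArg norm ?_)
  have e : levelTrace T N = ∑ i, T (ket (levelUp N i)) (levelUp N i) +
      ∑ i, T (ket (levelDn N i)) (levelDn N i) := Fintype.sum_sum_type _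
  rw [e]
  ring

/-- The zeta function of an operator whose traces over the eigenspaces of `|D|` are asymptotically
quadratic in the eigenvalue. -/
theorem isZetaContinuation_levelSeries {A B C : ℂ}
    (h : RapidDecay fun N => levelTrace T N - (A * level N ^ 2 + B * level N + C)) :
    IsZetaContinuation 3 diracEigenvalue T (levelSeries A B C fun N => levelTrace T N -
      (A * level N ^ 2 + B * level N + C)) := by
  refine ⟨fun s _ => (hasResidue_levelSeries A B C h s).meromorphicAt, fun z hz =>
    ⟨isTraceClass_mul_absPow one_le_abs_diracEigenvalue (summable_absEigenvalue_rpow hz)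
      (by linarith) T, ?_⟩⟩
  refine (hasSum_levelSeries A B C h hz).unique ?_
  refine (congrArg (HasSum · _) (funext fun N => ?_)).mp (hasSum_levelTrace T hz)
  rw [add_sub_cancel]

end Zeta

theorem RapidDecay.collect {t : ℕ → ℂ} {a₂ a₁ a₀ b₂ b₁ b₀ : ℂ}
    (h : RapidDecay fun N => t N -
      ((a₂ * level N ^ 2 + a₁ * level N + a₀) + (b₂ * level N ^ 2 + b₁ * level N + b₀))) :
    RapidDecay fun N => t N - ((a₂ + b₂) * level N ^ 2 + (a₁ + b₁) * level N + (a₀ + b₀)) := by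
  refine h.mono 1 0 fun N => ?_
  rw [pow_zero, one_mul, one_mul]
  refine le_of_eq (congrArg norm ?_)
  ring

/-! ### Traces of operators with a symbol -/

section SymbolTraces
variable {q : Set.Ioo (0 : ℝ) 1} {T : SpinOp} {σ τ : SymbolAlgebra q}

theorem rapidDecay_symbolCoeff {c c' : ℂ} {d d' : ℕ} (hd : c + d = 3 / 2) (hd' : c' + d' = 3 / 2)
    (σ : SymbolAlgebra q) :
    RapidDecay fun N => ∑ x ∈ Finset.range (N + d + 1), ∑ y ∈ Finset.range (N + d' + 1),
        symbolCoeff x y x y 0 σ -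
      (tensorFunctional (tau1 q 1) (tau1 q (-1)) (restrictZero σ) * level N ^ 2 +
        (tensorFunctional (tau1 q 1) (tau0 q (-1) c') + tensorFunctional (tau0 q 1 c) (tau1 q (-1)))
          (restrictZero σ) * level N +
        tensorFunctional (tau0 q 1 c) (tau0 q (-1) c') (restrictZero σ)) := by
  simp only [symbolCoeff_diag]
  exact rapidDecay_blockTrace hd hd' (restrictZero σ)

theorem HasSpinSymbol.diag_bound {s : Fin 2} (h : HasSpinSymbol s T σ) : ∃ C : ℝ, 0 ≤ C ∧
    ∀ k : SpinIndex, k.s = s → ‖T (ket k) k - symbolCoeff k.x k.y k.x k.y 0 σ‖ ≤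
      C * rate q ^ k.twoJ := by
  obtain ⟨C, hC, h⟩ := h.entry_bound
  refine ⟨C, hC, fun k hk => ?_⟩
  have := h k k hk hk
  rwa [sub_self] at this

/-- The traces over the eigenspaces of `|D|` are quadratic in the eigenvalue, up to rapidly decaying
errors. -/
theorem rapidDecay_levelTrace (h0 : HasSpinSymbol 0 T σ) (h1 : HasSpinSymbol 1 T τ) :
    RapidDecay fun N => levelTrace T N -
      ((tensorFunctional (tau1 q 1) (tau1 q (-1)) (restrictZero σ) +
          tensorFunctional (tau1 q 1) (tau1 q (-1)) (restrictZero τ)) * level N ^ 2 +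
        ((tensorFunctional (tau1 q 1) (tauDn q (-1)) + tensorFunctional (tauUp q 1) (tau1 q (-1)))
            (restrictZero σ) +
          (tensorFunctional (tau1 q 1) (tauUp q (-1)) + tensorFunctional (tauDn q 1) (tau1 q (-1)))
            (restrictZero τ)) * level N +
        (tensorFunctional (tauUp q 1) (tauDn q (-1)) (restrictZero σ) +
          tensorFunctional (tauDn q 1) (tauUp q (-1)) (restrictZero τ))) :=
  (rapidDecay_levelTrace_of (F := fun x y => symbolCoeff x y x y 0 σ)
    (G := fun x y => symbolCoeff x y x y 0 τ) (rate_pos q) (rate_lt_one q) h0.diag_bound h1.diag_bound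
    -- Up kets with `2j = N`: there are `N + 1` values of `x` and `N + 2` values of `y`.
    (rapidDecay_symbolCoeff (c := 3 / 2) (c' := 1 / 2) (d := 0) (d' := 1) (by norm_num)
      (by norm_num) σ)
    -- Down kets with `2j = N + 1`: there are `N + 2` values of `x` and `N + 1` values of `y`.
    (rapidDecay_symbolCoeff (c := 1 / 2) (c' := 3 / 2) (d := 1) (d' := 0) (by norm_num)
      (by norm_num) τ)).collect

end SymbolTraces

/-! ### Residues and the dimension spectrum -/

section Residues
variable {f g : ℂ → ℂ} {s : ℂ}

theorem HasResidue.order_nonneg (hf : HasResidue f s 0) : 0 ≤ meromorphicOrderAt f s := by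
  obtain ⟨g, hg, hgs, he⟩ := hf.order_eq
  have h0 : meromorphicOrderAt g s ≠ 0 := by
    intro h
    obtain ⟨c, hc, hlim⟩ := (tendsto_ne_zero_iff_meromorphicOrderAt_eq_zero hg.meromorphicAt).mpr h
    refine hc (tendsto_nhds_unique hlim ?_)
    rw [← hgs]
    exact hg.continuousAt.tendsto.mono_left nhdsWithin_le_nhds
  have h1 := lt_of_le_of_ne hg.meromorphicOrderAt_nonneg h0.symm
  rw [he]
  generalize meromorphicOrderAt g s = o at h1
  induction o using WithTop.recTopCoe with
  | top => simp
  | coe n =>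
    have : 0 < n := by exact_mod_cast h1
    rw [← WithTop.coe_add]
    exact_mod_cast (by omega : 0 ≤ -1 + n)

end Residues

section Spectrum
variable {T : SpinOp} {A B C : ℂ}

theorem exists_zeta_of_rapidDecay
    (h : RapidDecay fun N => levelTrace T N - (A * level N ^ 2 + B * level N + C)) :
    ∃ f, IsZetaContinuation 3 diracEigenvalue T f ∧
      (∀ s, s ≠ 1 → s ≠ 2 → s ≠ 3 → HasResidue f s 0) ∧
      HasResidue f 3 A ∧ HasResidue f 2 B ∧ HasResidue f 1 C := by
  have hres := hasResidue_levelSeries A B C h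
  refine ⟨_, isZetaContinuation_levelSeries h, fun s h1 h2 h3 => ?_, ?_, ?_, ?_⟩
  · have := hres s
    rwa [if_neg (fun e => h3 (by linear_combination e)), if_neg (fun e => h2 (by linear_combination e)),
      if_neg h1, mul_zero, mul_zero, mul_zero, add_zero, add_zero, add_zero] at this
  · have := hres 3
    norm_num at this
    exact this
  · have := hres 2
    norm_num at this
    exact this
  · have := hres 1
    norm_num at this
    exact this

/-- Multiplication by `|D|^{-k}` translates the zeta function by `k`. -/
theorem hasNCInt_mul_absPow {f : ℂ → ℂ} (hf : IsZetaContinuation 3 diracEigenvalue T f) (k : ℝ)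
    (hk : 0 ≤ k) {v : ℂ} (hv : HasResidue f k v) :
    HasNCInt 3 diracEigenvalue (T * absPow diracEigenvalue (-(k : ℂ))) v := by
  refine ⟨fun z => f (z + k), ⟨fun s _ => ?_, fun z hz => ?_⟩, ?_⟩
  · exact meromorphicAt_fun_comp_add_const_iff_meromorphicAt.mpr
      (hf.meromorphic (s + k) (Set.mem_univ _))
  · have h := hf.eq_trace (z + k) (by simp; linarith)
    rw [mul_assoc, absPow_mul one_le_abs_diracEigenvalue (by simpa using hk)
      (by rw [Complex.neg_re]; linarith), ← neg_add, add_comm (k : ℂ)]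
    exact h
  · have := (HasResidue.comp_add (s := 0) (c := k) (f := f) (by rwa [zero_add])).2
    simpa using this

theorem hasNCInt_of_rapidDecay
    (h : RapidDecay fun N => levelTrace T N - (A * level N ^ 2 + B * level N + C)) :
    HasNCInt 3 diracEigenvalue (T * absPow diracEigenvalue (-3)) A ∧
      HasNCInt 3 diracEigenvalue (T * absPow diracEigenvalue (-2)) B ∧
      HasNCInt 3 diracEigenvalue (T * absPow diracEigenvalue (-1)) C := by
  obtain ⟨f, hf, -, h3, h2, h1⟩ := exists_zeta_of_rapidDecay h
  have k3 := hasNCInt_mul_absPow hf 3 (by norm_num) (by exact_mod_cast h3)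
  have k2 := hasNCInt_mul_absPow hf 2 (by norm_num) (by exact_mod_cast h2)
  have k1 := hasNCInt_mul_absPow hf 1 (by norm_num) (by exact_mod_cast h1)
  exact ⟨by exact_mod_cast k3, by exact_mod_cast k2, by exact_mod_cast k1⟩

theorem mem_dimensionSpectrum {𝒜 : Set SpinOp} (hT : T ∈ psiZero diracEigenvalue 𝒜)
    (h : RapidDecay fun N => levelTrace T N - (A * level N ^ 2 + B * level N + C)) :
    (A ≠ 0 → 3 ∈ dimensionSpectrum 3 diracEigenvalue 𝒜) ∧
      (B ≠ 0 → 2 ∈ dimensionSpectrum 3 diracEigenvalue 𝒜) ∧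
      (C ≠ 0 → 1 ∈ dimensionSpectrum 3 diracEigenvalue 𝒜) := by
  obtain ⟨f, hf, -, h3, h2, h1⟩ := exists_zeta_of_rapidDecay h
  exact ⟨fun hA => ⟨T, hT, f, hf, h3.order_neg hA⟩, fun hB => ⟨T, hT, f, hf, h2.order_neg hB⟩,
    fun hC => ⟨T, hT, f, hf, h1.order_neg hC⟩⟩

/-- A continuation of a zeta function is unique up to its values at isolated points, so its poles are
those of the continuation given by `levelSeries`. -/
theorem hasSimpleDimensionSpectrum_of {𝒜 : Set SpinOp}
    (h : ∀ T ∈ psiZero diracEigenvalue 𝒜, ∃ A B C : ℂ, RapidDecay fun N => levelTrace T N -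
      (A * level N ^ 2 + B * level N + C))
    (hmem : ({1, 2, 3} : Set ℂ) ⊆ dimensionSpectrum 3 diracEigenvalue 𝒜) :
    HasSimpleDimensionSpectrum 3 diracEigenvalue 𝒜 {1, 2, 3} where
  exists_continuation T hT := by
    obtain ⟨A, B, C, h⟩ := h T hT
    exact ⟨_, isZetaContinuation_levelSeries h⟩
  eq_spectrum := by
    refine Set.Subset.antisymm ?_ hmem
    rintro s ⟨T, hT, f, hf, hs⟩
    obtain ⟨A, B, C, h⟩ := h T hT
    obtain ⟨g, hg, hreg, -⟩ := exists_zeta_of_rapidDecay h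
    by_contra hmem
    simp only [Set.mem_insert_iff, Set.mem_singleton_iff, not_or] at hmem
    rw [meromorphicOrderAt_congr (eventuallyEq_of_eq_on_halfPlane hf.meromorphic hg.meromorphic
      (fun z hz => (hf.eq_trace z hz).2.trans (hg.eq_trace z hz).2.symm) s)] at hs
    exact absurd hs (not_lt.mpr (hreg s hmem.1 hmem.2.1 hmem.2.2).order_nonneg)
  simple T hT f hf s := by
    obtain ⟨A, B, C, h⟩ := h T hT
    have hg := isZetaContinuation_levelSeries h
    rw [meromorphicOrderAt_congr (eventuallyEq_of_eq_on_halfPlane hf.meromorphic hg.meromorphic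
      (fun z hz => (hf.eq_trace z hz).2.trans (hg.eq_trace z hz).2.symm) s)]
    exact (hasResidue_levelSeries A B C h s).neg_one_le_order

end Spectrum

/-! ### Values of the functionals -/

section Evaluation

theorem tensorFun_restrictZero_tmul {A B : Type*} [Ring A] [Algebra ℂ A] [Ring B] [Algebra ℂ B]
    (f : A →ₗ[ℂ] ℂ) (g : B →ₗ[ℂ] ℂ) (a : A) (b : B) :
    tensorFun f g (restrictZero ((a ⊗ₜ[ℂ] b) ⊗ₜ[ℂ] (LaurentPolynomial.T 0 : ℂ[T;T⁻¹]))) =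
      f a * g b := by
  rw [restrictZero_tmul_T, if_pos rfl, tensorFun_tmul]

theorem tensorFun_restrictZero_one {A B : Type*} [Ring A] [Algebra ℂ A] [Ring B] [Algebra ℂ B]
    (f : A →ₗ[ℂ] ℂ) (g : B →ₗ[ℂ] ℂ) :
    tensorFun f g (restrictZero (1 : (A ⊗[ℂ] B) ⊗[ℂ] ℂ[T;T⁻¹])) = f 1 * g 1 := by
  rw [Algebra.TensorProduct.one_def, Algebra.TensorProduct.one_def, ← LaurentPolynomial.T_zero,
    tensorFun_restrictZero_tmul]

theorem tmul_T_mul_tmul_T {A B : Type*} [Ring A] [Algebra ℂ A] [Ring B] [Algebra ℂ B]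
    (a a' : A) (b b' : B) (m m' : ℤ) :
    ((a ⊗ₜ[ℂ] b) ⊗ₜ[ℂ] (LaurentPolynomial.T m : ℂ[T;T⁻¹])) *
      ((a' ⊗ₜ[ℂ] b') ⊗ₜ[ℂ] (LaurentPolynomial.T m' : ℂ[T;T⁻¹])) =
      ((a * a') ⊗ₜ[ℂ] (b * b')) ⊗ₜ[ℂ] (LaurentPolynomial.T (m + m') : ℂ[T;T⁻¹]) := by
  rw [Algebra.TensorProduct.tmul_mul_tmul, Algebra.TensorProduct.tmul_mul_tmul,
    ← LaurentPolynomial.T_add]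

variable (q : Set.Ioo (0 : ℝ) 1) (ε : ℤˣ)

theorem tau1_one : tau1 q ε 1 = 1 := by
  change (symbol q ε 1).coeff 0 = 1
  rw [map_one]
  simp

theorem tau0_one (c : ℂ) : tau0 q ε c 1 = 1 - c := by
  refine tendsto_nhds_unique (tendsto_tau0 q ε c 1) ?_
  refine tendsto_const_nhds.congr fun N => ?_
  rw [tau1_one, truncTrace]
  simp [norm_ket]

theorem tau1_star_mul_rA : tau1 q ε (star (rA q ε) * rA q ε) = 1 := by
  change (symbol q ε (star (rA q ε) * rA q ε)).coeff 0 = 1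
  rw [map_mul, symbol_star_rA, symbol_rA, ← LaurentPolynomial.T_add]
  simp

theorem tau1_star_mul_rB : tau1 q ε (star (rB q ε) * rB q ε) = 0 := by
  change (symbol q ε (star (rB q ε) * rB q ε)).coeff 0 = 0
  rw [map_mul, symbol_rB, mul_zero]
  simp

/-- Since `σ` kills `b* b`, the value of `τ₀` is the trace `Σ_k q^(2k)`. -/
theorem tau0_star_mul_rB (c : ℂ) :
    tau0 q ε c (star (rB q ε) * rB q ε) = (1 - ((q : ℝ) : ℂ) ^ 2)⁻¹ := by
  have hq : ‖((q : ℝ) : ℂ) ^ 2‖ < 1 := by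
    rw [norm_pow, Complex.norm_real, Real.norm_of_nonneg q.2.1.le]
    exact pow_lt_one₀ q.2.1.le q.2.2 two_ne_zero
  have hs := ((hasSum_geometric_of_norm_lt_one hq).tendsto_sum_nat).comp (tendsto_add_atTop_nat 1)
  refine tendsto_nhds_unique (tendsto_tau0 q ε c _) (hs.congr fun N => ?_)
  rw [tau1_star_mul_rB, mul_zero, sub_zero, truncTrace]
  refine Finset.sum_congr rfl fun k _ => ?_
  have hb : (diskB q ε) (ket k) = ((ε : ℂ) * ((q : ℝ) : ℂ) ^ k) • ket k :=
    apply_ket_eq (hasMatrix_diskB q ε) k k _ fun k' => by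
      by_cases h : k' = k <;> simp [h]
  change _ = ⟪ket k, (star (rB q ε) : disk q ε).1 ((rB q ε).1 (ket k))⟫_ℂ
  rw [star_rB]
  change _ = ⟪ket k, (diskB q ε) ((diskB q ε) (ket k))⟫_ℂ
  rw [hb, map_smul, hb, smul_smul, inner_ket, lp.coeFn_smul, Pi.smul_apply, ket_apply_self]
  rcases Int.units_eq_one_or ε with rfl | rfl <;> simp <;> ring

end Evaluation

/-! ### The dimension spectrum and the noncommutative integrals -/

section Integrals
variable (q : Set.Ioo (0 : ℝ) 1)

theorem exists_rapidDecay_levelTrace {T : SpinOp} (hT : T ∈ algPsi q) :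
    ∃ A B C : ℂ, RapidDecay fun N => levelTrace T N - (A * level N ^ 2 + B * level N + C) := by
  obtain ⟨σ, hσ⟩ := exists_symbol_of_mem_algPsi q hT 0
  obtain ⟨τ, hτ⟩ := exists_symbol_of_mem_algPsi q hT 1
  exact ⟨_, _, _, rapidDecay_levelTrace hσ hτ⟩

/-- The zeta function of the unit has poles at `3` and `1`, with the residues `2 τ₁(1)² = 2` and
`2 τ₀↑(1) τ₀↓(1) = -1/2`. -/
theorem three_one_mem_dimensionSpectrum :
    3 ∈ dimensionSpectrum 3 diracEigenvalue (spinAlgebra q : Set SpinOp) ∧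
      1 ∈ dimensionSpectrum 3 diracEigenvalue (spinAlgebra q : Set SpinOp) := by
  have hs : ∀ s, HasSpinSymbol s (1 : SpinOp) (1 : SymbolAlgebra q) := fun s => by
    have := hasSpinSymbol_algebraMap (q := q) s 1
    rwa [map_one, map_one] at this
  have h := mem_dimensionSpectrum (one_mem (algPsi q)) (rapidDecay_levelTrace (hs 0) (hs 1))
  have e : ∀ (f : disk q 1 →ₗ[ℂ] ℂ) (g : disk q (-1) →ₗ[ℂ] ℂ),
      tensorFunctional f g (restrictZero (1 : SymbolAlgebra q)) = f 1 * g 1 :=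
    tensorFun_restrictZero_one
  refine ⟨h.1 ?_, h.2.2 ?_⟩
  · rw [e, tau1_one, tau1_one]; norm_num
  · rw [e, e, tau0_one, tau0_one, tau0_one, tau0_one]; norm_num

theorem diagPart_bPlus_mem_algPsi : diagPart (bPlus q) ∈ algPsi q := by
  rw [algPsi_eq]
  exact (add_mem (StarAlgebra.subset_adjoin ℂ _ (by simp [gensPsi]))
    (StarAlgebra.subset_adjoin ℂ _ (by simp [gensPsi])) :
      diagPart (bPlus q) ∈ StarAlgebra.adjoin ℂ (gensPsi q))

theorem star_diagPart_bPlus_mem_algPsi : star (diagPart (bPlus q)) ∈ algPsi q := by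
  have h := diagPart_bPlus_mem_algPsi q
  rw [algPsi_eq] at h ⊢
  exact (star_mem (s := StarAlgebra.adjoin ℂ (gensPsi q)) h : _)

theorem hasSpinSymbol_star_mul_diagPart_bPlus (s : Fin 2) :
    HasSpinSymbol s (star (diagPart (bPlus q)) * diagPart (bPlus q))
      (symb (star (rA q 1) * rA q 1) (star (rB q (-1)) * rB q (-1)) 0) := by
  have hb := hasSpinSymbol_diagPart_pair (bPlus_symbol (q := q))
  have hσ : -symb (star (rA q 1)) (star (rB q (-1))) (-1) * -symb (rA q 1) (rB q (-1)) 1 =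
      symb (star (rA q 1) * rA q 1) (star (rB q (-1)) * rB q (-1)) 0 :=
    (neg_mul_neg _ _).trans (tmul_T_mul_tmul_T _ _ _ _ _ _)
  exact hσ ▸ (hb.2 s).mul (hb.1 s)

theorem tensorFun_restrictZero_tmul_ne_zero {A B : Type*} [Ring A] [Algebra ℂ A] [Ring B]
    [Algebra ℂ B] (f g h : A →ₗ[ℂ] ℂ) (f' g' h' : B →ₗ[ℂ] ℂ) (a : A) (b : B) {c : ℂ} (hc : c ≠ 0)
    (hf : f a = 1) (hf' : f' b = 0) (hg' : g' b = c) (hh' : h' b = c) :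
    (tensorFun f h' + tensorFun g f')
        (restrictZero ((a ⊗ₜ[ℂ] b) ⊗ₜ[ℂ] (LaurentPolynomial.T 0 : ℂ[T;T⁻¹]))) +
      (tensorFun f g' + tensorFun h f')
        (restrictZero ((a ⊗ₜ[ℂ] b) ⊗ₜ[ℂ] (LaurentPolynomial.T 0 : ℂ[T;T⁻¹]))) ≠ 0 := by
  simp only [LinearMap.add_apply, tensorFun_restrictZero_tmul, hf, hf', hg', hh']
  simpa using hc

/-- The operator `b̃₊* b̃₊` has symbol `a*a ⊗ b*b`, on which `τ₁ ⊗ τ₀` does not vanish; it therefore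
has a pole at `2`. -/
theorem two_mem_dimensionSpectrum :
    2 ∈ dimensionSpectrum 3 diracEigenvalue (spinAlgebra q : Set SpinOp) := by
  refine (mem_dimensionSpectrum
    (mul_mem (star_diagPart_bPlus_mem_algPsi q) (diagPart_bPlus_mem_algPsi q))
    (rapidDecay_levelTrace (hasSpinSymbol_star_mul_diagPart_bPlus q 0)
      (hasSpinSymbol_star_mul_diagPart_bPlus q 1))).2.1
    (tensorFun_restrictZero_tmul_ne_zero (tau1 q 1) (tauUp q 1) (tauDn q 1) (tau1 q (-1))
      (tauUp q (-1)) (tauDn q (-1)) _ _ (c := (1 - ((q : ℝ) : ℂ) ^ 2)⁻¹) ?_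
      (tau1_star_mul_rA q 1) (tau1_star_mul_rB q (-1)) (tau0_star_mul_rB q (-1) _)
      (tau0_star_mul_rB q (-1) _))
  have : (1 : ℝ) - (q : ℝ) ^ 2 ≠ 0 := by nlinarith [q.2.1, q.2.2]
  exact inv_ne_zero (by exact_mod_cast this)

theorem hasSimpleDimensionSpectrum_spin :
    HasSimpleDimensionSpectrum 3 diracEigenvalue (spinAlgebra q : Set SpinOp) {1, 2, 3} := by
  refine hasSimpleDimensionSpectrum_of (fun T hT => exists_rapidDecay_levelTrace q hT) ?_
  rintro s (rfl | rfl | rfl)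
  exacts [(three_one_mem_dimensionSpectrum q).2, two_mem_dimensionSpectrum q,
    (three_one_mem_dimensionSpectrum q).1]

theorem tensorFun_add_add {A B : Type*} [AddCommGroup A] [Module ℂ A] [AddCommGroup B] [Module ℂ B]
    (f g h : A →ₗ[ℂ] ℂ) (f' g' h' : B →ₗ[ℂ] ℂ) (w : A ⊗[ℂ] B) :
    (tensorFun f h' + tensorFun g f') w + (tensorFun f g' + tensorFun h f') w =
      (tensorFun f (g' + h') + tensorFun (g + h) f') w := by
  simp only [tensorFun, TensorProduct.map_add_left, TensorProduct.map_add_right, LinearMap.comp_add,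
    LinearMap.add_apply]
  ring

/-- The noncommutative integrals of the elements of `Ψ⁰(𝒜)`. -/
theorem hasNCInt_algPsi (T : algPsi q) :
    HasNCInt 3 diracEigenvalue ((T : SpinOp) * absPow diracEigenvalue (-3))
        (tensorFunctional (tau1 q 1) (tau1 q (-1)) (restrictZero (rhoExt q T).1) +
          tensorFunctional (tau1 q 1) (tau1 q (-1)) (restrictZero (rhoExt q T).2)) ∧
      HasNCInt 3 diracEigenvalue ((T : SpinOp) * absPow diracEigenvalue (-2))
        ((tensorFunctional (tau1 q 1) (tauDn q (-1)) + tensorFunctional (tauUp q 1) (tau1 q (-1)))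
            (restrictZero (rhoExt q T).1) +
          (tensorFunctional (tau1 q 1) (tauUp q (-1)) + tensorFunctional (tauDn q 1) (tau1 q (-1)))
            (restrictZero (rhoExt q T).2)) ∧
      HasNCInt 3 diracEigenvalue ((T : SpinOp) * absPow diracEigenvalue (-1))
        (tensorFunctional (tauUp q 1) (tauDn q (-1)) (restrictZero (rhoExt q T).1) +
          tensorFunctional (tauDn q 1) (tauUp q (-1)) (restrictZero (rhoExt q T).2)) :=
  hasNCInt_of_rapidDecay
    (rapidDecay_levelTrace (hasSpinSymbol_rhoExt T).1 (hasSpinSymbol_rhoExt T).2)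

/-- The formulas for a pair of equal symbols. -/
theorem hasNCInt_doubled {A B : Type*} [AddCommGroup A] [Module ℂ A] [AddCommGroup B] [Module ℂ B]
    {f g h : A →ₗ[ℂ] ℂ} {f' g' h' : B →ₗ[ℂ] ℂ} {w : A ⊗[ℂ] B} {T₃ T₂ T₁ : SpinOp}
    (H : HasNCInt 3 diracEigenvalue T₃ (tensorFun f f' w + tensorFun f f' w) ∧
      HasNCInt 3 diracEigenvalue T₂ ((tensorFun f h' + tensorFun g f') w +
        (tensorFun f g' + tensorFun h f') w) ∧
      HasNCInt 3 diracEigenvalue T₁ (tensorFun g h' w + tensorFun h g' w)) :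
    HasNCInt 3 diracEigenvalue T₃ (2 * tensorFun f f' w) ∧
      HasNCInt 3 diracEigenvalue T₂ ((tensorFun f (g' + h') + tensorFun (g + h) f') w) ∧
      HasNCInt 3 diracEigenvalue T₁ ((tensorFun g h' + tensorFun h g') w) := by
  rwa [two_mul, ← tensorFun_add_add, LinearMap.add_apply (tensorFun g h')]

/-- The noncommutative integrals of the elements of `ℬ`. -/
theorem hasNCInt_algB (T : algB q) :
    HasNCInt 3 diracEigenvalue ((T : SpinOp) * absPow diracEigenvalue (-3))
        (2 * tensorFunctional (tau1 q 1) (tau1 q (-1)) (restrictZero (rho q T))) ∧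
      HasNCInt 3 diracEigenvalue ((T : SpinOp) * absPow diracEigenvalue (-2))
        ((tensorFunctional (tau1 q 1) (tauUp q (-1) + tauDn q (-1)) +
          tensorFunctional (tauUp q 1 + tauDn q 1) (tau1 q (-1))) (restrictZero (rho q T))) ∧
      HasNCInt 3 diracEigenvalue ((T : SpinOp) * absPow diracEigenvalue (-1))
        ((tensorFunctional (tauUp q 1) (tauDn q (-1)) +
          tensorFunctional (tauDn q 1) (tauUp q (-1))) (restrictZero (rho q T))) :=
  hasNCInt_doubled (hasNCInt_of_rapidDecay
    (rapidDecay_levelTrace (hasSpinSymbol_rho T 0) (hasSpinSymbol_rho T 1)))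

end Integrals
end SUq2
end

theorem mainTheorem1 (q : Set.Ioo (0 : ℝ) 1) :
    SUq2.HasSimpleDimensionSpectrum 3 SUq2.diracEigenvalue (SUq2.spinAlgebra q) {1, 2, 3} ∧
    ∃ ρ : SUq2.algB q →ₐ[ℂ] SUq2.SymbolAlgebra q,
      SUq2.IsSymbolMap q ρ ∧ (∀ ρ₁, SUq2.IsSymbolMap q ρ₁ → ρ₁ = ρ) ∧
      (∀ T : SUq2.algB q,
        SUq2.HasNCInt 3 SUq2.diracEigenvalue
          ((T : SUq2.SpinOp) * SUq2.absPow SUq2.diracEigenvalue (-3))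
          (2 * SUq2.tensorFunctional (SUq2.tau1 q 1) (SUq2.tau1 q (-1))
            (SUq2.restrictZero (ρ T))) ∧
        SUq2.HasNCInt 3 SUq2.diracEigenvalue
          ((T : SUq2.SpinOp) * SUq2.absPow SUq2.diracEigenvalue (-2))
          ((SUq2.tensorFunctional (SUq2.tau1 q 1) (SUq2.tauUp q (-1) + SUq2.tauDn q (-1)) +
              SUq2.tensorFunctional (SUq2.tauUp q 1 + SUq2.tauDn q 1) (SUq2.tau1 q (-1)))
            (SUq2.restrictZero (ρ T))) ∧
        SUq2.HasNCInt 3 SUq2.diracEigenvalue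
          ((T : SUq2.SpinOp) * SUq2.absPow SUq2.diracEigenvalue (-1))
          ((SUq2.tensorFunctional (SUq2.tauUp q 1) (SUq2.tauDn q (-1)) +
              SUq2.tensorFunctional (SUq2.tauDn q 1) (SUq2.tauUp q (-1)))
            (SUq2.restrictZero (ρ T)))) ∧
      ∃ ρ' : SUq2.algPsi q →ₐ[ℂ] SUq2.SymbolAlgebra q × SUq2.SymbolAlgebra q,
        SUq2.IsExtendedSymbolMap ρ ρ' ∧ (∀ ρ₁, SUq2.IsExtendedSymbolMap ρ ρ₁ → ρ₁ = ρ') ∧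
        ∀ T : SUq2.algPsi q,
          SUq2.HasNCInt 3 SUq2.diracEigenvalue
            ((T : SUq2.SpinOp) * SUq2.absPow SUq2.diracEigenvalue (-3))
            (SUq2.tensorFunctional (SUq2.tau1 q 1) (SUq2.tau1 q (-1))
                (SUq2.restrictZero (ρ' T).1) +
              SUq2.tensorFunctional (SUq2.tau1 q 1) (SUq2.tau1 q (-1))
                (SUq2.restrictZero (ρ' T).2)) ∧
          SUq2.HasNCInt 3 SUq2.diracEigenvalue
            ((T : SUq2.SpinOp) * SUq2.absPow SUq2.diracEigenvalue (-2))
            ((SUq2.tensorFunctional (SUq2.tau1 q 1) (SUq2.tauDn q (-1)) +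
                SUq2.tensorFunctional (SUq2.tauUp q 1) (SUq2.tau1 q (-1)))
                (SUq2.restrictZero (ρ' T).1) +
              (SUq2.tensorFunctional (SUq2.tau1 q 1) (SUq2.tauUp q (-1)) +
                SUq2.tensorFunctional (SUq2.tauDn q 1) (SUq2.tau1 q (-1)))
                (SUq2.restrictZero (ρ' T).2)) ∧
          SUq2.HasNCInt 3 SUq2.diracEigenvalue
            ((T : SUq2.SpinOp) * SUq2.absPow SUq2.diracEigenvalue (-1))
            (SUq2.tensorFunctional (SUq2.tauUp q 1) (SUq2.tauDn q (-1))
                (SUq2.restrictZero (ρ' T).1) +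
              SUq2.tensorFunctional (SUq2.tauDn q 1) (SUq2.tauUp q (-1))
                (SUq2.restrictZero (ρ' T).2)) := by
  exact ⟨SUq2.hasSimpleDimensionSpectrum_spin q, SUq2.rho q, SUq2.isSymbolMap_rho q,
    fun _ h => h.ext (SUq2.isSymbolMap_rho q), SUq2.hasNCInt_algB q, SUq2.rhoExt q,
    SUq2.isExtendedSymbolMap_rhoExt q, fun _ h => h.ext (SUq2.isExtendedSymbolMap_rhoExt q),
    SUq2.hasNCInt_algPsi q⟩
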